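/- **Setting.** Let $T,w_0,\nu^{\max}>0$, $K\in\mathbb N$, and let $(q^{ij})$ be a $K\times K$ generator matrix ($q^{ij}\ge0$ for $i\ne j$, rows summing to $0$). Let $\eta^{\mathbf Q}$ be a finite measure on $\mathbb R$ whose support $\operatorname{supp}(\eta)$ is a compact subset of $(-1,\infty)$. For $t\in[0,T]$, $i\le K$, $\nu\in[0,\infty)$ let $\eta^{\mathbf P}(t,e_i,\nu;\mathrm dz)$ be a measure on $\mathbb R$ equivalent to $\eta^{\mathbf Q}$, with a version $\varrho^i(t,\nu,z)$ of its density with respect to $\eta^{\mathbf Q}$ that is jointly measurable and such that for every $m<\infty$ there is a constant $C>0$ with $C^{-1}<\varrho^i(t,\nu,z)<C$ for all $t\in[0,T]$, $i\le K$, $\nu\in[0,m]$, $z\in\operatorname{supp}(\eta)$. Let $\widetilde{\mathcal X}=[0,T]\times[0,w_0]\times(0,\infty)\times\mathcal S^K$, with $\mathcal S^K=\{\pi\in[0,1]^K:\sum_i\pi^i=1\}$, and write $\widetilde x=(t,w,s,\pi)$. Put $u^i(t,\nu,\pi,z)=\varrho^i(t,\nu,z)/\sum_j\pi^j\varrho^j(t,\nu,z)-1$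 and define the vector field $g$ by $g^1=1$, $g^2=-\nu$, $g^3=0$, $$g^{k+3}(\widetilde x,\nu)=\sum_jq^{jk}\pi^j-\pi^k\sum_j\pi^j\int u^k(t,\nu,\pi,z)\,\eta^{\mathbf P}(t,e_j,\nu;\mathrm dz),\qquad k=1,\dots,K,$$ the jump rate $\lambda(\widetilde x,\nu)=\sum_j\pi^j\eta^{\mathbf P}(t,e_j,\nu;\mathbb R)$, and the jump kernel $$Q_{\widetilde X}f(\widetilde x,\nu)=\frac1{\lambda(\widetilde x,\nu)}\sum_j\pi^j\int f\big(t,w,s(1+z),(\pi^i(1+u^i(t,\nu,\pi,z)))_{i\le K}\big)\,\eta^{\mathbf P}(t,e_j,\nu;\mathrm dz).$$ An admissible open-loop strategy is a sequence $\{\nu^n\}_{n\ge0}$ of maps from $\widetilde{\mathcal X}$ to the set $\mathcal A$ of measurable functions $[0,T]\to[0,\nu^{\max}]$ (with $(\widetilde x,u)\mapsto\nu^n(u,\widetilde x)$ measurable). The selling rate is $\nu_t=\sum_n\mathbf 1_{(T_n\wedge\tau,T_{n+1}\wedge\tau]}(t)\,\nu^n(t-T_n,\widetilde X_{T_n})$,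 where $T_0$ is the initial time, $T_1<T_2<\dots$ are the jump times and $\tau$ is the minimum of $T$ and the first time the inventory is $\le0$. A PDMP started in $\widetilde x=(t_0,x)$ with characteristics $g,\lambda,Q_{\widetilde X}$ is a process $\widetilde X$ on $[t_0,T]$ with $\widetilde X_{t_0}=\widetilde x$ and with jump times that do not accumulate, which between jumps solves $\mathrm d\widetilde X_t=g(\widetilde X_t,\nu_t)\,\mathrm dt$ in $\widetilde{\mathcal X}$ (in integrated form), for which, given the past up to $T_n$, $T_{n+1}$ exceeds $t\in[T_n,T]$ with probability $\exp(-\int_{T_n}^t\lambda\,\mathrm dr)$, $\lambda$ being evaluated along the solution of the ODE started in $\widetilde X_{T_n}$, and for which, given in addition $T_{n+1}\le T$, $\widetilde X_{T_{n+1}}$ has law $Q_{\widetilde X}(\widetilde X_{T_{n+1}-},\nu_{T_{n+1}};\cdot)$. **Proposition.** Let $\{\nu^n\}$ be an admissible open-loop strategy and $\widetilde x=(t_0,w,s,\pi_0)\in\widetilde{\mathcal X}$. 1. For all $n$ and $\widetilde y\in\widetilde{\mathcal X}$ the controlled ODE started in $\widetilde y$ under the policy $\nu^n(\cdot,\widetilde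 y)$ (selling being stopped when the inventory is zero) has a unique solution in $\widetilde{\mathcal X}$ up to the horizon. There is a PDMP with characteristics $g,\lambda,Q_{\widetilde X}$ started in $\widetilde x$ under $\{\nu^n\}$, and any two such PDMPs have the same law on path space. 2. In particular, the Kushner–Stratonovich equation has a unique solution, in the following sense. Let $R$ be a return process on $[t_0,T]$ whose trajectories are piecewise constant with finitely many jumps, at times $T_n\in(t_0,T]$ and of nonzero sizes in $\operatorname{supp}(\eta)$, let $\mu^R$ be its jump measure, and let $(\mathcal F_t)$ be the information generated by the jump times and sizes up to $t$. Consider $$\pi^i_t=\pi^i_0+\int_{t_0}^t\sum_jq^{ji}\pi^j_r\,\mathrm dr+\int_{t_0}^t\!\int_{\mathbb R}\pi^i_{r-}\,u^i(r,\nu_r,\pi_{r-},z)\Big(\mu^R(\mathrm dr,\mathrm dz)-\sum_j\pi^j_{r-}\eta^{\mathbf P}(r,e_j,\nu_r;\mathrm dz)\,\mathrm dr\Big)$$ for $t\in[t_0,T]$, $i\le K$. (a) Under the strategy $\{\nu^n\}$, i.e. with $\nu_t$ as above, $\widetilde X_t=(t,W_t,S_t,\pi_t)$, $W_t=w-\int_{t_0}^t\nu_r\,\mathrm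 dr$ and $S_t=s\prod_{t_0<T_n\le t}(1+\Delta R_{T_n})$, there is an $(\mathcal F_t)$-adapted process $(t,W,S,\pi)$ such that $\pi$ is càdlàg, $\mathcal S^K$-valued and solves the equation; for every trajectory of $R$ the solution is unique on $[t_0,T]$. (b) The same holds for $\pi$ when $(\nu_t)$ is any given $[0,\nu^{\max}]$-valued selling rate that is progressively measurable with respect to $(\mathcal F_t)$. -/

import Mathlib

open MeasureTheory ProbabilityTheory Set Filter Topology
open scoped ENNReal

universe u v

namespace Liquidation

noncomputable section

/-- The data of the liquidation model with a hidden Markov chain on `K` states: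
horizon `T`, initial inventory `w0`, maximal selling rate `νmax`, generator matrix `q` of the chain,
reference jump measure `ηQ`, jump measures `ηP t i ν` of the returns under the historical measure
(chain in state `i`, time `t`, selling rate `ν`), and a jointly measurable version
`dens t i ν z` of the Radon-Nikodym density of `ηP t i ν` with respect to `ηQ`. -/
structure Model (K : ℕ) where
  T : ℝ
  T_pos : 0 < T
  w0 : ℝ
  w0_pos : 0 < w0
  νmax : ℝ
  νmax_pos : 0 < νmax
  q : Matrix (Fin K) (Fin K) ℝ
  q_nonneg : ∀ i j, i ≠ j → 0 ≤ q i j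
  q_row_sum : ∀ i, ∑ j, q i j = 0
  ηQ : Measure ℝ
  ηQ_finite : IsFiniteMeasure ηQ
  ηP : ℝ → Fin K → ℝ → Measure ℝ
  dens : ℝ → Fin K → ℝ → ℝ → ℝ
  dens_measurable : ∀ i, Measurable fun p : ℝ × ℝ × ℝ => dens p.1 i p.2.1 p.2.2
  ηP_eq : ∀ t ∈ Icc 0 T, ∀ i, ∀ ν, 0 ≤ ν →
    ηP t i ν = ηQ.withDensity fun z => ENNReal.ofReal (dens t i ν z)

/-- States `(t, w, s, π)`: time, inventory, bid price, conditional state probabilities. -/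
abbrev State (K : ℕ) : Type := ℝ × ℝ × ℝ × (Fin K → ℝ)

variable {K : ℕ}

namespace Model

/-- The regularity assumption on the jump measures. -/
structure RegularJumps (M : Model K) : Prop where
  isCompact_support : IsCompact M.ηQ.support
  support_subset : M.ηQ.support ⊆ Ioi (-1)
  equivalent : ∀ t ∈ Icc 0 M.T, ∀ i, ∀ ν, 0 ≤ ν → M.ηP t i ν ≪ M.ηQ ∧ M.ηQ ≪ M.ηP t i ν
  dens_bounds : ∀ m : ℝ, 0 ≤ m → ∃ C : ℝ, 0 < C ∧
    ∀ t ∈ Icc 0 M.T, ∀ i, ∀ ν ∈ Icc 0 m, ∀ z ∈ M.ηQ.support,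
      C⁻¹ < M.dens t i ν z ∧ M.dens t i ν z < C

/-- The state space `[0,T] × [0,w0] × (0,∞) × S^K`. -/
def stateSpace (M : Model K) : Set (State K) :=
  Icc 0 M.T ×ˢ Icc 0 M.w0 ×ˢ Ioi 0 ×ˢ stdSimplex ℝ (Fin K)

/-- `u^i(t,ν,π,z)`: relative update of the `i`-th conditional probability at a jump of size `z`. -/
def upd (M : Model K) (i : Fin K) (t ν : ℝ) (π : Fin K → ℝ) (z : ℝ) : ℝ :=
  M.dens t i ν z / (∑ j, π j * M.dens t j ν z) - 1

/-- The controlled vector field `g`. -/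
def g (M : Model K) : State K → ℝ → State K := fun (t, _, _, π) ν =>
  (1, -ν, 0, fun k =>
    ∑ j, M.q j k * π j - π k * ∑ j, π j * ∫ z, M.upd k t ν π z ∂(M.ηP t j ν))

/-- The controlled jump rate `λ`. -/
def jumpRate (M : Model K) : State K → ℝ → ℝ := fun (t, _, _, π) ν =>
  ∑ j, π j * (M.ηP t j ν).real univ

/-- The state directly after a jump of the return process of size `z`. -/
def jumpTo (M : Model K) : State K → ℝ → ℝ → State K := fun (t, w, s, π) ν z =>
  (t, w, s * (1 + z), fun i => π i * (1 + M.upd i t ν π z))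

/-- The unnormalized jump kernel. -/
def jumpKernelBar (M : Model K) (x : State K) (ν : ℝ) : Measure (State K) :=
  ∑ j, ENNReal.ofReal (x.2.2.2 j) • (M.ηP x.1 j ν).map (M.jumpTo x ν)

/-- The jump kernel `Q(x, ν; dy)`. -/
def jumpKernel (M : Model K) (x : State K) (ν : ℝ) : Measure (State K) :=
  (ENNReal.ofReal (M.jumpRate x ν))⁻¹ • M.jumpKernelBar x ν

/-- Admissible open-loop strategies: the `n`-th policy sends the state `x` at the `n`-th jump time
to a selling rate `u ↦ ν n x u` in `[0, νmax]`, `u` being the time elapsed since that jump. -/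
structure IsAdmissible (M : Model K) (ν : ℕ → State K → ℝ → ℝ) : Prop where
  measurable : ∀ n, Measurable fun p : State K × ℝ => ν n p.1 p.2
  mem_Icc : ∀ n, ∀ x ∈ M.stateSpace, ∀ u ∈ Icc 0 M.T, ν n x u ∈ Icc 0 M.νmax

/-- The selling rate that is effective at time `u` after a jump if the inventory after that jump
is `w` and the policy `α` is chosen: selling stops when the inventory has been liquidated. -/
def effRate (α : ℝ → ℝ) (w u : ℝ) : ℝ :=
  open Classical in if ∀ v ∈ Ico 0 u, ∫ r in (0 : ℝ)..v, α r < w then α u else 0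

/-- `φ` solves the controlled ODE `dX = g(X, α) du`, `X 0 = x` (in integrated form, the policy being
merely measurable in time) in the state space until the horizon is reached. -/
structure IsFlow (M : Model K) (α : ℝ → ℝ) (x : State K) (φ : ℝ → State K) : Prop where
  mem : ∀ u ∈ Icc 0 (M.T - x.1), φ u ∈ M.stateSpace
  integrable : IntervalIntegrable (fun v => M.g (φ v) (effRate α x.2.1 v)) volume 0 (M.T - x.1)
  eq : ∀ u ∈ Icc 0 (M.T - x.1),
    φ u = x + ∫ v in (0 : ℝ)..u, M.g (φ v) (effRate α x.2.1 v)

/-- The flow of the controlled ODE started in `x` under the policy `α` (used only on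
`[0, T - x.1]`, where the solution is unique). -/
def flow (M : Model K) (α : ℝ → ℝ) (x : State K) : ℝ → State K :=
  Classical.epsilon (M.IsFlow α x)

/-- The cumulated jump rate `Λ_u` along the flow. -/
def cumRate (M : Model K) (α : ℝ → ℝ) (x : State K) (u : ℝ) : ℝ :=
  ∫ v in (0 : ℝ)..u, M.jumpRate (M.flow α x v) (effRate α x.2.1 v)

/-- The history `σ(T_0, Z_0, …, T_n, Z_n)`. -/
abbrev jumpHist {Ω : Type*} (Tn : ℕ → Ω → ℝ≥0∞) (Z : ℕ → Ω → State K) (n : ℕ) :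
    MeasurableSpace Ω :=
  MeasurableSpace.comap (fun ω (k : Finset.Iic n) => (Tn k ω, Z k ω)) inferInstance

/-- `X` is a piecewise deterministic process on `[x.1, T]` with characteristics `g`, `jumpRate`,
`jumpKernel` under the open-loop strategy `ν`, started in `x`, with jump times `Tn` (`Tn 0` is the
initial time, and `⊤` means that there is no further jump up to `T`) and with state `Z n` at the
`n`-th jump time. -/
structure IsPDMPWith (M : Model K) (ν : ℕ → State K → ℝ → ℝ) (x : State K)
    {Ω : Type*} [MeasurableSpace Ω] (P : Measure Ω) (X : ℝ → Ω → State K)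
    (Tn : ℕ → Ω → ℝ≥0∞) (Z : ℕ → Ω → State K) : Prop where
  measurable_X : ∀ t ∈ Icc x.1 M.T, Measurable (X t)
  measurable_T : ∀ n, Measurable (Tn n)
  measurable_Z : ∀ n, Measurable (Z n)
  initial : ∀ᵐ ω ∂P, Tn 0 ω = ENNReal.ofReal x.1 ∧ Z 0 ω = x
  increasing : ∀ᵐ ω ∂P, ∀ n, (Tn n ω < ⊤ → Tn n ω < Tn (n + 1) ω) ∧
    (Tn n ω = ⊤ → Tn (n + 1) ω = ⊤)
  /-- No accumulation of jump times. -/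
  nonexplosive : ∀ᵐ ω ∂P, ∃ n, Tn n ω = ⊤
  mem : ∀ᵐ ω ∂P, ∀ n, Tn n ω < ⊤ → Z n ω ∈ M.stateSpace ∧ ENNReal.ofReal (Z n ω).1 = Tn n ω
  /-- Between two jump times the process follows the controlled flow. -/
  eq_flow : ∀ᵐ ω ∂P, ∀ n, ∀ t ∈ Icc x.1 M.T,
    Tn n ω ≤ ENNReal.ofReal t → ENNReal.ofReal t < Tn (n + 1) ω →
      X t ω = M.flow (ν n (Z n ω)) (Z n ω) (t - (Z n ω).1)
  /-- Law of the next jump time given the past up to the `n`-th jump. -/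
  survival : ∀ n, ∀ t ∈ Icc x.1 M.T, ∀ᵐ ω ∂P, Tn n ω ≤ ENNReal.ofReal t →
    (P⟦{ω' | ENNReal.ofReal t < Tn (n + 1) ω'} | jumpHist Tn Z n⟧) ω =
      Real.exp (- M.cumRate (ν n (Z n ω)) (Z n ω) (t - (Z n ω).1))
  /-- Law of the state at the next jump time given the past and the next jump time. -/
  jump_law : ∀ n, ∀ A : Set (State K), MeasurableSet A → ∀ᵐ ω ∂P, Tn (n + 1) ω < ⊤ →
    (P⟦Z (n + 1) ⁻¹' A |
        jumpHist Tn Z n ⊔ MeasurableSpace.comap (Tn (n + 1)) inferInstance⟧) ω =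
      (M.jumpKernel
        (M.flow (ν n (Z n ω)) (Z n ω) ((Tn (n + 1) ω).toReal - (Z n ω).1))
        (effRate (ν n (Z n ω)) (Z n ω).2.1 ((Tn (n + 1) ω).toReal - (Z n ω).1))).real A

/-- `X` is a PDMP with characteristics `g`, `jumpRate`, `jumpKernel` under the open-loop strategy
`ν`, started in `x`. -/
def IsPDMP (M : Model K) (ν : ℕ → State K → ℝ → ℝ) (x : State K)
    {Ω : Type*} [MeasurableSpace Ω] (P : Measure Ω) (X : ℝ → Ω → State K) : Prop :=
  ∃ (Tn : ℕ → Ω → ℝ≥0∞) (Z : ℕ → Ω → State K), M.IsPDMPWith ν x P X Tn Z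

/-- The law on the path space of a process on `[t0, T]`. -/
def pathLaw (M : Model K) (t0 : ℝ) {Ω : Type*} [MeasurableSpace Ω] (P : Measure Ω)
    (X : ℝ → Ω → State K) : Measure (Icc t0 M.T → State K) :=
  P.map fun ω t => X t ω

/-- A trajectory of the return process on `[t0, T]`: `τ 0 = t0`, and for `n ≥ 1` the `n`-th jump is
of size `ζ n` and takes place at the time `τ n` (`⊤` if there is no such jump). There are finitely
many jumps, and their sizes are nonzero and lie in the support of the jump measures. -/
structure IsReturnPath (M : Model K) (t0 : ℝ) (τ : ℕ → ℝ≥0∞) (ζ : ℕ → ℝ) : Prop where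
  initial : τ 0 = ENNReal.ofReal t0
  increasing : ∀ n, (τ n < ⊤ → τ n < τ (n + 1)) ∧ (τ n = ⊤ → τ (n + 1) = ⊤)
  finite : ∃ n, τ n = ⊤
  le_horizon : ∀ n, τ n < ⊤ → τ n ≤ ENNReal.ofReal M.T
  size : ∀ n, τ (n + 1) < ⊤ → ζ (n + 1) ∈ M.ηQ.support ∧ ζ (n + 1) ≠ 0

/-- The information generated by the return process up to time `t`, i.e. by the jump times and
jump sizes up to `t`. -/
abbrev returnFiltration {Ω : Type*} (τ : ℕ → Ω → ℝ≥0∞) (ζ : ℕ → Ω → ℝ) (t : ℝ) :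
    MeasurableSpace Ω :=
  MeasurableSpace.generateFrom {A | ∃ n, ∃ s, s ≤ t ∧ ∃ B : Set ℝ, MeasurableSet B ∧
    A = {ω | τ (n + 1) ω ≤ ENNReal.ofReal s ∧ ζ (n + 1) ω ∈ B}}

/-- `π` is a càdlàg, simplex-valued solution on `[t0, T]`, started in `π0`, of the
Kushner-Stratonovich equation driven by the return path with jump times `τ` and jump sizes `ζ`,
for the selling rate `t ↦ rate t`. The integral with respect to the jump measure of the
returns over `(t0, t]` is the sum over the jumps up to `t`. -/
structure SolvesKS (M : Model K) (t0 : ℝ) (π0 : Fin K → ℝ) (τ : ℕ → ℝ≥0∞) (ζ : ℕ → ℝ)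
    (rate : ℝ → ℝ) (π : ℝ → Fin K → ℝ) : Prop where
  mem : ∀ t ∈ Icc t0 M.T, π t ∈ stdSimplex ℝ (Fin K)
  right_cont : ∀ t ∈ Ico t0 M.T, ContinuousWithinAt π (Ici t) t
  left_lim : ∀ t ∈ Ioc t0 M.T, ∃ l, Tendsto π (𝓝[<] t) (𝓝 l)
  eq : ∀ t ∈ Icc t0 M.T, ∀ i,
    π t i = π0 i
      + (∫ r in t0..t, ∑ j, M.q j i * π r j)
      + (∑' n : ℕ, open Classical in if τ (n + 1) ≤ ENNReal.ofReal t then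
          Function.leftLim π (τ (n + 1)).toReal i *
            M.upd i (τ (n + 1)).toReal (rate (τ (n + 1)).toReal)
              (Function.leftLim π (τ (n + 1)).toReal) (ζ (n + 1))
        else 0)
      - ∫ r in t0..t, ∑ j, Function.leftLim π r j *
          ∫ z, Function.leftLim π r i * M.upd i r (rate r) (Function.leftLim π r) z
            ∂(M.ηP r j (rate r))

/-- The selling rate at time `t` of a trader who uses the open-loop strategy `ν`, when `X` is the
trajectory of the state started at time `t0` and `τ` are the jump times: the `n`-th policy is used
on `(τ n, τ (n+1)]`, up to the time at which the inventory is liquidated. -/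
def sellingRate (ν : ℕ → State K → ℝ → ℝ) (t0 : ℝ) (τ : ℕ → ℝ≥0∞)
    (X : ℝ → State K) (t : ℝ) : ℝ :=
  ∑' n : ℕ, open Classical in
    if τ n < ENNReal.ofReal t ∧ ENNReal.ofReal t ≤ τ (n + 1) ∧ ∀ r ∈ Ico t0 t, 0 < (X r).2.1
    then ν n (X (τ n).toReal) (t - (τ n).toReal) else 0

/-- `X = (t, W, S, π)` is a trajectory of the state under the open-loop strategy `ν`, started in
`x`, driven by the given return path: `W` is the inventory, `S` the bid price (the stochastic
exponential of the returns), and `π` solves the Kushner-Stratonovich equation. -/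
structure SolvesState (M : Model K) (ν : ℕ → State K → ℝ → ℝ) (x : State K)
    (τ : ℕ → ℝ≥0∞) (ζ : ℕ → ℝ) (X : ℝ → State K) : Prop where
  time : ∀ t ∈ Icc x.1 M.T, (X t).1 = t
  inventory : ∀ t ∈ Icc x.1 M.T,
    (X t).2.1 = x.2.1 - ∫ r in x.1..t, sellingRate ν x.1 τ X r
  price : ∀ t ∈ Icc x.1 M.T,
    (X t).2.2.1 = x.2.2.1 * ∏' n : ℕ, open Classical in
      if τ (n + 1) ≤ ENNReal.ofReal t then 1 + ζ (n + 1) else 1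
  filter : M.SolvesKS x.1 x.2.2.2 τ ζ (sellingRate ν x.1 τ X) fun t => (X t).2.2.2

end Model

end

end Liquidation

/-! The drift of the filter looks rational in `π`, but it is not. The denominator of `u^k` is the
weight `Σ_j π_j ρ_j` against which the compensator integrates, so the compensator collapses to `a_k
- Σ_j π_j a_j`, where `a_k` is the total jump mass in state `k` (`sum_integral_upd`). Between jumps
the filter therefore solves `π_i' = Σ_j q_ji π_j - π_i (a_i - Σ_j π_j a_j)`, whose coefficients are
bounded but merely measurable in time.

Existence for this equation comes from the unnormalized filter, which is linear: `p' = (qᵀ + c -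
diag a) p`. For large `c` all coefficients are nonnegative, the Picard iterates increase in `ℝ≥0∞`,
and their total mass is bounded by `exp (c t)`. Dividing the limit by its total mass removes `c` and
gives a simplex-valued solution (`filterSol_spec`). The construction is jointly measurable in all
its data and uses the coefficients only up to the current time, so it also supplies the
measurability of the kernels and the adaptedness of the filter. Uniqueness is Gronwall's lemma,
since the quadratic field is Lipschitz on the simplex (`filterODE_unique`). Time, inventory and
price have explicit formulas, so the controlled ODE is settled by `isFlow_flowSol` and
`IsFlow.eqOn_flowSol`.

For the PDMP, consider the chain of marks (jump time, state after the jump). Given the last mark,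
the next jump time has density `λ exp (-Λ)` up to the horizon, with the remaining mass at `⊤`; the
next state has the jump kernel as its law. The Ionescu-Tulcea theorem yields the chain (`chainLaw`).
Because `λ` is bounded, a suitable moment `E exp (-a T_n)` is at least halved by each jump, which
excludes accumulation before `T` (`chainLaw_nonexplosive`). Conversely, the survival and jump laws
of an arbitrary PDMP determine the conditional law of its next mark, so its marks have law
`chainLaw` once the irrelevant states at time `⊤` are normalized (`IsPDMPWith.map_marks`). The path
is almost surely a fixed measurable function of the marks, hence its law is determined
(`IsPDMPWith.pathLaw_eq`).

On a given return path, the Kushner-Stratonovich equation is the same ODE between jumps together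
with multiplication by `1 + u^i` at jumps, so solutions are glued from pieces (`IsPieced.solvesKS`).
For uniqueness, argue jump by jump: if two solutions agree before a jump, their left limits there
agree, the jump sums cancel, and Gronwall's lemma applies up to the next jump (`SolvesKS.unique`).
Under an open-loop strategy the selling rate itself depends on the solution, but only through the
states after jumps and the positivity of the past inventory. On each segment the rate is therefore
identified first, and the filter compared afterwards (`SolvesState.eqOn_succ`). -/

namespace Liquidation

noncomputable section

/-! ### Analysis on the line -/

/-- Gronwall's lemma in integral form, for an integrable function with initial value zero. -/
theorem eq_zero_of_le_integral {h : ℝ → ℝ} {s e L : ℝ}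
    (hint : IntervalIntegrable h volume s e) (h0 : ∀ t ∈ Icc s e, 0 ≤ h t)
    (hle : ∀ t ∈ Icc s e, h t ≤ L * ∫ r in s..t, h r) : ∀ t ∈ Icc s e, h t = 0 := by
  intro t0 ht0
  have hse : s ≤ e := ht0.1.trans ht0.2
  have hint' : IntegrableOn h (Icc s e) := by
    rwa [intervalIntegrable_iff_integrableOn_Icc_of_le hse] at hint
  have hsub : ∀ t ∈ Icc s e, IntervalIntegrable h volume s t := fun t ht =>
    hint.mono_set (by rw [uIcc_of_le ht.1, uIcc_of_le hse]; exact Icc_subset_Icc le_rfl ht.2)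
  set E : ℝ → ℝ := fun t => ∫ r in s..t, h r with hE
  have hu : uIcc s e = Icc s e := uIcc_of_le hse
  have hEc : ContinuousOn E (Icc s e) :=
    hu ▸ intervalIntegral.continuousOn_primitive_interval (by rwa [hu])
  have hE0 : ∀ t ∈ Icc s e, 0 ≤ E t := fun t ht =>
    intervalIntegral.integral_nonneg ht.1 fun r hr => h0 r ⟨hr.1, hr.2.trans ht.2⟩
  have hEi : ∀ t ∈ Icc s e, IntervalIntegrable E volume s t := fun t ht =>
    (hEc.mono (by rw [uIcc_of_le ht.1]; exact Icc_subset_Icc le_rfl ht.2)).intervalIntegrable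
  -- Since `h` is only integrable, its primitive `E` need not be differentiable everywhere. The
  -- classical Gronwall lemma is applied to the second primitive `D`, whose derivative `E` is
  -- continuous and satisfies `E ≤ L * D`.
  set D : ℝ → ℝ := fun t => ∫ r in s..t, E r with hD
  have hED : ∀ t ∈ Icc s e, E t ≤ L * D t := by
    intro t ht
    rw [hD, ← intervalIntegral.integral_const_mul]
    exact intervalIntegral.integral_mono_on ht.1 (hsub t ht) ((hEi t ht).const_mul L)
      fun r hr => hle r ⟨hr.1, hr.2.trans ht.2⟩
  have hD0 : ∀ t ∈ Icc s e, 0 ≤ D t := fun t ht =>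
    intervalIntegral.integral_nonneg ht.1 fun r hr => hE0 r ⟨hr.1, hr.2.trans ht.2⟩
  have hDc : ContinuousOn D (Icc s e) :=
    hu ▸ intervalIntegral.continuousOn_primitive_interval (by rw [hu]; exact hEc.integrableOn_Icc)
  have hDd : ∀ x ∈ Ico s e, HasDerivWithinAt D (E x) (Ici x) x := by
    intro x hx
    have hx' : x ∈ Icc s e := ⟨hx.1, hx.2.le⟩
    have hcw : ContinuousWithinAt E (Ici x) x :=
      (hEc x hx').mono_of_mem_nhdsWithin
        (mem_of_superset (Icc_mem_nhdsGE hx.2) (Icc_subset_Icc hx.1 le_rfl))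
    refine intervalIntegral.integral_hasDerivWithinAt_right (hEi x hx') ?_ (t := Ioi x)
        (hcw.mono Ioi_subset_Ici_self)
    exact ⟨Ioc x e, Ioc_mem_nhdsGT hx.2, (hEc.mono (fun y hy => ⟨hx.1.trans hy.1.le, hy.2⟩)
      ).aestronglyMeasurable measurableSet_Ioc⟩
  have hg := norm_le_gronwallBound_of_norm_deriv_right_le (f := D) (f' := E) (δ := 0) (K := L)
    (ε := 0) hDc hDd (by simp [hD]) (fun x hx => by
      have hx' : x ∈ Icc s e := ⟨hx.1, hx.2.le⟩
      rw [Real.norm_of_nonneg (hE0 x hx'), Real.norm_of_nonneg (hD0 x hx'), add_zero]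
      exact hED x hx') t0 ht0
  rw [gronwallBound_ε0_δ0, norm_le_zero_iff] at hg
  have hE00 : E t0 = 0 := le_antisymm (by simpa [hg] using hED t0 ht0) (hE0 t0 ht0)
  refine le_antisymm ?_ (h0 t0 ht0)
  have := hle t0 ht0
  rw [show (∫ r in s..t0, h r) = 0 from hE00, mul_zero] at this
  exact this

/-- The moving endpoints are absorbed into the integrand as the indicator of a measurable set in the
product, after which the integral over a fixed space is measurable in the parameter. -/
theorem measurable_intervalIntegral {Θ : Type*} [MeasurableSpace Θ] {f : Θ → ℝ → ℝ}
    (hf : Measurable (Function.uncurry f)) {a b : Θ → ℝ} (ha : Measurable a) (hb : Measurable b) :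
    Measurable fun θ => ∫ r in a θ..b θ, f θ r := by
  have key : ∀ {a b : Θ → ℝ}, Measurable a → Measurable b →
      Measurable fun θ => ∫ r in Ioc (a θ) (b θ), f θ r := by
    intro a b ha hb
    simp_rw [← integral_indicator measurableSet_Ioc]
    have hset : MeasurableSet {p : Θ × ℝ | a p.1 < p.2 ∧ p.2 ≤ b p.1} :=
      (measurableSet_lt (ha.comp measurable_fst) measurable_snd).inter
        (measurableSet_le measurable_snd (hb.comp measurable_fst))
    exact ((hf.indicator hset).stronglyMeasurable.integral_prod_right' (ν := volume)).measurable
  simp_rw [intervalIntegral]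
  exact (key ha hb).sub (key hb ha)

/-- The quotient rule for integral functions. -/
theorem div_eq_integral {f' g' : ℝ → ℝ} {f0 g0 L D : ℝ} (hL : 0 ≤ L)
    (hf : IntervalIntegrable f' volume 0 L) (hg : IntervalIntegrable g' volume 0 L)
    (hgD : ∀ r ∈ Icc 0 L, |g' r| ≤ D) {f g : ℝ → ℝ}
    (hfe : ∀ t ∈ Icc 0 L, f t = f0 + ∫ r in (0 : ℝ)..t, f' r)
    (hge : ∀ t ∈ Icc 0 L, g t = g0 + ∫ r in (0 : ℝ)..t, g' r)
    (hg1 : ∀ t ∈ Icc 0 L, 1 ≤ g t) :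
    f L / g L = f0 / g0 + ∫ r in (0 : ℝ)..L, (f' r - f r / g r * g' r) / g r := by
  have hu : uIcc 0 L = Icc 0 L := uIcc_of_le hL
  -- `f` and `g` are known only on `[0, L]`. The primitives `F` and `G` are defined on the whole
  -- line, so they can be differentiated in the two-sided sense almost everywhere.
  set F : ℝ → ℝ := fun t => f0 + ∫ r in (0 : ℝ)..t, f' r with hF
  set G : ℝ → ℝ := fun t => g0 + ∫ r in (0 : ℝ)..t, g' r with hG
  have hG1 : ∀ t ∈ Icc 0 L, 1 ≤ G t := fun t ht => (hg1 t ht).trans_eq (hge t ht)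
  have hmono : ∀ {h : ℝ → ℝ}, IntervalIntegrable h volume 0 L → ∀ s ∈ Icc 0 L, ∀ t ∈ Icc 0 L,
      IntervalIntegrable h volume s t := fun hh s hs t ht =>
    hh.mono_set (by rw [hu]; exact uIcc_subset_Icc hs ht)
  have hFac : AbsolutelyContinuousOnInterval F 0 L := by
    have h1 : AbsolutelyContinuousOnInterval (fun _ : ℝ => f0) 0 L :=
      (LipschitzWith.const f0).lipschitzOnWith.absolutelyContinuousOnInterval
    exact h1.add (hf.absolutelyContinuousOnInterval_intervalIntegral (c := 0) (by simp))
  have hD0 : 0 ≤ D := (abs_nonneg _).trans (hgD 0 ⟨le_rfl, hL⟩)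
  -- `1 / G` is Lipschitz because `G` is Lipschitz with constant `D` and `G ≥ 1`. Thus `F / G` is
  -- absolutely continuous and is the integral of its almost everywhere derivative.
  have hIac : AbsolutelyContinuousOnInterval (fun t => (G t)⁻¹) 0 L := by
    apply LipschitzOnWith.absolutelyContinuousOnInterval (K := D.toNNReal)
    rw [hu]
    refine LipschitzOnWith.of_dist_le_mul fun s hs t ht => ?_
    have e1 : G t - G s = ∫ r in s..t, g' r := by
      simp only [hG, add_sub_add_left_eq_sub]
      exact intervalIntegral.integral_interval_sub_left (hmono hg 0 ⟨le_rfl, hL⟩ t ht)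
        (hmono hg 0 ⟨le_rfl, hL⟩ s hs)
    have e2 : |G t - G s| ≤ D * |t - s| := by
      rw [e1]
      exact intervalIntegral.norm_integral_le_of_norm_le_const (f := g') fun r hr =>
        hgD r (uIcc_subset_Icc hs ht (uIoc_subset_uIcc hr))
    have hs1 := hG1 s hs
    have ht1 := hG1 t ht
    have e3 : (G s)⁻¹ - (G t)⁻¹ = (G t - G s) / (G s * G t) := by
      field_simp
    rw [Real.dist_eq, Real.dist_eq, e3, abs_div, Real.coe_toNNReal D hD0, abs_sub_comm s t]
    refine (div_le_self (abs_nonneg _) ?_).trans e2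
    rw [abs_of_nonneg (by positivity)]
    nlinarith
  have hprod := (hFac.fun_mul hIac).integral_deriv_eq_sub
  have hcongr : ∫ x in (0 : ℝ)..L, deriv (fun t => F t * (G t)⁻¹) x
      = ∫ r in (0 : ℝ)..L, (f' r - f r / g r * g' r) / g r := by
    apply intervalIntegral.integral_congr_ae
    filter_upwards [hf.ae_hasDerivAt_integral, hg.ae_hasDerivAt_integral] with x h1 h2 hx
    have hx' : x ∈ uIcc 0 L := uIoc_subset_uIcc hx
    have hxI : x ∈ Icc 0 L := hu ▸ hx'
    have d1 : HasDerivAt F (f' x) x := (h1 hx' 0 (by simp)).const_add f0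
    have d2 : HasDerivAt G (g' x) x := (h2 hx' 0 (by simp)).const_add g0
    have hne : G x ≠ 0 := by have := hG1 x hxI; positivity
    rw [(d1.fun_mul (d2.fun_inv hne)).deriv, hfe x hxI, hge x hxI]
    change f' x * (G x)⁻¹ + F x * (-g' x / G x ^ 2) = (f' x - F x / G x * g' x) / G x
    field_simp
    ring
  rw [← hcongr, hprod, hfe L ⟨hL, le_rfl⟩, hge L ⟨hL, le_rfl⟩]
  simp [hF, hG, div_eq_mul_inv]

end
end Liquidation

namespace Liquidation

noncomputable section

/-! ### Linear differential equations with nonnegative coefficients -/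

section Linear

variable {ι : Type*} [Fintype ι]

/-- Picard iterates of `p' = B p`, `p 0 = p0`. -/
def picard (B : ℝ → ι → ι → ℝ≥0∞) (p0 : ι → ℝ≥0∞) : ℕ → ℝ → ι → ℝ≥0∞
  | 0 => fun _ => p0
  | n + 1 => fun t i => p0 i + ∫⁻ r in Ioc 0 t, ∑ j, B r i j * picard B p0 n r j

/-- The solution of `p' = B p`, `p 0 = p0`, as the supremum of the Picard iterates. -/
def linSol (B : ℝ → ι → ι → ℝ≥0∞) (p0 : ι → ℝ≥0∞) (t : ℝ) (i : ι) : ℝ≥0∞ :=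
  ⨆ n, picard B p0 n t i

/-- With coefficients in `ℝ≥0∞` the Picard map is monotone and its first iterate dominates the
constant start. Convergence is therefore free, without a contraction estimate. -/
theorem picard_le_succ (B : ℝ → ι → ι → ℝ≥0∞) (p0 : ι → ℝ≥0∞) (n : ℕ) (t : ℝ) (i : ι) :
    picard B p0 n t i ≤ picard B p0 (n + 1) t i := by
  induction n generalizing t i with
  | zero => exact le_self_add
  | succ n ih =>
    refine add_le_add_right (lintegral_mono fun r => Finset.sum_le_sum fun j _ => ?_) _
    exact mul_le_mul_right (ih r j) _

theorem picard_mono (B : ℝ → ι → ι → ℝ≥0∞) (p0 : ι → ℝ≥0∞) (t : ℝ) (i : ι) :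
    Monotone fun n => picard B p0 n t i :=
  monotone_nat_of_le_succ fun n => picard_le_succ B p0 n t i

/-- The iterates do not anticipate: up to time `t` they see the coefficients on `(0, t]` only.
Adaptedness of the filter rests on this. -/
theorem picard_congr {B B' : ℝ → ι → ι → ℝ≥0∞} {p0 : ι → ℝ≥0∞} {t : ℝ}
    (h : ∀ r ∈ Ioc 0 t, B r = B' r) (n : ℕ) (s : ℝ) (hs : s ≤ t) :
    picard B p0 n s = picard B' p0 n s := by
  induction n generalizing s with
  | zero => rfl
  | succ n ih =>
    ext i
    simp only [picard]
    congr 1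
    refine setLIntegral_congr_fun measurableSet_Ioc fun r hr => ?_
    simp only [h r ⟨hr.1, hr.2.trans hs⟩, ih r (hr.2.trans hs)]

theorem linSol_congr {B B' : ℝ → ι → ι → ℝ≥0∞} {p0 : ι → ℝ≥0∞} {t : ℝ}
    (h : ∀ r ∈ Ioc 0 t, B r = B' r) : linSol B p0 t = linSol B' p0 t := by
  ext i
  simp only [linSol, picard_congr h _ t le_rfl]

theorem measurable_picard {Θ : Type*} [MeasurableSpace Θ] {B : Θ → ℝ → ι → ι → ℝ≥0∞}
    {p0 : Θ → ι → ℝ≥0∞} (hB : ∀ i j, Measurable fun p : Θ × ℝ => B p.1 p.2 i j)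
    (hp : ∀ i, Measurable fun θ => p0 θ i) (n : ℕ) (i : ι) :
    Measurable fun p : Θ × ℝ => picard (B p.1) (p0 p.1) n p.2 i := by
  induction n generalizing i with
  | zero => exact (hp i).comp measurable_fst
  | succ n ih =>
    simp only [picard]
    refine ((hp i).comp measurable_fst).add ?_
    simp_rw [← lintegral_indicator measurableSet_Ioc]
    have hset : MeasurableSet {q : (Θ × ℝ) × ℝ | q.2 ∈ Ioc 0 q.1.2} :=
      (measurableSet_lt measurable_const measurable_snd).inter
        (measurableSet_le measurable_snd (measurable_snd.comp measurable_fst))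
    have hmap : Measurable fun q : (Θ × ℝ) × ℝ => (q.1.1, q.2) :=
      (measurable_fst.comp measurable_fst).prodMk measurable_snd
    have hf : Measurable fun q : (Θ × ℝ) × ℝ =>
        ∑ j, B q.1.1 q.2 i j * picard (B q.1.1) (p0 q.1.1) n q.2 j :=
      Finset.measurable_sum _ fun j _ => ((hB i j).comp hmap).mul ((ih j).comp hmap)
    exact (hf.indicator hset).lintegral_prod_right' (ν := volume)

theorem measurable_linSol {Θ : Type*} [MeasurableSpace Θ] {B : Θ → ℝ → ι → ι → ℝ≥0∞}
    {p0 : Θ → ι → ℝ≥0∞} (hB : ∀ i j, Measurable fun p : Θ × ℝ => B p.1 p.2 i j)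
    (hp : ∀ i, Measurable fun θ => p0 θ i) (i : ι) :
    Measurable fun p : Θ × ℝ => linSol (B p.1) (p0 p.1) p.2 i :=
  Measurable.iSup fun n => measurable_picard hB hp n i

theorem measurable_picard_right {B : ℝ → ι → ι → ℝ≥0∞} {p0 : ι → ℝ≥0∞}
    (hB : ∀ i j, Measurable fun r => B r i j) (n : ℕ) (j : ι) :
    Measurable fun r => picard B p0 n r j :=
  (measurable_picard (Θ := Unit) (B := fun _ => B) (p0 := fun _ => p0)
    (fun i j => (hB i j).comp measurable_snd) (fun _ => measurable_const) n j).comp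
    (g := fun p : Unit × ℝ => picard B p0 n p.2 j) (f := fun r : ℝ => ((), r))
    (measurable_const.prodMk measurable_id)

/-- Monotone convergence, for the sum and for the integral, lets the supremum pass through the
Picard recursion. -/
theorem linSol_eq {B : ℝ → ι → ι → ℝ≥0∞} {p0 : ι → ℝ≥0∞}
    (hB : ∀ i j, Measurable fun r => B r i j) (t : ℝ) (i : ι) :
    linSol B p0 t i = p0 i + ∫⁻ r in Ioc 0 t, ∑ j, B r i j * linSol B p0 r j := by
  have hmeas := measurable_picard_right (p0 := p0) hB
  have h1 : linSol B p0 t i = ⨆ n, picard B p0 (n + 1) t i :=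
    ((picard_mono B p0 t i).iSup_nat_add 1).symm
  rw [h1]
  simp only [picard]
  rw [← ENNReal.add_iSup, ← lintegral_iSup]
  · congr 1
    refine lintegral_congr fun r => ?_
    rw [← ENNReal.finsetSum_iSup_of_monotone]
    · simp only [linSol, ENNReal.mul_iSup]
    · exact fun j _ _ h => mul_le_mul_right (picard_mono B p0 r j h) _
  · exact fun n => Finset.measurable_sum _ fun j _ => (hB i j).mul (hmeas n j)
  · exact fun _ _ h r => Finset.sum_le_sum fun j _ =>
      mul_le_mul_right (picard_mono B p0 r j h) _

/-- `exp (M t)` is the fixed point of `m ↦ 1 + ∫ M m`. It serves as the comparison function for the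
total mass of the Picard iterates. -/
theorem lintegral_exp_le {M t : ℝ} (hM : 0 ≤ M) (ht : 0 ≤ t) :
    1 + ∫⁻ r in Ioc 0 t, ENNReal.ofReal (M * Real.exp (M * r)) = ENNReal.ofReal
        (Real.exp (M * t)) := by
  have hc : Continuous fun r : ℝ => M * Real.exp (M * r) := by fun_prop
  rw [← ofReal_integral_eq_lintegral_ofReal (hc.integrableOn_Ioc)
    (ae_of_all _ fun r => by positivity), ← intervalIntegral.integral_of_le ht,
    ← ENNReal.ofReal_one, ← ENNReal.ofReal_add zero_le_one]
  · congr 1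
    have hd : ∀ r ∈ uIcc 0 t, HasDerivAt (fun r => Real.exp (M * r)) (M * Real.exp (M * r)) r := by
      intro r _
      have := ((hasDerivAt_id r).const_mul M).exp
      simpa [mul_comm] using this
    rw [intervalIntegral.integral_eq_sub_of_hasDerivAt hd (hc.intervalIntegrable _ _)]
    simp
  · exact intervalIntegral.integral_nonneg ht fun r _ => by positivity

/-- Summing the recursion over `i` leaves only the column sums of `B`. The total mass of an iterate
is thus at most `1 + ∫ M` times that of the previous one, and `exp (M t)` reproduces itself under
this bound. -/
theorem picard_sum_le {B : ℝ → ι → ι → ℝ≥0∞} {p0 : ι → ℝ≥0∞} {M : ℝ} (hM : 0 ≤ M)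
    (hBM : ∀ r j, ∑ i, B r i j ≤ ENNReal.ofReal M) (hB : ∀ i j, Measurable fun r => B r i j)
    (hp : ∑ i, p0 i ≤ 1) (n : ℕ) {t : ℝ} (ht : 0 ≤ t) :
    ∑ i, picard B p0 n t i ≤ ENNReal.ofReal (Real.exp (M * t)) := by
  have hmeas := measurable_picard_right (p0 := p0) hB
  induction n generalizing t with
  | zero =>
    refine hp.trans ?_
    rw [← ENNReal.ofReal_one]
    exact ENNReal.ofReal_le_ofReal (Real.one_le_exp (by positivity))
  | succ n ih =>
    simp only [picard]
    rw [Finset.sum_add_distrib, ← lintegral_finsetSum]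
    · rw [← lintegral_exp_le hM ht]
      refine add_le_add hp (setLIntegral_mono' measurableSet_Ioc fun r hr => ?_)
      rw [Finset.sum_comm]
      calc ∑ j, ∑ i, B r i j * picard B p0 n r j
          = ∑ j, (∑ i, B r i j) * picard B p0 n r j := by simp_rw [Finset.sum_mul]
        _ ≤ ∑ j, ENNReal.ofReal M * picard B p0 n r j :=
            Finset.sum_le_sum fun j _ => mul_le_mul_left (hBM r j) _
        _ = ENNReal.ofReal M * ∑ j, picard B p0 n r j := by rw [Finset.mul_sum]
        _ ≤ ENNReal.ofReal M * ENNReal.ofReal (Real.exp (M * r)) :=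
            mul_le_mul_right (ih hr.1.le) _
        _ = _ := (ENNReal.ofReal_mul hM).symm
    · exact fun i _ => Finset.measurable_sum _ fun j _ => (hB i j).mul (hmeas n j)

theorem linSol_sum_le {B : ℝ → ι → ι → ℝ≥0∞} {p0 : ι → ℝ≥0∞} {M : ℝ} (hM : 0 ≤ M)
    (hBM : ∀ r j, ∑ i, B r i j ≤ ENNReal.ofReal M) (hB : ∀ i j, Measurable fun r => B r i j)
    (hp : ∑ i, p0 i ≤ 1) {t : ℝ} (ht : 0 ≤ t) :
    ∑ i, linSol B p0 t i ≤ ENNReal.ofReal (Real.exp (M * t)) := by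
  simp only [linSol]
  rw [ENNReal.finsetSum_iSup_of_monotone fun j => picard_mono B p0 t j]
  exact iSup_le fun n => picard_sum_le hM hBM hB hp n ht

end Linear

/-! ### The filter equation between jumps -/

section FilterODE

variable {K : ℕ}

/-- The right-hand side of the filter equation between jumps, for the jump intensities `a`. -/
def filterField (q : Matrix (Fin K) (Fin K) ℝ) (a π : Fin K → ℝ) (i : Fin K) : ℝ :=
  ∑ j, q j i * π j - π i * (a i - ∑ j, π j * a j)

/-- A shift that makes the coefficients of the unnormalized filter equation nonnegative. -/
def filterShift (q : Matrix (Fin K) (Fin K) ℝ) (C : ℝ) : ℝ := C + ∑ k, |q k k|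

/-- The coefficients of the shifted unnormalized filter equation. -/
def filterCoef (q : Matrix (Fin K) (Fin K) ℝ) (C : ℝ) (a : Fin K → ℝ) (i j : Fin K) : ℝ :=
  q j i + if i = j then filterShift q C - a i else 0

/-- The solution of the filter equation between jumps, started in `π0` at time `0`. -/
def filterSol (q : Matrix (Fin K) (Fin K) ℝ) (C : ℝ) (a : ℝ → Fin K → ℝ) (π0 : Fin K → ℝ)
    (t : ℝ) (i : Fin K) : ℝ :=
  (linSol (fun r i j => ENNReal.ofReal (filterCoef q C (a r) i j))
      (fun i => ENNReal.ofReal (π0 i)) t i).toReal /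
    ∑ k, (linSol (fun r i j => ENNReal.ofReal (filterCoef q C (a r) i j))
      (fun i => ENNReal.ofReal (π0 i)) t k).toReal

theorem filterSol_congr {q : Matrix (Fin K) (Fin K) ℝ} {C : ℝ} {a a' : ℝ → Fin K → ℝ}
    {π0 : Fin K → ℝ} {t : ℝ} (h : ∀ r ∈ Ioc 0 t, a r = a' r) :
    filterSol q C a π0 t = filterSol q C a' π0 t := by
  ext i
  simp only [filterSol]
  rw [linSol_congr (t := t) (fun r hr => by rw [h r hr])]

theorem measurable_filterSol {Θ : Type*} [MeasurableSpace Θ] (q : Matrix (Fin K) (Fin K) ℝ) (C : ℝ)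
    {a : Θ → ℝ → Fin K → ℝ} {π0 : Θ → Fin K → ℝ}
    (ha : Measurable fun p : Θ × ℝ => a p.1 p.2) (hp : Measurable π0) :
    Measurable fun p : Θ × ℝ => filterSol q C (a p.1) (π0 p.1) p.2 := by
  have hlin : ∀ i, Measurable fun p : Θ × ℝ => (linSol
      (fun r i j => ENNReal.ofReal (filterCoef q C (a p.1 r) i j))
      (fun i => ENNReal.ofReal (π0 p.1 i)) p.2 i).toReal := by
    intro i
    refine (measurable_linSol (B := fun θ r i j => ENNReal.ofReal (filterCoef q C (a θ r) i j))
      (p0 := fun θ i => ENNReal.ofReal (π0 θ i)) ?_ ?_ i).ennreal_toReal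
    · intro i j
      refine Measurable.ennreal_ofReal (measurable_const.add ?_)
      by_cases hij : i = j
      · simp only [hij, if_true]
        exact measurable_const.sub ((measurable_pi_apply j).comp ha)
      · simp only [hij, if_false]
        exact measurable_const
    · exact fun i => ((measurable_pi_apply i).comp hp).ennreal_ofReal
  refine measurable_pi_lambda _ fun i => (hlin i).div (Finset.measurable_sum _ fun k _ => hlin k)

/-- A generator matrix. -/
structure IsGenerator (q : Matrix (Fin K) (Fin K) ℝ) : Prop where
  nonneg : ∀ i j, i ≠ j → 0 ≤ q i j
  row_sum : ∀ i, ∑ j, q i j = 0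

variable {q : Matrix (Fin K) (Fin K) ℝ} {C : ℝ} {a : ℝ → Fin K → ℝ} {π0 : Fin K → ℝ}

/-- Off the diagonal the coefficients are transition rates. On the diagonal `Σ_k |q k k|`
compensates `q i i`, and `C` compensates the killing `b i`. -/
theorem filterCoef_nonneg (hq : IsGenerator q) {b : Fin K → ℝ} (hb : ∀ k, b k ∈ Icc 0 C)
    (i j : Fin K) : 0 ≤ filterCoef q C b i j := by
  unfold filterCoef filterShift
  by_cases hij : i = j
  · subst hij
    have h1 : |q i i| ≤ ∑ k, |q k k| :=
      Finset.single_le_sum (f := fun k => |q k k|) (fun k _ => abs_nonneg _) (Finset.mem_univ i)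
    have h2 := neg_abs_le (q i i)
    have h3 := (hb i).2
    simp only [if_true]
    linarith
  · simp only [hij, if_false, add_zero]
    exact hq.nonneg j i (Ne.symm hij)

/-- The rows of the generator sum to zero, so only the shift and the killing change the total mass
of the unnormalized filter. -/
theorem filterCoef_sum (hq : IsGenerator q) (b : Fin K → ℝ) (j : Fin K) :
    ∑ i, filterCoef q C b i j = filterShift q C - b j := by
  simp [filterCoef, Finset.sum_add_distrib, hq.row_sum j]

theorem filterShift_nonneg (hC : 0 ≤ C) : 0 ≤ filterShift q C :=
  add_nonneg hC (Finset.sum_nonneg fun _ _ => abs_nonneg _)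

/-- `filterSol` stays in the simplex and solves the filter equation. -/
theorem filterSol_spec (hq : IsGenerator q) (ha : Measurable a) (haC : ∀ r k, a r k ∈ Icc 0 C)
    (hC : 0 ≤ C) (hπ : π0 ∈ stdSimplex ℝ (Fin K)) {t : ℝ} (ht : 0 ≤ t) :
    filterSol q C a π0 t ∈ stdSimplex ℝ (Fin K) ∧
      ∀ i, filterSol q C a π0 t i =
        π0 i + ∫ r in (0 : ℝ)..t, filterField q (a r) (filterSol q C a π0 r) i := by
  -- Let `p` be the unnormalized solution and `N` its total mass. The proof bounds `p`, turns its
  -- equation from `ℝ≥0∞` into `ℝ`, and applies the quotient rule to `p i / N`.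
  set c := filterShift q C with hc
  have hc0 : 0 ≤ c := filterShift_nonneg hC
  set b : ℝ → Fin K → Fin K → ℝ := fun r i j => filterCoef q C (a r) i j with hb
  have hb0 : ∀ r i j, 0 ≤ b r i j := fun r i j => filterCoef_nonneg hq (haC r) i j
  have hbm : ∀ i j, Measurable fun r => b r i j := by
    intro i j
    refine measurable_const.add ?_
    by_cases hij : i = j
    · simp only [hij, if_true]
      exact measurable_const.sub ((measurable_pi_apply j).comp ha)
    · simp only [hij, if_false]
      exact measurable_const
  set B : ℝ → Fin K → Fin K → ℝ≥0∞ := fun r i j => ENNReal.ofReal (b r i j) with hB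
  set p0 : Fin K → ℝ≥0∞ := fun i => ENNReal.ofReal (π0 i) with hp0
  have hBm : ∀ i j, Measurable fun r => B r i j := fun i j => (hbm i j).ennreal_ofReal
  have hBs : ∀ r j, ∑ i, B r i j ≤ ENNReal.ofReal c := by
    intro r j
    rw [← ENNReal.ofReal_sum_of_nonneg fun i _ => hb0 r i j, filterCoef_sum hq]
    exact ENNReal.ofReal_le_ofReal (by linarith [(haC r j).1])
  have hp1 : ∑ i, p0 i ≤ 1 := by
    rw [← ENNReal.ofReal_sum_of_nonneg fun i _ => hπ.1 i, hπ.2, ENNReal.ofReal_one]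
  have hle : ∀ s, 0 ≤ s → ∀ i, linSol B p0 s i ≤ ENNReal.ofReal (Real.exp (c * s)) := fun s hs i =>
    (Finset.single_le_sum (f := fun i => linSol B p0 s i) (fun _ _ => zero_le)
      (Finset.mem_univ i)).trans (linSol_sum_le hc0 hBs hBm hp1 hs)
  have hfin : ∀ s, 0 ≤ s → ∀ i, linSol B p0 s i ≠ ⊤ := fun s hs i =>
    ((hle s hs i).trans_lt ENNReal.ofReal_lt_top).ne
  set p : ℝ → Fin K → ℝ := fun s i => (linSol B p0 s i).toReal with hp
  have hpm : ∀ i, Measurable fun s => p s i := fun i =>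
    ((measurable_linSol (Θ := Unit) (B := fun _ => B) (p0 := fun _ => p0)
      (fun i j => (hBm i j).comp measurable_snd) (fun _ => measurable_const) i).comp
      (g := fun x : Unit × ℝ => linSol B p0 x.2 i) (f := fun r : ℝ => ((), r))
      (measurable_const.prodMk measurable_id)).ennreal_toReal
  have hpn : ∀ s i, 0 ≤ p s i := fun s i => ENNReal.toReal_nonneg
  have hpl : ∀ s ∈ Icc 0 t, ∀ i, p s i ≤ Real.exp (c * t) := by
    intro s hs i
    refine (ENNReal.toReal_le_of_le_ofReal (Real.exp_pos _).le (hle s hs.1 i)).trans ?_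
    exact Real.exp_le_exp.2 (mul_le_mul_of_nonneg_left hs.2 hc0)
  have hbl : ∀ r i j, b r i j ≤ c := by
    intro r i j
    refine (Finset.single_le_sum (f := fun i => b r i j) (fun i _ => hb0 r i j)
      (Finset.mem_univ i)).trans ?_
    rw [filterCoef_sum hq]
    linarith [(haC r j).1]
  have hint : ∀ {h : ℝ → ℝ} {D s : ℝ}, Measurable h → (∀ r ∈ Icc 0 t, |h r| ≤ D) → s ∈ Icc 0 t →
      IntervalIntegrable h volume 0 s := by
    intro h D s hm hD hs
    rw [intervalIntegrable_iff_integrableOn_Icc_of_le hs.1]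
    refine Measure.integrableOn_of_bounded (M := D) (by simp) hm.aestronglyMeasurable ?_
    filter_upwards [ae_restrict_mem measurableSet_Icc] with r hr
    exact hD r ⟨hr.1, hr.2.trans hs.2⟩
  have hbpm : ∀ i j, Measurable fun r => b r i j * p r j := fun i j => (hbm i j).mul (hpm j)
  have hbpD : ∀ i j, ∀ r ∈ Icc 0 t, |b r i j * p r j| ≤ c * Real.exp (c * t) := by
    intro i j r hr
    rw [abs_of_nonneg (mul_nonneg (hb0 r i j) (hpn r j))]
    exact mul_le_mul (hbl r i j) (hpl r hr j) (hpn r j) hc0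
  have hbpi : ∀ i, ∀ s ∈ Icc 0 t, IntervalIntegrable (fun r => ∑ j, b r i j * p r j) volume 0 s :=
    fun i s hs => by
      have := IntervalIntegrable.sum (μ := volume) (a := 0) (b := s) Finset.univ
        (f := fun j r => b r i j * p r j) fun j _ => hint (hbpm i j) (hbpD i j) hs
      simpa [Finset.sum_fn] using this
  have hpe : ∀ s ∈ Icc 0 t, ∀ i, p s i = π0 i + ∫ r in (0 : ℝ)..s, ∑ j, b r i j * p r j := by
    intro s hs i
    have h1 := linSol_eq (p0 := p0) hBm s i
    have h2 : ∫⁻ r in Ioc 0 s, ∑ j, B r i j * linSol B p0 r j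
        = ENNReal.ofReal (∫ r in (0 : ℝ)..s, ∑ j, b r i j * p r j) := by
      rw [intervalIntegral.integral_of_le hs.1, ofReal_integral_eq_lintegral_ofReal]
      · refine setLIntegral_congr_fun measurableSet_Ioc fun r hr => ?_
        rw [ENNReal.ofReal_sum_of_nonneg fun j _ => mul_nonneg (hb0 r i j) (hpn r j)]
        refine Finset.sum_congr rfl fun j _ => ?_
        rw [ENNReal.ofReal_mul (hb0 r i j), ENNReal.ofReal_toReal (hfin r hr.1.le j)]
      · exact (intervalIntegrable_iff_integrableOn_Ioc_of_le hs.1).1 (hbpi i s hs)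
      · exact ae_of_all _ fun r => Finset.sum_nonneg fun j _ => mul_nonneg (hb0 r i j) (hpn r j)
    have h3 : 0 ≤ ∫ r in (0 : ℝ)..s, ∑ j, b r i j * p r j :=
      intervalIntegral.integral_nonneg hs.1 fun r _ =>
        Finset.sum_nonneg fun j _ => mul_nonneg (hb0 r i j) (hpn r j)
    simp only [hp]
    rw [h1, h2, ← ENNReal.ofReal_add (hπ.1 i) h3, ENNReal.toReal_ofReal (add_nonneg (hπ.1 i) h3)]
  set N : ℝ → ℝ := fun s => ∑ i, p s i with hN
  set g' : ℝ → ℝ := fun r => ∑ i, ∑ j, b r i j * p r j with hg'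
  have hg'eq : ∀ r, g' r = ∑ j, (c - a r j) * p r j := by
    intro r
    simp only [hg']
    rw [Finset.sum_comm]
    refine Finset.sum_congr rfl fun j _ => ?_
    rw [← Finset.sum_mul, filterCoef_sum hq]
  have hNe : ∀ s ∈ Icc 0 t, N s = 1 + ∫ r in (0 : ℝ)..s, g' r := by
    intro s hs
    simp only [hN, hg']
    rw [intervalIntegral.integral_finsetSum fun i _ => hbpi i s hs, ← hπ.2,
      ← Finset.sum_add_distrib]
    exact Finset.sum_congr rfl fun i _ => hpe s hs i
  have hg'0 : ∀ r, 0 ≤ g' r := fun r =>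
    Finset.sum_nonneg fun i _ => Finset.sum_nonneg fun j _ => mul_nonneg (hb0 r i j) (hpn r j)
  -- The mass starts from `1` and cannot decrease, because the shifted coefficients are nonnegative.
  -- This is the lower bound that the quotient rule needs.
  have hN1 : ∀ s ∈ Icc 0 t, 1 ≤ N s := by
    intro s hs
    rw [hNe s hs]
    exact le_add_of_nonneg_right (intervalIntegral.integral_nonneg hs.1 fun r _ => hg'0 r)
  have hsol : ∀ s i, filterSol q C a π0 s i = p s i / N s := fun s i => rfl
  have hg'i : IntervalIntegrable g' volume 0 t := by
    have := IntervalIntegrable.sum (μ := volume) (a := 0) (b := t) Finset.univ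
      (f := fun i r => ∑ j, b r i j * p r j) fun i _ => hbpi i t ⟨ht, le_rfl⟩
    simpa [Finset.sum_fn] using this
  have hmemt : t ∈ Icc 0 t := ⟨ht, le_rfl⟩
  refine ⟨⟨fun i => ?_, ?_⟩, fun i => ?_⟩
  · rw [hsol]
    exact div_nonneg (hpn t i) (zero_le_one.trans (hN1 t hmemt))
  · simp only [hsol]
    rw [← Finset.sum_div]
    exact div_self (zero_lt_one.trans_le (hN1 t hmemt)).ne'
  · rw [hsol, div_eq_integral (D := ∑ _i : Fin K, ∑ _j : Fin K, c * Real.exp (c * t)) ht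
      (hbpi i t hmemt) hg'i ?_ (fun s hs => hpe s hs i) hNe hN1, div_one]
    · congr 1
      refine intervalIntegral.integral_congr fun r hr => ?_
      rw [uIcc_of_le ht] at hr
      have hNr : N r ≠ 0 := (zero_lt_one.trans_le (hN1 r hr)).ne'
      have hsum1 : ∑ j, p r j / N r = 1 := by
        rw [← Finset.sum_div]
        exact div_self hNr
      simp only [filterField, hsol, hg'eq]
      have e1 : ∑ j, b r i j * p r j = ∑ j, q j i * p r j + (c - a r i) * p r i := by
        simp [hb, filterCoef, add_mul, Finset.sum_add_distrib, hc]
      have e2 : ∑ j, (c - a r j) * p r j = c * N r - ∑ j, p r j * a r j := by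
        rw [hN, Finset.mul_sum, ← Finset.sum_sub_distrib]
        exact Finset.sum_congr rfl fun j _ => by ring
      have e3 : ∑ j, q j i * (p r j / N r) = (∑ j, q j i * p r j) / N r := by
        rw [Finset.sum_div]
        exact Finset.sum_congr rfl fun j _ => by ring
      have e4 : ∑ j, p r j / N r * a r j = (∑ j, p r j * a r j) / N r := by
        rw [Finset.sum_div]
        exact Finset.sum_congr rfl fun j _ => by ring
      -- The shift contributes `c p_i / N` through `e1` and `-(p_i / N) c` through `e2`. These
      -- cancel, so the normalized equation does not contain `c`.
      rw [e1, e2, e3, e4]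
      field_simp
      ring
    · intro r hr
      refine (Finset.abs_sum_le_sum_abs _ _).trans (Finset.sum_le_sum fun i _ => ?_)
      exact (Finset.abs_sum_le_sum_abs _ _).trans (Finset.sum_le_sum fun j _ => hbpD i j r hr)

theorem filterSol_zero (hq : IsGenerator q) (ha : Measurable a) (haC : ∀ r k, a r k ∈ Icc 0 C)
    (hC : 0 ≤ C) (hπ : π0 ∈ stdSimplex ℝ (Fin K)) : filterSol q C a π0 0 = π0 := by
  ext i
  simpa using (filterSol_spec hq ha haC hC hπ le_rfl).2 i

end FilterODE

end
end Liquidation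

/-! ### Jump measures through their densities, and the cancellation in the filter equation. -/

namespace Liquidation

noncomputable section

variable {K : ℕ}

namespace Model

instance (M : Model K) : IsFiniteMeasure M.ηQ := M.ηQ_finite

theorem isGenerator (M : Model K) : IsGenerator M.q := ⟨M.q_nonneg, M.q_row_sum⟩

/-- The projection of a time to `[0, T]`. -/
def clampT (M : Model K) (t : ℝ) : ℝ := max 0 (min t M.T)

/-- The projection of a rate to `[0, νmax]`. -/
def clampν (M : Model K) (ν : ℝ) : ℝ := max 0 (min ν M.νmax)

/-- The total mass of `ηP t k ν`, extended constantly outside of `[0, T] × [0, νmax]`. -/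
def kill (M : Model K) (t ν : ℝ) (k : Fin K) : ℝ :=
  ∫ z, M.dens (M.clampT t) k (M.clampν ν) z ∂M.ηQ

theorem clampT_mem (M : Model K) (t : ℝ) : M.clampT t ∈ Icc 0 M.T :=
  ⟨le_max_left _ _, max_le M.T_pos.le (min_le_right _ _)⟩

theorem clampν_mem (M : Model K) (ν : ℝ) : M.clampν ν ∈ Icc 0 M.νmax :=
  ⟨le_max_left _ _, max_le M.νmax_pos.le (min_le_right _ _)⟩

theorem clampT_eq (M : Model K) {t : ℝ} (ht : t ∈ Icc 0 M.T) : M.clampT t = t := by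
  rw [clampT, min_eq_left ht.2, max_eq_right ht.1]

theorem clampν_eq (M : Model K) {ν : ℝ} (hν : ν ∈ Icc 0 M.νmax) : M.clampν ν = ν := by
  rw [clampν, min_eq_left hν.2, max_eq_right hν.1]

@[fun_prop]
theorem measurable_clampT (M : Model K) : Measurable M.clampT :=
  measurable_const.max (measurable_id.min measurable_const)

@[fun_prop]
theorem measurable_clampν (M : Model K) : Measurable M.clampν :=
  measurable_const.max (measurable_id.min measurable_const)

theorem ae_mem_support (M : Model K) : ∀ᵐ z ∂M.ηQ, z ∈ M.ηQ.support :=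
  Measure.support_mem_ae

theorem measurable_kill (M : Model K) : Measurable fun p : ℝ × ℝ => M.kill p.1 p.2 := by
  refine measurable_pi_lambda _ fun k => ?_
  have h : Measurable fun p : (ℝ × ℝ) × ℝ => M.dens (M.clampT p.1.1) k (M.clampν p.1.2) p.2 :=
    (M.dens_measurable k).comp (g := fun p : ℝ × ℝ × ℝ => M.dens p.1 k p.2.1 p.2.2)
      (f := fun p : (ℝ × ℝ) × ℝ => (M.clampT p.1.1, M.clampν p.1.2, p.2)) (by fun_prop)
  exact (h.stronglyMeasurable.integral_prod_right' (ν := M.ηQ)).measurable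

theorem measurable_dens (M : Model K) (t : ℝ) (k : Fin K) (ν : ℝ) : Measurable (M.dens t k ν) :=
  (M.dens_measurable k).comp (g := fun p : ℝ × ℝ × ℝ => M.dens p.1 k p.2.1 p.2.2)
    (f := fun z : ℝ => (t, ν, z)) (by fun_prop)

variable {M : Model K}

/-- The constant is the one for `m = νmax`. The support of `ηQ` has full measure, so the bounds on
the support hold almost everywhere. -/
theorem RegularJumps.dens_bounds' (hM : M.RegularJumps) : ∃ C : ℝ, 0 < C ∧
    ∀ t ∈ Icc 0 M.T, ∀ ν ∈ Icc 0 M.νmax, ∀ᵐ z ∂M.ηQ, z ∈ M.ηQ.support ∧ ∀ i,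
      0 < M.dens t i ν z ∧ C⁻¹ < M.dens t i ν z ∧ M.dens t i ν z < C := by
  obtain ⟨C, hC, h⟩ := hM.dens_bounds M.νmax M.νmax_pos.le
  refine ⟨C, hC, fun t ht ν hν => ?_⟩
  filter_upwards [M.ae_mem_support] with z hz
  exact ⟨hz, fun i => ⟨(inv_pos.2 hC).trans (h t ht i ν hν z hz).1, h t ht i ν hν z hz⟩⟩

/-- Because time and rate are projected in `kill`, one bound holds for all real arguments.
Coefficients built from `kill` are then bounded without side conditions. -/
theorem exists_kill_bound (hM : M.RegularJumps) :
    ∃ C : ℝ, 0 ≤ C ∧ ∀ t ν k, M.kill t ν k ∈ Icc 0 C := by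
  obtain ⟨C, hC, h⟩ := hM.dens_bounds'
  refine ⟨C * M.ηQ.real univ, by positivity, fun t ν k => ⟨?_, ?_⟩⟩
  · refine integral_nonneg_of_ae ?_
    filter_upwards [h _ (M.clampT_mem t) _ (M.clampν_mem ν)] with z hz
    exact (hz.2 k).1.le
  · refine (le_abs_self _).trans ?_
    rw [← Real.norm_eq_abs, kill]
    refine norm_integral_le_of_norm_le_const ?_
    filter_upwards [h _ (M.clampT_mem t) _ (M.clampν_mem ν)] with z hz
    rw [Real.norm_of_nonneg (hz.2 k).1.le]
    exact (hz.2 k).2.2.le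

/-- A bound for the total masses of the jump measures. -/
def killBound (M : Model K) : ℝ :=
  Classical.epsilon fun C => 0 ≤ C ∧ ∀ t ν k, M.kill t ν k ∈ Icc 0 C

theorem killBound_nonneg (hM : M.RegularJumps) : 0 ≤ M.killBound :=
  (Classical.epsilon_spec (exists_kill_bound hM)).1

theorem kill_mem (hM : M.RegularJumps) (t ν : ℝ) (k : Fin K) : M.kill t ν k ∈ Icc 0 M.killBound :=
  (Classical.epsilon_spec (exists_kill_bound hM)).2 t ν k

theorem kill_eq {t ν : ℝ} (ht : t ∈ Icc 0 M.T) (hν : ν ∈ Icc 0 M.νmax) (k : Fin K) :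
    M.kill t ν k = ∫ z, M.dens t k ν z ∂M.ηQ := by
  rw [kill, M.clampT_eq ht, M.clampν_eq hν]

theorem integral_ηP (hM : M.RegularJumps) {t ν : ℝ} (ht : t ∈ Icc 0 M.T) (hν : ν ∈ Icc 0 M.νmax)
    (k : Fin K) (f : ℝ → ℝ) :
    ∫ z, f z ∂(M.ηP t k ν) = ∫ z, M.dens t k ν z * f z ∂M.ηQ := by
  obtain ⟨C, hC, h⟩ := hM.dens_bounds'
  rw [M.ηP_eq t ht k ν hν.1, integral_withDensity_eq_integral_toReal_smul
    (M.measurable_dens t k ν).ennreal_ofReal (ae_of_all _ fun _ => ENNReal.ofReal_lt_top)]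
  refine integral_congr_ae ?_
  filter_upwards [h t ht ν hν] with z hz
  simp only [ENNReal.toReal_ofReal (hz.2 k).1.le, smul_eq_mul]

theorem integrable_dens (hM : M.RegularJumps) {t ν : ℝ} (ht : t ∈ Icc 0 M.T)
    (hν : ν ∈ Icc 0 M.νmax) (k : Fin K) : Integrable (M.dens t k ν) M.ηQ := by
  obtain ⟨C, hC, h⟩ := hM.dens_bounds'
  refine Integrable.of_bound (M.measurable_dens t k ν).aestronglyMeasurable C ?_
  filter_upwards [h t ht ν hν] with z hz
  rw [Real.norm_of_nonneg (hz.2 k).1.le]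
  exact (hz.2 k).2.2.le

theorem ηP_univ (hM : M.RegularJumps) {t ν : ℝ} (ht : t ∈ Icc 0 M.T) (hν : ν ∈ Icc 0 M.νmax)
    (k : Fin K) : M.ηP t k ν univ = ENNReal.ofReal (M.kill t ν k) := by
  obtain ⟨C, hC, h⟩ := hM.dens_bounds'
  rw [M.ηP_eq t ht k ν hν.1, withDensity_apply _ MeasurableSet.univ, Measure.restrict_univ,
    kill_eq ht hν, ofReal_integral_eq_lintegral_ofReal (integrable_dens hM ht hν k)]
  filter_upwards [h t ht ν hν] with z hz
  exact (hz.2 k).1.le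

theorem ηP_real_univ (hM : M.RegularJumps) {t ν : ℝ} (ht : t ∈ Icc 0 M.T) (hν : ν ∈ Icc 0 M.νmax)
    (k : Fin K) : (M.ηP t k ν).real univ = M.kill t ν k := by
  rw [measureReal_def, ηP_univ hM ht hν, ENNReal.toReal_ofReal (kill_mem hM t ν k).1]

/-- The strict inequalities survive averaging because some weight is positive. Applied to densities,
this keeps the denominator in the update away from zero. -/
theorem simplex_sum_bounds {π : Fin K → ℝ} (hπ : π ∈ stdSimplex ℝ (Fin K)) {d : Fin K → ℝ}
    {a b : ℝ} (hd : ∀ i, a < d i ∧ d i < b) : a < ∑ j, π j * d j ∧ ∑ j, π j * d j < b := by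
  obtain ⟨i, hi⟩ : ∃ i, 0 < π i := by
    by_contra! hcon
    have h1 : ∑ i, π i = 0 := Finset.sum_eq_zero fun i _ => le_antisymm (hcon i) (hπ.1 i)
    rw [hπ.2] at h1
    exact one_ne_zero h1
  constructor
  · calc a = ∑ j, π j * a := by rw [← Finset.sum_mul, hπ.2, one_mul]
      _ < ∑ j, π j * d j := Finset.sum_lt_sum
          (fun j _ => mul_le_mul_of_nonneg_left (hd j).1.le (hπ.1 j))
          ⟨i, Finset.mem_univ i, mul_lt_mul_of_pos_left (hd i).1 hi⟩
  · calc ∑ j, π j * d j < ∑ j, π j * b := Finset.sum_lt_sum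
          (fun j _ => mul_le_mul_of_nonneg_left (hd j).2.le (hπ.1 j))
          ⟨i, Finset.mem_univ i, mul_lt_mul_of_pos_left (hd i).2 hi⟩
      _ = b := by rw [← Finset.sum_mul, hπ.2, one_mul]

theorem measurable_upd (t ν : ℝ) (π : Fin K → ℝ) (k : Fin K) : Measurable (M.upd k t ν π) :=
  ((M.measurable_dens t k ν).div (Finset.measurable_sum _ fun j _ =>
    (M.measurable_dens t j ν).const_mul _)).sub_const 1

/-- The compensator of the updates of the filter. -/
theorem sum_integral_upd (hM : M.RegularJumps) {t ν : ℝ} (ht : t ∈ Icc 0 M.T)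
    (hν : ν ∈ Icc 0 M.νmax) {π : Fin K → ℝ} (hπ : π ∈ stdSimplex ℝ (Fin K)) (k : Fin K) :
    ∑ j, π j * ∫ z, M.upd k t ν π z ∂(M.ηP t j ν) = M.kill t ν k - ∑ j, π j * M.kill t ν j := by
  obtain ⟨C, hC, h⟩ := hM.dens_bounds'
  have hpos : ∀ᵐ z ∂M.ηQ, C⁻¹ < ∑ j, π j * M.dens t j ν z := by
    filter_upwards [h t ht ν hν] with z hz
    exact (simplex_sum_bounds hπ fun i => (hz.2 i).2).1
  have hbd : ∀ j, Integrable (fun z => M.dens t j ν z * M.upd k t ν π z) M.ηQ := by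
    intro j
    refine Integrable.of_bound ((M.measurable_dens t j ν).mul
      (measurable_upd t ν π k)).aestronglyMeasurable (C * (C * C + 1)) ?_
    filter_upwards [h t ht ν hν, hpos] with z hz hz'
    rw [norm_mul, Real.norm_of_nonneg (hz.2 j).1.le]
    have hp : 0 < ∑ j, π j * M.dens t j ν z := (inv_pos.2 hC).trans hz'
    refine mul_le_mul (hz.2 j).2.2.le ?_ (norm_nonneg _) hC.le
    refine (norm_sub_le _ _).trans (add_le_add ?_ (by simp))
    rw [Real.norm_of_nonneg (div_nonneg (hz.2 k).1.le hp.le), div_eq_mul_inv]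
    refine mul_le_mul (hz.2 k).2.2.le ?_ (inv_nonneg.2 hp.le) hC.le
    exact inv_le_of_inv_le₀ hC hz'.le
  simp_rw [integral_ηP hM ht hν]
  -- The weight `Σ_j π_j ρ_j` multiplying `u^k` is exactly the denominator of `u^k`. The integrand
  -- becomes `ρ_k - Σ_j π_j ρ_j`, and no quotient is left.
  calc ∑ j, π j * ∫ z, M.dens t j ν z * M.upd k t ν π z ∂M.ηQ
      = ∫ z, ∑ j, π j * (M.dens t j ν z * M.upd k t ν π z) ∂M.ηQ := by
        rw [integral_finsetSum _ fun j _ => (hbd j).const_mul _]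
        simp_rw [integral_const_mul]
    _ = ∫ z, (M.dens t k ν z - ∑ j, π j * M.dens t j ν z) ∂M.ηQ := by
        refine integral_congr_ae ?_
        filter_upwards [hpos] with z hz
        have hp : ∑ j, π j * M.dens t j ν z ≠ 0 := ((inv_pos.2 hC).trans hz).ne'
        simp_rw [← mul_assoc]
        rw [← Finset.sum_mul, upd]
        field_simp
    _ = _ := by
        rw [integral_sub (integrable_dens hM ht hν k)
          (integrable_finsetSum _ fun j _ => (integrable_dens hM ht hν j).const_mul _),
          integral_finsetSum _ fun j _ => (integrable_dens hM ht hν j).const_mul _, kill_eq ht hν]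
        simp_rw [integral_const_mul, kill_eq ht hν]

/-- The same cancellation in the form in which the Kushner-Stratonovich equation states it, with the
factor `π k` inside the integral. -/
theorem sum_integral_mul_upd (hM : M.RegularJumps) {t ν : ℝ} (ht : t ∈ Icc 0 M.T)
    (hν : ν ∈ Icc 0 M.νmax) {π : Fin K → ℝ} (hπ : π ∈ stdSimplex ℝ (Fin K)) (k : Fin K) :
    ∑ j, π j * ∫ z, π k * M.upd k t ν π z ∂(M.ηP t j ν)
      = π k * (M.kill t ν k - ∑ j, π j * M.kill t ν j) := by
  rw [← sum_integral_upd hM ht hν hπ, Finset.mul_sum]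
  simp_rw [integral_const_mul]
  exact Finset.sum_congr rfl fun j _ => by ring

/-- On the state space the drift of the filter is quadratic in `π` with bounded coefficients, which
makes the Lipschitz theory available. -/
theorem g_eq (hM : M.RegularJumps) {x : State K} (hx : x ∈ M.stateSpace) {ν : ℝ}
    (hν : ν ∈ Icc 0 M.νmax) :
    M.g x ν = (1, -ν, 0, filterField M.q (M.kill x.1 ν) x.2.2.2) := by
  obtain ⟨t, w, s, π⟩ := x
  obtain ⟨ht, hw, hs, hπ⟩ := hx
  simp only [g]
  refine Prod.ext rfl (Prod.ext rfl (Prod.ext rfl (funext fun k => ?_)))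
  simp only
  rw [sum_integral_upd hM ht hν hπ]
  rfl

theorem jumpRate_eq (hM : M.RegularJumps) {x : State K} (hx : x ∈ M.stateSpace) {ν : ℝ}
    (hν : ν ∈ Icc 0 M.νmax) : M.jumpRate x ν = ∑ j, x.2.2.2 j * M.kill x.1 ν j := by
  obtain ⟨t, w, s, π⟩ := x
  exact Finset.sum_congr rfl fun j _ => by rw [ηP_real_univ hM hx.1 hν]

/-! ### Jumps stay in the state space -/

/-- The update is Bayes' rule: `π_i (1 + u^i) = π_i ρ_i / Σ_j π_j ρ_j` is nonnegative and sums to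
one. The price stays positive because the support lies in `(-1, ∞)`. -/
theorem jumpTo_mem (hM : M.RegularJumps) {x : State K} (hx : x ∈ M.stateSpace) {ν : ℝ}
    (hν : ν ∈ Icc 0 M.νmax) {z : ℝ} (hz : z ∈ M.ηQ.support) :
    M.jumpTo x ν z ∈ M.stateSpace := by
  obtain ⟨C, hC, h⟩ := hM.dens_bounds M.νmax M.νmax_pos.le
  obtain ⟨t, w, s, π⟩ := x
  obtain ⟨ht, hw, hs, hπ⟩ := hx
  have hd : ∀ i, C⁻¹ < M.dens t i ν z ∧ M.dens t i ν z < C := fun i => h t ht i ν hν z hz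
  have hp : 0 < ∑ j, π j * M.dens t j ν z :=
    (inv_pos.2 hC).trans (simplex_sum_bounds hπ hd).1
  refine ⟨ht, hw, mul_pos hs (by
    have h1 : -1 < z := hM.support_subset hz
    change 0 < 1 + z
    linarith), ?_⟩
  have e : ∀ i, π i * (1 + M.upd i t ν π z) = π i * M.dens t i ν z / ∑ j, π j * M.dens t j ν z := by
    intro i
    rw [upd, add_sub_cancel, mul_div_assoc]
  change (fun i => π i * (1 + M.upd i t ν π z)) ∈ stdSimplex ℝ (Fin K)
  simp_rw [e]
  refine ⟨fun i => div_nonneg (mul_nonneg (hπ.1 i) ((inv_pos.2 hC).trans (hd i).1).le) hp.le, ?_⟩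
  rw [← Finset.sum_div, div_self hp.ne']

theorem measurableSet_stateSpace (M : Model K) : MeasurableSet M.stateSpace :=
  measurableSet_Icc.prod (measurableSet_Icc.prod (measurableSet_Ioi.prod
    (isClosed_stdSimplex ℝ (Fin K)).measurableSet))

theorem measurable_jumpTo (M : Model K) :
    Measurable fun p : (State K × ℝ) × ℝ => M.jumpTo p.1.1 p.1.2 p.2 := by
  have hd : ∀ i, Measurable fun p : (State K × ℝ) × ℝ => M.dens p.1.1.1 i p.1.2 p.2 := fun i =>
    (M.dens_measurable i).comp (g := fun p : ℝ × ℝ × ℝ => M.dens p.1 i p.2.1 p.2.2)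
      (f := fun p : (State K × ℝ) × ℝ => (p.1.1.1, p.1.2, p.2)) (by fun_prop)
  have hπ : ∀ i, Measurable fun p : (State K × ℝ) × ℝ => p.1.1.2.2.2 i := fun i =>
    (measurable_pi_apply i).comp (by fun_prop)
  have hu : ∀ i, Measurable fun p : (State K × ℝ) × ℝ => M.upd i p.1.1.1 p.1.2 p.1.1.2.2.2 p.2 :=
    fun i => ((hd i).div (Finset.measurable_sum _ fun j _ => (hπ j).mul (hd j))).sub_const 1
  have h4 : Measurable fun p : (State K × ℝ) × ℝ => fun i =>
      p.1.1.2.2.2 i * (1 + M.upd i p.1.1.1 p.1.2 p.1.1.2.2.2 p.2) :=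
    measurable_pi_lambda _ fun i => (hπ i).mul ((hu i).const_add 1)
  have h3 : Measurable fun p : (State K × ℝ) × ℝ => p.1.1.2.2.1 * (1 + p.2) := by fun_prop
  have h1 : Measurable fun p : (State K × ℝ) × ℝ => p.1.1.1 := by fun_prop
  have h2 : Measurable fun p : (State K × ℝ) × ℝ => p.1.1.2.1 := by fun_prop
  exact h1.prodMk (h2.prodMk (h3.prodMk h4))

end Model

namespace Model

/-! ### The effective selling rate -/

/-- The liquidation test at time `u` looks at the policy on `[0, u]` only. Hence a policy may be
replaced by its projection wherever the two coincide. -/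
theorem effRate_congr {α α' : ℝ → ℝ} {w u : ℝ} (hu : 0 ≤ u) (h : ∀ v ∈ Icc 0 u, α v = α' v) :
    effRate α w u = effRate α' w u := by
  have hI : ∀ v ∈ Ico 0 u, ∫ r in (0 : ℝ)..v, α r = ∫ r in (0 : ℝ)..v, α' r := fun v hv =>
    intervalIntegral.integral_congr fun r hr => by
      rw [uIcc_of_le hv.1] at hr
      exact h r ⟨hr.1, hr.2.trans hv.2.le⟩
  have hiff : (∀ v ∈ Ico 0 u, ∫ r in (0 : ℝ)..v, α r < w) ↔
      ∀ v ∈ Ico 0 u, ∫ r in (0 : ℝ)..v, α' r < w :=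
    forall₂_congr fun v hv => by rw [hI v hv]
  unfold effRate
  by_cases hc : ∀ v ∈ Ico 0 u, ∫ r in (0 : ℝ)..v, α r < w
  · rw [if_pos hc, if_pos (hiff.1 hc), h u ⟨hu, le_rfl⟩]
  · rw [if_neg hc, if_neg (mt hiff.2 hc)]

section effRate

variable {α : ℝ → ℝ} {c : ℝ}

theorem effRate_mem (hα : ∀ u, α u ∈ Icc 0 c) (w u : ℝ) : effRate α w u ∈ Icc 0 c := by
  unfold effRate
  split_ifs
  · exact hα u
  · exact ⟨le_rfl, (hα 0).1.trans (hα 0).2⟩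

theorem intervalIntegrable_of_mem_Icc (hm : Measurable α) (hα : ∀ u, α u ∈ Icc 0 c) (a b : ℝ) :
    IntervalIntegrable α volume a b := by
  rw [intervalIntegrable_iff]
  refine Measure.integrableOn_of_bounded (M := c) (by simp) hm.aestronglyMeasurable ?_
  exact ae_of_all _ fun u => by rw [Real.norm_of_nonneg (hα u).1]; exact (hα u).2

theorem continuous_primitive_of_mem_Icc (hm : Measurable α) (hα : ∀ u, α u ∈ Icc 0 c) :
    Continuous fun v => ∫ r in (0 : ℝ)..v, α r :=
  intervalIntegral.continuous_primitive (fun a b => intervalIntegrable_of_mem_Icc hm hα a b) 0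

theorem monotone_primitive_of_mem_Icc (hm : Measurable α) (hα : ∀ u, α u ∈ Icc 0 c) :
    Monotone fun v => ∫ r in (0 : ℝ)..v, α r := by
  intro a b hab
  have h := intervalIntegral.integral_interval_sub_left (intervalIntegrable_of_mem_Icc hm hα 0 b)
    (intervalIntegrable_of_mem_Icc hm hα 0 a)
  have h2 : 0 ≤ ∫ r in a..b, α r := intervalIntegral.integral_nonneg hab fun r _ => (hα r).1
  simp only
  linarith

/-- The inventory sold under the effective rate. -/
theorem integral_effRate (hm : Measurable α) (hα : ∀ u, α u ∈ Icc 0 c) {w u : ℝ} (hw : 0 ≤ w)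
    (hu : 0 ≤ u) : ∫ r in (0 : ℝ)..u, effRate α w r = min (∫ r in (0 : ℝ)..u, α r) w := by
  set I : ℝ → ℝ := fun v => ∫ r in (0 : ℝ)..v, α r with hI
  have hIc : Continuous I := continuous_primitive_of_mem_Icc hm hα
  have hIm : Monotone I := monotone_primitive_of_mem_Icc hm hα
  have key : ∀ u, 0 ≤ u → (∀ v ∈ Ico 0 u, I v < w) →
      ∫ r in (0 : ℝ)..u, effRate α w r = I u ∧ I u ≤ w := by
    intro u hu h
    constructor
    · refine intervalIntegral.integral_congr fun r hr => ?_
      rw [uIcc_of_le hu] at hr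
      exact if_pos fun v hv => h v ⟨hv.1, hv.2.trans_le hr.2⟩
    · rcases hu.eq_or_lt with rfl | hu'
      · simpa [hI] using hw
      · refine le_of_tendsto (hIc.continuousWithinAt (s := Iio u)) ?_
        filter_upwards [Ico_mem_nhdsLT hu'] with v hv using (h v hv).le
  by_cases h : ∀ v ∈ Ico 0 u, I v < w
  · rw [(key u hu h).1, min_eq_left (key u hu h).2]
  · push Not at h
    obtain ⟨v0, hv0, hv0w⟩ := h
    -- `d` is the liquidation time, the first time at which the amount sold reaches `w`. It exists
    -- by compactness and continuity. Up to `d` the effective rate is `α`, afterwards it is zero.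
    obtain ⟨d, ⟨hdI, hdw⟩, hdl⟩ : ∃ d, IsLeast (Icc 0 u ∩ {v | w ≤ I v}) d :=
      (isCompact_Icc.inter_right (isClosed_le continuous_const hIc)).exists_isLeast
        ⟨v0, ⟨hv0.1, hv0.2.le⟩, hv0w⟩
    have hd1 : ∀ v ∈ Ico 0 d, I v < w := by
      intro v hv
      by_contra! hcon
      exact absurd (hdl ⟨⟨hv.1, hv.2.le.trans hdI.2⟩, hcon⟩) (not_le.2 hv.2)
    obtain ⟨k1, k2⟩ := key d hdI.1 hd1
    have hzero : ∀ r ∈ Ioc d u, effRate α w r = 0 := fun r hr =>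
      if_neg fun hcon => absurd (hcon d ⟨hdI.1, hr.1⟩) (not_lt.2 hdw)
    have i2 : IntervalIntegrable (effRate α w) volume d u := by
      rw [intervalIntegrable_iff_integrableOn_Ioc_of_le hdI.2]
      exact (integrableOn_zero).congr_fun (fun r hr => (hzero r hr).symm) measurableSet_Ioc
    have i1 : IntervalIntegrable (effRate α w) volume 0 d := by
      rw [intervalIntegrable_iff_integrableOn_Ioc_of_le hdI.1]
      refine ((intervalIntegrable_iff_integrableOn_Ioc_of_le hdI.1).1
        (intervalIntegrable_of_mem_Icc hm hα 0 d)).congr_fun (fun r hr => ?_) measurableSet_Ioc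
      exact (if_pos fun v hv => hd1 v ⟨hv.1, hv.2.trans_le hr.2⟩).symm
    have h0 : ∫ r in d..u, effRate α w r = 0 := by
      rw [intervalIntegral.integral_of_le hdI.2, setIntegral_congr_fun measurableSet_Ioc hzero]
      simp
    rw [← intervalIntegral.integral_add_adjacent_intervals i1 i2, h0, add_zero, k1,
      le_antisymm k2 hdw, min_eq_right (hv0w.trans (hIm hv0.2.le))]

theorem measurable_effRate {Θ : Type*} [MeasurableSpace Θ] {α : Θ → ℝ → ℝ} {w : Θ → ℝ}
    (hm : Measurable (Function.uncurry α)) (hα : ∀ θ u, α θ u ∈ Icc 0 c) (hw : Measurable w) :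
    Measurable fun p : Θ × ℝ => effRate (α p.1) (w p.1) p.2 := by
  have hm1 : ∀ θ, Measurable (α θ) := fun θ => hm.of_uncurry_left
  -- The amount sold is monotone in time, so the condition need only be tested at rational times.
  -- This makes the set a countable intersection.
  have hset : {p : Θ × ℝ | ∀ v ∈ Ico 0 p.2, ∫ r in (0 : ℝ)..v, α p.1 r < w p.1} =
      ⋂ q : ℚ, {p : Θ × ℝ | 0 ≤ (q : ℝ) → (q : ℝ) < p.2 → ∫ r in (0 : ℝ)..q, α p.1 r < w p.1} := by
    ext p
    simp only [mem_ofPred_eq, mem_iInter]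
    refine ⟨fun h q h1 h2 => h q ⟨h1, h2⟩, fun h v hv => ?_⟩
    obtain ⟨q, hq1, hq2⟩ := exists_rat_btwn hv.2
    exact (monotone_primitive_of_mem_Icc (hm1 p.1) (hα p.1) hq1.le).trans_lt
      (h q (hv.1.trans hq1.le) hq2)
  have hms : MeasurableSet {p : Θ × ℝ | ∀ v ∈ Ico 0 p.2, ∫ r in (0 : ℝ)..v, α p.1 r < w p.1} := by
    rw [hset]
    refine MeasurableSet.iInter fun q => ?_
    by_cases hq : 0 ≤ (q : ℝ)
    · simp only [hq, true_imp_iff]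
      have e : {p : Θ × ℝ | (q : ℝ) < p.2 → ∫ r in (0 : ℝ)..q, α p.1 r < w p.1} =
          {p : Θ × ℝ | p.2 ≤ q} ∪ {p : Θ × ℝ | ∫ r in (0 : ℝ)..q, α p.1 r < w p.1} := by
        ext p
        simp only [mem_ofPred_eq, mem_union, ← not_lt, imp_iff_not_or]
      rw [e]
      refine (measurableSet_le measurable_snd measurable_const).union (measurableSet_lt ?_ ?_)
      · exact (measurable_intervalIntegral hm measurable_const measurable_const).comp measurable_fst
      · exact hw.comp measurable_fst
    · simp [hq]
  exact Measurable.ite hms hm measurable_const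

end effRate

end Model
end
end Liquidation

namespace Liquidation

noncomputable section

variable {K : ℕ}

/-! ### Lipschitz estimates for the filter equation -/

/-- A Lipschitz constant of the linear part of the filter equation. -/
def genNorm (q : Matrix (Fin K) (Fin K) ℝ) : ℝ := ∑ j, ∑ i, |q j i|

theorem genNorm_nonneg (q : Matrix (Fin K) (Fin K) ℝ) : 0 ≤ genNorm q :=
  Finset.sum_nonneg fun _ _ => Finset.sum_nonneg fun _ _ => abs_nonneg _

theorem abs_gen_sub_le (q : Matrix (Fin K) (Fin K) ℝ) (π π' : Fin K → ℝ) (i : Fin K) :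
    |∑ j, q j i * π j - ∑ j, q j i * π' j| ≤ genNorm q * ∑ j, |π j - π' j| := by
  rw [← Finset.sum_sub_distrib]
  refine (Finset.abs_sum_le_sum_abs _ _).trans ?_
  rw [Finset.mul_sum]
  refine Finset.sum_le_sum fun j _ => ?_
  rw [← mul_sub, abs_mul]
  refine mul_le_mul_of_nonneg_right ?_ (abs_nonneg _)
  exact (Finset.single_le_sum (f := fun i => |q j i|) (fun _ _ => abs_nonneg _)
    (Finset.mem_univ i)).trans (Finset.single_le_sum (f := fun j => ∑ i, |q j i|)
    (fun _ _ => Finset.sum_nonneg fun _ _ => abs_nonneg _) (Finset.mem_univ j))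

theorem simplex_sum_mem {π : Fin K → ℝ} (hπ : π ∈ stdSimplex ℝ (Fin K)) {a : Fin K → ℝ} {C : ℝ}
    (ha : ∀ k, a k ∈ Icc 0 C) : ∑ j, π j * a j ∈ Icc 0 C := by
  refine ⟨Finset.sum_nonneg fun j _ => mul_nonneg (hπ.1 j) (ha j).1, ?_⟩
  calc ∑ j, π j * a j ≤ ∑ j, π j * C :=
        Finset.sum_le_sum fun j _ => mul_le_mul_of_nonneg_left (ha j).2 (hπ.1 j)
    _ = C := by rw [← Finset.sum_mul, hπ.2, one_mul]

theorem simplex_le_one {π : Fin K → ℝ} (hπ : π ∈ stdSimplex ℝ (Fin K)) (i : Fin K) : π i ≤ 1 :=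
  hπ.2 ▸ Finset.single_le_sum (fun j _ => hπ.1 j) (Finset.mem_univ i)

theorem abs_quad_le {π : Fin K → ℝ} (hπ : π ∈ stdSimplex ℝ (Fin K)) {a : Fin K → ℝ} {C : ℝ}
    (ha : ∀ k, a k ∈ Icc 0 C) (i : Fin K) : |π i * (a i - ∑ j, π j * a j)| ≤ C := by
  have h1 := simplex_sum_mem hπ ha
  have h2 : |a i - ∑ j, π j * a j| ≤ C := by
    rw [abs_le]; constructor <;> linarith [(ha i).1, (ha i).2, h1.1, h1.2]
  rw [abs_mul, abs_of_nonneg (hπ.1 i)]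
  exact (mul_le_mul (simplex_le_one hπ i) h2 (abs_nonneg _) zero_le_one).trans_eq (one_mul C)

/-- A difference of products is split in the usual way. On the simplex both factors are bounded, by
`1` and by `C`, and each part contributes one `C` to the constant. -/
theorem abs_quad_sub_le {π π' : Fin K → ℝ} (hπ : π ∈ stdSimplex ℝ (Fin K))
    (hπ' : π' ∈ stdSimplex ℝ (Fin K)) {a : Fin K → ℝ} {C : ℝ} (ha : ∀ k, a k ∈ Icc 0 C)
    (i : Fin K) :
    |π i * (a i - ∑ j, π j * a j) - π' i * (a i - ∑ j, π' j * a j)|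
      ≤ 2 * C * ∑ j, |π j - π' j| := by
  have hC : 0 ≤ C := (ha i).1.trans (ha i).2
  have h1 := simplex_sum_mem hπ ha
  have h2 : |a i - ∑ j, π j * a j| ≤ C := by
    rw [abs_le]; constructor <;> linarith [(ha i).1, (ha i).2, h1.1, h1.2]
  have h3 : |∑ j, π j * a j - ∑ j, π' j * a j| ≤ C * ∑ j, |π j - π' j| := by
    rw [← Finset.sum_sub_distrib, Finset.mul_sum]
    refine (Finset.abs_sum_le_sum_abs _ _).trans (Finset.sum_le_sum fun j _ => ?_)
    rw [← sub_mul, abs_mul, mul_comm, abs_of_nonneg (ha j).1]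
    exact mul_le_mul_of_nonneg_right (ha j).2 (abs_nonneg _)
  have h4 : |π i - π' i| ≤ ∑ j, |π j - π' j| :=
    Finset.single_le_sum (f := fun j => |π j - π' j|) (fun _ _ => abs_nonneg _) (Finset.mem_univ i)
  have e : π i * (a i - ∑ j, π j * a j) - π' i * (a i - ∑ j, π' j * a j) =
      (π i - π' i) * (a i - ∑ j, π j * a j) - π' i * (∑ j, π j * a j - ∑ j, π' j * a j) := by ring
  rw [e]
  refine (abs_sub _ _).trans ?_
  rw [abs_mul, abs_mul, abs_of_nonneg (hπ'.1 i)]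
  have h5 := mul_le_mul h4 h2 (abs_nonneg _) (Finset.sum_nonneg fun _ _ => abs_nonneg _)
  have h6 := mul_le_mul (simplex_le_one hπ' i) h3 (abs_nonneg _) zero_le_one
  linarith

theorem abs_gen_le (q : Matrix (Fin K) (Fin K) ℝ) {π : Fin K → ℝ} (hπ : π ∈ stdSimplex ℝ (Fin K))
    (i : Fin K) : |∑ j, q j i * π j| ≤ genNorm q := by
  have h := abs_gen_sub_le q π 0 i
  simp only [Pi.zero_apply, mul_zero, Finset.sum_const_zero, sub_zero] at h
  rwa [Finset.sum_congr rfl fun j _ => abs_of_nonneg (hπ.1 j), hπ.2, mul_one] at h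

theorem abs_filterField_le {q : Matrix (Fin K) (Fin K) ℝ} {π : Fin K → ℝ}
    (hπ : π ∈ stdSimplex ℝ (Fin K)) {a : Fin K → ℝ} {C : ℝ} (ha : ∀ k, a k ∈ Icc 0 C)
    (i : Fin K) : |filterField q a π i| ≤ genNorm q + C :=
  (abs_sub _ _).trans (add_le_add (abs_gen_le q hπ i) (abs_quad_le hπ ha i))

theorem abs_filterField_sub_le {q : Matrix (Fin K) (Fin K) ℝ} {π π' : Fin K → ℝ}
    (hπ : π ∈ stdSimplex ℝ (Fin K)) (hπ' : π' ∈ stdSimplex ℝ (Fin K)) {a : Fin K → ℝ} {C : ℝ}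
    (ha : ∀ k, a k ∈ Icc 0 C) (i : Fin K) :
    |filterField q a π i - filterField q a π' i| ≤ (genNorm q + 2 * C) * ∑ j, |π j - π' j| := by
  have e : filterField q a π i - filterField q a π' i = (∑ j, q j i * π j - ∑ j, q j i * π' j)
      - (π i * (a i - ∑ j, π j * a j) - π' i * (a i - ∑ j, π' j * a j)) := by
    unfold filterField; ring
  rw [e, add_mul]
  exact (abs_sub _ _).trans (add_le_add (abs_gen_sub_le q π π' i) (abs_quad_sub_le hπ hπ' ha i))

/-- Uniqueness of simplex-valued solutions of the filter equation between jumps. -/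
theorem filterODE_unique {q : Matrix (Fin K) (Fin K) ℝ} {a : ℝ → Fin K → ℝ} {C : ℝ}
    (ha : ∀ r k, a r k ∈ Icc 0 C) {L : ℝ} {π0 : Fin K → ℝ} {p p' : ℝ → Fin K → ℝ}
    (hp : ∀ t ∈ Icc 0 L, p t ∈ stdSimplex ℝ (Fin K))
    (hp' : ∀ t ∈ Icc 0 L, p' t ∈ stdSimplex ℝ (Fin K))
    (hi : ∀ i, IntervalIntegrable (fun r => filterField q (a r) (p r) i) volume 0 L)
    (hi' : ∀ i, IntervalIntegrable (fun r => filterField q (a r) (p' r) i) volume 0 L)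
    (he : ∀ t ∈ Icc 0 L, ∀ i, p t i = π0 i + ∫ r in (0 : ℝ)..t, filterField q (a r) (p r) i)
    (he' : ∀ t ∈ Icc 0 L, ∀ i, p' t i = π0 i + ∫ r in (0 : ℝ)..t, filterField q (a r) (p' r) i) :
    EqOn p p' (Icc 0 L) := by
  intro t0 ht0
  have hL : 0 ≤ L := ht0.1.trans ht0.2
  have hu : uIcc 0 L = Icc 0 L := uIcc_of_le hL
  have hcont : ∀ {p : ℝ → Fin K → ℝ},
      (∀ i, IntervalIntegrable (fun r => filterField q (a r) (p r) i) volume 0 L) →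
      (∀ t ∈ Icc 0 L, ∀ i, p t i = π0 i + ∫ r in (0 : ℝ)..t, filterField q (a r) (p r) i) →
      ∀ i, ContinuousOn (fun t => p t i) (Icc 0 L) := by
    intro p hi he i
    refine ContinuousOn.congr (f := fun t => π0 i + ∫ r in (0 : ℝ)..t, filterField q (a r) (p r) i)
      (continuousOn_const.add ?_) fun t ht => he t ht i
    refine hu ▸ intervalIntegral.continuousOn_primitive_interval ?_
    rw [hu]
    exact (intervalIntegrable_iff_integrableOn_Icc_of_le hL).1 (hi i)
  set D : ℝ → ℝ := fun t => ∑ i, |p t i - p' t i| with hD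
  have hDc : ContinuousOn D (Icc 0 L) :=
    continuousOn_finsetSum _ fun i _ => ((hcont hi he i).sub (hcont hi' he' i)).abs
  have hDi : IntervalIntegrable D volume 0 L :=
    (hu.symm ▸ hDc : ContinuousOn D (uIcc 0 L)).intervalIntegrable
  have hsub : ∀ {h : ℝ → ℝ}, IntervalIntegrable h volume 0 L → ∀ t ∈ Icc 0 L,
      IntervalIntegrable h volume 0 t := fun hh t ht =>
    hh.mono_set (by rw [hu, uIcc_of_le ht.1]; exact Icc_subset_Icc le_rfl ht.2)
  -- `D` is the `ℓ¹` distance. Each component satisfies the Lipschitz estimate with constant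
  -- `genNorm q + 2 * C`, and adding the components gives the factor `K`.
  have hz := eq_zero_of_le_integral (L := K * (genNorm q + 2 * C)) hDi
    (fun t _ => Finset.sum_nonneg fun _ _ => abs_nonneg _) (fun t ht => by
      have hone : ∀ i, |p t i - p' t i| ≤ (genNorm q + 2 * C) * ∫ r in (0 : ℝ)..t, D r := by
        intro i
        rw [he t ht i, he' t ht i, add_sub_add_left_eq_sub, ← intervalIntegral.integral_sub
          (hsub (hi i) t ht) (hsub (hi' i) t ht), ← intervalIntegral.integral_const_mul]
        refine intervalIntegral.norm_integral_le_of_norm_le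
          (f := fun r => filterField q (a r) (p r) i - filterField q (a r) (p' r) i) ht.1 ?_
          ((hsub hDi t ht).const_mul _)
        refine ae_of_all _ fun r hr => ?_
        have hr' : r ∈ Icc 0 L := ⟨hr.1.le, hr.2.trans ht.2⟩
        exact abs_filterField_sub_le (hp r hr') (hp' r hr') (ha r) i
      calc D t ≤ ∑ _i : Fin K, (genNorm q + 2 * C) * ∫ r in (0 : ℝ)..t, D r :=
            Finset.sum_le_sum fun i _ => hone i
        _ = _ := by simp [mul_assoc]) t0 ht0
  ext i
  have := (Finset.sum_eq_zero_iff_of_nonneg fun i _ => abs_nonneg _).1 hz i (Finset.mem_univ i)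
  exact sub_eq_zero.1 (abs_eq_zero.1 this)

end
end Liquidation

namespace Liquidation

noncomputable section

variable {K : ℕ}

namespace Model

/-! ### The controlled flow -/

/-- An admissible policy after one of the jumps. -/
structure IsPolicy (M : Model K) (β : State K → ℝ → ℝ) : Prop where
  measurable : Measurable fun p : State K × ℝ => β p.1 p.2
  mem_Icc : ∀ x ∈ M.stateSpace, ∀ u ∈ Icc 0 M.T, β x u ∈ Icc 0 M.νmax

/-- The policy `β`, with time and values projected to `[0, T]` and `[0, νmax]`. -/
def pol (M : Model K) (β : State K → ℝ → ℝ) (y : State K) (u : ℝ) : ℝ :=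
  M.clampν (β y (M.clampT u))

/-- The effective selling rate for the projected policy. -/
def polRate (M : Model K) (β : State K → ℝ → ℝ) (y : State K) (u : ℝ) : ℝ :=
  effRate (M.pol β y) y.2.1 u

/-- The jump intensities along the controlled flow. -/
def killAlong (M : Model K) (β : State K → ℝ → ℝ) (y : State K) (u : ℝ) : Fin K → ℝ :=
  M.kill (y.1 + u) (M.polRate β y u)

/-- The solution of the controlled ODE. -/
def flowSol (M : Model K) (β : State K → ℝ → ℝ) (y : State K) (u : ℝ) : State K :=
  (y.1 + u, y.2.1 - ∫ r in (0 : ℝ)..u, M.polRate β y r, y.2.2.1,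
    filterSol M.q M.killBound (M.killAlong β y) y.2.2.2 u)

variable {M : Model K} {β : State K → ℝ → ℝ}

theorem measurable_pol (hβ : M.IsPolicy β) : Measurable (Function.uncurry (M.pol β)) :=
  M.measurable_clampν.comp (hβ.measurable.comp
    (measurable_fst.prodMk (M.measurable_clampT.comp measurable_snd)))

theorem pol_mem (y : State K) (u : ℝ) : M.pol β y u ∈ Icc 0 M.νmax := M.clampν_mem _

theorem polRate_mem (y : State K) (u : ℝ) : M.polRate β y u ∈ Icc 0 M.νmax :=
  effRate_mem (pol_mem y) _ _

theorem measurable_polRate (hβ : M.IsPolicy β) :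
    Measurable fun p : State K × ℝ => M.polRate β p.1 p.2 :=
  measurable_effRate (measurable_pol hβ) (fun y u => pol_mem y u)
    (w := fun y : State K => y.2.1) (by fun_prop)

theorem measurable_polRate_right (hβ : M.IsPolicy β) (y : State K) : Measurable (M.polRate β y) :=
  (measurable_polRate hβ).of_uncurry_left (f := M.polRate β)

theorem measurable_killAlong (hβ : M.IsPolicy β) :
    Measurable fun p : State K × ℝ => M.killAlong β p.1 p.2 :=
  M.measurable_kill.comp
    (((measurable_fst.comp measurable_fst).add measurable_snd).prodMk (measurable_polRate hβ))

theorem measurable_killAlong_right (hβ : M.IsPolicy β) (y : State K) :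
    Measurable (M.killAlong β y) :=
  (measurable_killAlong hβ).of_uncurry_left (f := M.killAlong β)

theorem killAlong_mem (hM : M.RegularJumps) (y : State K) (u : ℝ) (k : Fin K) :
    M.killAlong β y u k ∈ Icc 0 M.killBound := kill_mem hM _ _ k

theorem measurable_flowSol (hβ : M.IsPolicy β) :
    Measurable fun p : State K × ℝ => M.flowSol β p.1 p.2 := by
  have h1 : Measurable fun p : State K × ℝ => p.1.1 + p.2 := by fun_prop
  have h2 : Measurable fun p : State K × ℝ => p.1.2.1 - ∫ r in (0 : ℝ)..p.2, M.polRate β p.1 r := by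
    have hr : Measurable (Function.uncurry fun (p : State K × ℝ) r => M.polRate β p.1 r) :=
      (measurable_polRate hβ).comp
        ((measurable_fst.comp measurable_fst).prodMk measurable_snd)
    have h0 : Measurable fun p : State K × ℝ => p.1.2.1 := by fun_prop
    exact h0.sub (measurable_intervalIntegral hr measurable_const measurable_snd)
  have h3 : Measurable fun p : State K × ℝ => p.1.2.2.1 := by fun_prop
  have h4 := measurable_filterSol M.q M.killBound (measurable_killAlong hβ)
    (π0 := fun y : State K => y.2.2.2) (by fun_prop)
  exact h1.prodMk (h2.prodMk (h3.prodMk h4))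

theorem polRate_eq (hβ : M.IsPolicy β) {y : State K} (hy : y ∈ M.stateSpace) {u : ℝ}
    (hu : u ∈ Icc 0 M.T) : effRate (β y) y.2.1 u = M.polRate β y u := by
  refine effRate_congr hu.1 fun v hv => ?_
  have hv' : v ∈ Icc 0 M.T := ⟨hv.1, hv.2.trans hu.2⟩
  rw [pol, M.clampT_eq hv', M.clampν_eq (hβ.mem_Icc y hy v hv')]

theorem stateSpace_horizon {y : State K} (hy : y ∈ M.stateSpace) : 0 ≤ M.T - y.1 :=
  sub_nonneg.2 hy.1.2

theorem mem_Icc_of_horizon {y : State K} (hy : y ∈ M.stateSpace) {u : ℝ}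
    (hu : u ∈ Icc 0 (M.T - y.1)) : u ∈ Icc 0 M.T :=
  ⟨hu.1, hu.2.trans (by linarith [hy.1.1])⟩

/-- The amount sold is capped at the initial inventory, so the inventory never becomes negative,
although the cap is encoded only in the rate. -/
theorem inventory_flowSol (hβ : M.IsPolicy β) {y : State K} (hy : y ∈ M.stateSpace) {u : ℝ}
    (hu : 0 ≤ u) :
    (M.flowSol β y u).2.1 = y.2.1 - min (∫ r in (0 : ℝ)..u, M.pol β y r) y.2.1 := by
  change y.2.1 - ∫ r in (0 : ℝ)..u, effRate (M.pol β y) y.2.1 r = _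
  rw [integral_effRate (measurable_pol hβ).of_uncurry_left (pol_mem y) hy.2.1.1 hu]

theorem flowSol_mem (hM : M.RegularJumps) (hβ : M.IsPolicy β) {y : State K}
    (hy : y ∈ M.stateSpace) {u : ℝ} (hu : u ∈ Icc 0 (M.T - y.1)) :
    M.flowSol β y u ∈ M.stateSpace := by
  refine ⟨⟨add_nonneg hy.1.1 hu.1, ?_⟩, ?_, hy.2.2.1, ?_⟩
  · change y.1 + u ≤ M.T
    linarith [hu.2]
  · rw [inventory_flowSol hβ hy hu.1]
    have h1 : 0 ≤ ∫ r in (0 : ℝ)..u, M.pol β y r :=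
      intervalIntegral.integral_nonneg hu.1 fun r _ => (pol_mem y r).1
    have h2 : 0 ≤ min (∫ r in (0 : ℝ)..u, M.pol β y r) y.2.1 := le_min h1 hy.2.1.1
    exact ⟨sub_nonneg.2 (min_le_right _ _), by linarith [hy.2.1.2]⟩
  · exact (filterSol_spec M.isGenerator (measurable_killAlong_right hβ y) (killAlong_mem hM y)
      (killBound_nonneg hM) hy.2.2.2 hu.1).1

theorem flowSol_zero (hM : M.RegularJumps) (hβ : M.IsPolicy β) {y : State K}
    (hy : y ∈ M.stateSpace) : M.flowSol β y 0 = y := by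
  unfold flowSol
  rw [filterSol_zero M.isGenerator (measurable_killAlong_right hβ y) (killAlong_mem hM y)
      (killBound_nonneg hM) hy.2.2.2]
  simp

theorem flowSol_filter_eq (hM : M.RegularJumps) (hβ : M.IsPolicy β) {y : State K}
    (hy : y ∈ M.stateSpace) {u : ℝ} (hu : 0 ≤ u) (i : Fin K) :
    (M.flowSol β y u).2.2.2 i = y.2.2.2 i + ∫ r in (0 : ℝ)..u,
      filterField M.q (M.killAlong β y r) (M.flowSol β y r).2.2.2 i :=
  (filterSol_spec M.isGenerator (measurable_killAlong_right hβ y) (killAlong_mem hM y)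
      (killBound_nonneg hM) hy.2.2.2 hu).2 i

theorem measurable_filterField {Θ : Type*} [MeasurableSpace Θ] {q : Matrix (Fin K) (Fin K) ℝ}
    {a π : Θ → Fin K → ℝ} (ha : Measurable a) (hπ : Measurable π) (i : Fin K) :
    Measurable fun r => filterField q (a r) (π r) i := by
  have ha' : ∀ k, Measurable fun r => a r k := fun k => (measurable_pi_apply k).comp ha
  have hπ' : ∀ k, Measurable fun r => π r k := fun k => (measurable_pi_apply k).comp hπ
  exact (Finset.measurable_sum _ fun j _ => (hπ' j).const_mul _).sub
    ((hπ' i).mul ((ha' i).sub (Finset.measurable_sum _ fun j _ => (hπ' j).mul (ha' j))))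

theorem measurable_flowSol_right (hβ : M.IsPolicy β) (y : State K) : Measurable (M.flowSol β y) :=
  (measurable_flowSol hβ).of_uncurry_left (f := M.flowSol β)

theorem intervalIntegrable_field (hM : M.RegularJumps) (hβ : M.IsPolicy β) {y : State K}
    (hy : y ∈ M.stateSpace) {u : ℝ} (hu : u ∈ Icc 0 (M.T - y.1)) (i : Fin K) :
    IntervalIntegrable (fun r => filterField M.q (M.killAlong β y r) (M.flowSol β y r).2.2.2 i)
      volume 0 u := by
  rw [intervalIntegrable_iff_integrableOn_Icc_of_le hu.1]
  refine Measure.integrableOn_of_bounded (M := genNorm M.q + M.killBound) (by simp)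
    (measurable_filterField (measurable_killAlong_right hβ y)
      (measurable_snd.comp (measurable_snd.comp (measurable_snd.comp
        (measurable_flowSol_right hβ y)))) i).aestronglyMeasurable ?_
  filter_upwards [ae_restrict_mem measurableSet_Icc] with r hr
  exact abs_filterField_le (flowSol_mem hM hβ hy ⟨hr.1, hr.2.trans hu.2⟩).2.2.2
    (killAlong_mem hM y r) i

theorem g_flow (hM : M.RegularJumps) (hβ : M.IsPolicy β) {y : State K} (hy : y ∈ M.stateSpace)
    {u : ℝ} (hu : u ∈ Icc 0 (M.T - y.1)) {z : State K} (hz : z ∈ M.stateSpace)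
    (hz1 : z.1 = y.1 + u) :
    M.g z (effRate (β y) y.2.1 u) =
      (1, -M.polRate β y u, 0, filterField M.q (M.killAlong β y u) z.2.2.2) := by
  rw [polRate_eq hβ hy (mem_Icc_of_horizon hy hu), g_eq hM hz (polRate_mem y u), hz1]
  rfl

theorem isFlow_flowSol (hM : M.RegularJumps) (hβ : M.IsPolicy β) {y : State K}
    (hy : y ∈ M.stateSpace) : M.IsFlow (β y) y (M.flowSol β y) := by
  -- Along `flowSol` the field has this coordinate form. It is integrated one pair at a time, from
  -- the last coordinates outwards, following the nesting of the product.
  set F : ℝ → State K := fun r => (1, -M.polRate β y r, 0,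
    filterField M.q (M.killAlong β y r) (M.flowSol β y r).2.2.2) with hF
  have hg : ∀ r ∈ Icc 0 (M.T - y.1), M.g (M.flowSol β y r) (effRate (β y) y.2.1 r) = F r :=
    fun r hr => g_flow hM hβ hy hr (flowSol_mem hM hβ hy hr) rfl
  have hrm : ∀ u, IntervalIntegrable (M.polRate β y) volume 0 u := fun u =>
    intervalIntegrable_of_mem_Icc (measurable_polRate_right hβ y) (polRate_mem y) 0 u
  have h4 : ∀ u ∈ Icc 0 (M.T - y.1), IntegrableOn
      (fun r => filterField M.q (M.killAlong β y r) (M.flowSol β y r).2.2.2) (Ioc 0 u) :=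
    fun u hu => Integrable.of_eval fun i =>
      (intervalIntegrable_iff_integrableOn_Ioc_of_le hu.1).1
          (intervalIntegrable_field hM hβ hy hu i)
  have h34 : ∀ u ∈ Icc 0 (M.T - y.1), IntegrableOn (fun r => (F r).2.2) (Ioc 0 u) :=
    fun u hu => (integrable_zero _ _ _).prodMk (h4 u hu)
  have h2 : ∀ u ∈ Icc 0 (M.T - y.1), IntegrableOn (fun r => -M.polRate β y r) (Ioc 0 u) :=
    fun u hu => ((intervalIntegrable_iff_integrableOn_Ioc_of_le hu.1).1 (hrm u)).neg
  have h234 : ∀ u ∈ Icc 0 (M.T - y.1), IntegrableOn (fun r => (F r).2) (Ioc 0 u) :=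
    fun u hu => (h2 u hu).prodMk (h34 u hu)
  have h1 : ∀ u : ℝ, IntegrableOn (fun _ : ℝ => (1 : ℝ)) (Ioc 0 u) := fun u => by simp
  have hFi : ∀ u ∈ Icc 0 (M.T - y.1), IntegrableOn F (Ioc 0 u) :=
    fun u hu => (h1 u).prodMk (h234 u hu)
  have hL : M.T - y.1 ∈ Icc 0 (M.T - y.1) := ⟨stateSpace_horizon hy, le_rfl⟩
  refine ⟨fun u hu => flowSol_mem hM hβ hy hu, ?_, fun u hu => ?_⟩
  · rw [intervalIntegrable_iff_integrableOn_Ioc_of_le hL.1]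
    exact (hFi _ hL).congr_fun (fun r hr => (hg r ⟨hr.1.le, hr.2⟩).symm) measurableSet_Ioc
  · have e : ∫ r in (0 : ℝ)..u, M.g (M.flowSol β y r) (effRate (β y) y.2.1 r)
        = ∫ r in Ioc 0 u, F r := by
      rw [intervalIntegral.integral_of_le hu.1]
      exact setIntegral_congr_fun measurableSet_Ioc fun r hr =>
        hg r ⟨hr.1.le, hr.2.trans hu.2⟩
    have e1 : ∫ r in Ioc 0 u, F r = (∫ r in Ioc 0 u, (1 : ℝ), ∫ r in Ioc 0 u, (F r).2) :=
      integral_pair (h1 u) (h234 u hu)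
    have e2 : ∫ r in Ioc 0 u, (F r).2
        = (∫ r in Ioc 0 u, -M.polRate β y r, ∫ r in Ioc 0 u, (F r).2.2) :=
      integral_pair (h2 u hu) (h34 u hu)
    have e3 : ∫ r in Ioc 0 u, (F r).2.2 = (∫ r in Ioc 0 u, (0 : ℝ), ∫ r in Ioc 0 u,
        filterField M.q (M.killAlong β y r) (M.flowSol β y r).2.2.2) :=
      integral_pair (integrable_zero _ _ _) (h4 u hu)
    rw [e, e1, e2, e3, ← intervalIntegral.integral_of_le hu.1, ← intervalIntegral.integral_of_le
        hu.1]
    refine Prod.ext ?_ (Prod.ext ?_ (Prod.ext ?_ (funext fun i => ?_)))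
    · change y.1 + u = y.1 + ∫ r in (0 : ℝ)..u, (1 : ℝ)
      simp
    · change y.2.1 - ∫ r in (0 : ℝ)..u, M.polRate β y r = y.2.1 + ∫ r in
        (0 : ℝ)..u, -M.polRate β y r
      rw [intervalIntegral.integral_neg, sub_eq_add_neg]
    · change y.2.2.1 = y.2.2.1 + ∫ r in Ioc 0 u, (0 : ℝ)
      simp
    · change (M.flowSol β y u).2.2.2 i = y.2.2.2 i + (∫ r in Ioc 0 u,
        filterField M.q (M.killAlong β y r) (M.flowSol β y r).2.2.2) i
      rw [eval_integral fun i => (intervalIntegrable_iff_integrableOn_Ioc_of_le hu.1).1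
        (intervalIntegrable_field hM hβ hy hu i), ← intervalIntegral.integral_of_le hu.1]
      exact flowSol_filter_eq hM hβ hy hu.1 i

/-- The effective rate depends on the policy and the initial inventory, not on `φ`. Once the time
coordinate is known to be `y.1 + u`, the coefficients of the filter equation are given functions of
`u`, and `filterODE_unique` applies. The other coordinates are explicit integrals. -/
theorem IsFlow.eqOn_flowSol (hM : M.RegularJumps) (hβ : M.IsPolicy β) {y : State K}
    (hy : y ∈ M.stateSpace) {φ : ℝ → State K} (hφ : M.IsFlow (β y) y φ) :
    EqOn φ (M.flowSol β y) (Icc 0 (M.T - y.1)) := by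
  set L := M.T - y.1 with hL
  have hL0 : 0 ≤ L := stateSpace_horizon hy
  have hint : ∀ u ∈ Icc 0 L, IntervalIntegrable
      (fun v => M.g (φ v) (effRate (β y) y.2.1 v)) volume 0 u := fun u hu =>
    hφ.integrable.mono_set (by
      rw [uIcc_of_le hL0, uIcc_of_le hu.1]
      exact Icc_subset_Icc le_rfl hu.2)
  -- Continuous linear functionals commute with the vector-valued integral. The coordinates are
  -- extracted in this way.
  have hcomp : ∀ (l : State K →L[ℝ] ℝ), ∀ u ∈ Icc 0 L,
      l (φ u) = l y + ∫ v in (0 : ℝ)..u, l (M.g (φ v) (effRate (β y) y.2.1 v)) := by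
    intro l u hu
    rw [l.intervalIntegral_comp_comm (hint u hu), ← map_add, ← hφ.eq u hu]
  have ht : ∀ u ∈ Icc 0 L, (φ u).1 = y.1 + u := by
    intro u hu
    have := hcomp (ContinuousLinearMap.fst ℝ _ _) u hu
    simpa [g] using this
  have hg : ∀ u ∈ Icc 0 L, M.g (φ u) (effRate (β y) y.2.1 u) =
      (1, -M.polRate β y u, 0, filterField M.q (M.killAlong β y u) (φ u).2.2.2) :=
    fun u hu => g_flow hM hβ hy hu (hφ.mem u hu) (ht u hu)
  have hcomp' : ∀ (l : State K →L[ℝ] ℝ), ∀ u ∈ Icc 0 L, l (φ u) = l y + ∫ v in (0 : ℝ)..u,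
      l (1, -M.polRate β y v, 0, filterField M.q (M.killAlong β y v) (φ v).2.2.2) := by
    intro l u hu
    rw [hcomp l u hu]
    congr 1
    refine intervalIntegral.integral_congr fun v hv => ?_
    rw [uIcc_of_le hu.1] at hv
    simp only [hg v ⟨hv.1, hv.2.trans hu.2⟩]
  let l2 : State K →L[ℝ] ℝ := (ContinuousLinearMap.fst ℝ _ _).comp (ContinuousLinearMap.snd ℝ _ _)
  let l3 : State K →L[ℝ] ℝ := ((ContinuousLinearMap.fst ℝ _ _).comp
    (ContinuousLinearMap.snd ℝ _ _)).comp (ContinuousLinearMap.snd ℝ _ _)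
  let l4 : Fin K → (State K →L[ℝ] ℝ) := fun i => (((ContinuousLinearMap.proj i).comp
    (ContinuousLinearMap.snd ℝ _ _)).comp (ContinuousLinearMap.snd ℝ _ _)).comp
    (ContinuousLinearMap.snd ℝ _ _)
  have hi4 : ∀ i, IntervalIntegrable (fun r => filterField M.q (M.killAlong β y r) (φ r).2.2.2 i)
      volume 0 L := by
    intro i
    rw [intervalIntegrable_iff_integrableOn_Icc_of_le hL0]
    have h := (l4 i).integrable_comp ((intervalIntegrable_iff_integrableOn_Icc_of_le hL0).1
      hφ.integrable)
    refine IntegrableOn.congr_fun h (fun r hr => ?_) measurableSet_Icc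
    simp only [hg r hr]
    rfl
  have hπ := filterODE_unique (C := M.killBound) (π0 := y.2.2.2) (killAlong_mem hM y (β := β))
    (fun t ht => (hφ.mem t ht).2.2.2) (fun t ht => (flowSol_mem hM hβ hy ht).2.2.2) hi4
    (intervalIntegrable_field hM hβ hy ⟨hL0, le_rfl⟩) (fun t ht i => hcomp' (l4 i) t ht)
    (fun t ht i => flowSol_filter_eq hM hβ hy ht.1 i)
  intro u hu
  refine Prod.ext (ht u hu) (Prod.ext ?_ (Prod.ext ?_ (hπ hu)))
  · have := hcomp' l2 u hu
    change (φ u).2.1 = y.2.1 + ∫ v in (0 : ℝ)..u, -M.polRate β y v at this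
    rw [this, intervalIntegral.integral_neg, ← sub_eq_add_neg]
    rfl
  · have := hcomp' l3 u hu
    change (φ u).2.2.1 = y.2.2.1 + ∫ v in (0 : ℝ)..u, (0 : ℝ) at this
    rw [this]
    simp [flowSol]

/-- A flow exists, so the choice in `flow` returns one, and by uniqueness it is the explicit
solution on the relevant interval. -/
theorem flow_eq (hM : M.RegularJumps) (hβ : M.IsPolicy β) {y : State K} (hy : y ∈ M.stateSpace) :
    EqOn (M.flow (β y) y) (M.flowSol β y) (Icc 0 (M.T - y.1)) :=
  IsFlow.eqOn_flowSol hM hβ hy (Classical.epsilon_spec ⟨_, isFlow_flowSol hM hβ hy⟩)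

theorem IsAdmissible.isPolicy {ν : ℕ → State K → ℝ → ℝ} (hν : M.IsAdmissible ν) (n : ℕ) :
    M.IsPolicy (ν n) := ⟨hν.measurable n, hν.mem_Icc n⟩

end Model
end
end Liquidation

namespace Liquidation

noncomputable section

variable {K : ℕ}

/-! ### Functions with one-sided limits -/

/-- `f` is sampled at the next point to the right of `t` in a grid of mesh `1 / (n + 1)`. Each
approximation factors through `ℤ`, so it is measurable whatever `f` is, and right continuity gives
convergence. -/
theorem aemeasurable_of_continuousWithinAt_Ici {E : Type*} [PseudoEMetricSpace E]
    [MeasurableSpace E] [BorelSpace E] {f : ℝ → E} {s : Set ℝ} (hs : MeasurableSet s)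
    (h : ∀ t ∈ s, ContinuousWithinAt f (Ici t) t) : AEMeasurable f (volume.restrict s) := by
  refine aemeasurable_of_tendsto_metrizable_ae atTop
    (f := fun (n : ℕ) t => f ((⌊(n + 1 : ℝ) * t⌋ + 1 : ℝ) / (n + 1 : ℝ))) (fun n => ?_) ?_
  · have h1 : Measurable fun t : ℝ => ⌊(n + 1 : ℝ) * t⌋ :=
      Int.measurable_floor.comp (measurable_id.const_mul _)
    exact ((measurable_from_top (f := fun k : ℤ => f ((k + 1 : ℝ) / (n + 1 : ℝ)))).comp
      h1).aemeasurable
  · filter_upwards [ae_restrict_mem hs] with t ht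
    refine (h t ht).tendsto.comp (tendsto_nhdsWithin_iff.2 ⟨?_, Eventually.of_forall fun n => ?_⟩)
    · refine tendsto_of_tendsto_of_tendsto_of_le_of_le (g := fun _ => t)
        (h := fun n : ℕ => t + 1 / ((n : ℝ) + 1)) tendsto_const_nhds
        (by simpa using tendsto_one_div_add_atTop_nhds_zero_nat.const_add t)
        (fun n => ?_) (fun n => ?_)
      · have hn : (0 : ℝ) < n + 1 := by positivity
        simp only
        rw [le_div_iff₀ hn, mul_comm]
        exact (Int.lt_floor_add_one _).le
      · have hn : (0 : ℝ) < n + 1 := by positivity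
        simp only
        rw [div_le_iff₀ hn, add_mul t, one_div_mul_cancel hn.ne', mul_comm t]
        linarith [Int.floor_le ((n + 1 : ℝ) * t)]
    · have hn : (0 : ℝ) < n + 1 := by positivity
      rw [mem_Ici, le_div_iff₀ hn, mul_comm]
      exact (Int.lt_floor_add_one _).le

/-- Sampling is now at grid points strictly to the left of `t`; the ceiling minus one ensures
strictness, so the samples converge to the left limit. -/
theorem aemeasurable_leftLim {E : Type*} [MetricSpace E]
    [MeasurableSpace E] [BorelSpace E] {f : ℝ → E} {s : Set ℝ} (hs : MeasurableSet s)
    (h : ∀ t ∈ s, ∃ l, Tendsto f (𝓝[<] t) (𝓝 l)) :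
    AEMeasurable (Function.leftLim f) (volume.restrict s) := by
  refine aemeasurable_of_tendsto_metrizable_ae atTop
    (f := fun (n : ℕ) t => f ((⌈(n + 1 : ℝ) * t⌉ - 1 : ℝ) / (n + 1 : ℝ))) (fun n => ?_) ?_
  · have h1 : Measurable fun t : ℝ => ⌈(n + 1 : ℝ) * t⌉ :=
      Int.measurable_ceil.comp (measurable_id.const_mul _)
    exact ((measurable_from_top (f := fun k : ℤ => f ((k - 1 : ℝ) / (n + 1 : ℝ)))).comp
      h1).aemeasurable
  · filter_upwards [ae_restrict_mem hs] with t ht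
    obtain ⟨l, hl⟩ := h t ht
    rw [leftLim_eq_of_tendsto hl]
    have hlt : ∀ n : ℕ, (⌈(n + 1 : ℝ) * t⌉ - 1 : ℝ) / (n + 1 : ℝ) < t := fun n => by
      have hn : (0 : ℝ) < n + 1 := by positivity
      rw [div_lt_iff₀ hn, mul_comm t]
      linarith [Int.ceil_lt_add_one ((n + 1 : ℝ) * t)]
    refine hl.comp (tendsto_nhdsWithin_iff.2 ⟨?_, Eventually.of_forall hlt⟩)
    refine tendsto_of_tendsto_of_tendsto_of_le_of_le (h := fun _ => t)
        (g := fun n : ℕ => t - 1 / ((n : ℝ) + 1)) 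
        (by simpa using tendsto_one_div_add_atTop_nhds_zero_nat.const_sub t) tendsto_const_nhds
        (fun n => ?_) (fun n => (hlt n).le)
    have hn : (0 : ℝ) < n + 1 := by positivity
    simp only
    rw [le_div_iff₀ hn, sub_mul, one_div_mul_cancel hn.ne', mul_comm t]
    linarith [Int.le_ceil ((n + 1 : ℝ) * t)]

namespace Model

variable {M : Model K}

/-! ### Uniqueness for the Kushner-Stratonovich equation -/

section SolvesKS

variable {t0 : ℝ} {π0 : Fin K → ℝ} {τ : ℕ → ℝ≥0∞} {ζ : ℕ → ℝ} {rate : ℝ → ℝ}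
  {π : ℝ → Fin K → ℝ}

theorem SolvesKS.tendsto_leftLim (h : M.SolvesKS t0 π0 τ ζ rate π) {t : ℝ}
    (ht : t ∈ Ioc t0 M.T) : Tendsto π (𝓝[<] t) (𝓝 (Function.leftLim π t)) := by
  obtain ⟨l, hl⟩ := h.left_lim t ht
  rwa [leftLim_eq_of_tendsto hl]

theorem SolvesKS.leftLim_mem (h : M.SolvesKS t0 π0 τ ζ rate π) {t : ℝ}
    (ht : t ∈ Ioc t0 M.T) : Function.leftLim π t ∈ stdSimplex ℝ (Fin K) := by
  refine (isClosed_stdSimplex ℝ (Fin K)).mem_of_tendsto (h.tendsto_leftLim ht) ?_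
  filter_upwards [Ico_mem_nhdsLT ht.1] with s hs using h.mem s ⟨hs.1, hs.2.le.trans ht.2⟩

/-- The nonlinear part of the filter equation. -/
def filterQuad (a π : Fin K → ℝ) (i : Fin K) : ℝ := π i * (a i - ∑ j, π j * a j)

open Classical in
/-- The contributions of the jumps up to time `t` to the filter equation. -/
def jumpTerm (M : Model K) (τ : ℕ → ℝ≥0∞) (ζ : ℕ → ℝ) (rate : ℝ → ℝ) (l : ℝ → Fin K → ℝ) (t : ℝ)
    (i : Fin K) (n : ℕ) : ℝ :=
  if τ (n + 1) ≤ ENNReal.ofReal t then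
    l (τ (n + 1)).toReal i * M.upd i (τ (n + 1)).toReal (rate (τ (n + 1)).toReal)
      (l (τ (n + 1)).toReal) (ζ (n + 1))
  else 0

theorem SolvesKS.eq' (hM : M.RegularJumps) (h0 : 0 ≤ t0) (h : M.SolvesKS t0 π0 τ ζ rate π)
    {e : ℝ} (he : e ≤ M.T) (hr : ∀ r ∈ Ioc t0 e, rate r ∈ Icc 0 M.νmax) {t : ℝ}
    (ht : t ∈ Icc t0 e) (i : Fin K) :
    π t i = π0 i
      + (∫ r in t0..t, ∑ j, M.q j i * π r j)
      + (∑' n : ℕ, M.jumpTerm τ ζ rate (Function.leftLim π) t i n)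
      - ∫ r in t0..t, filterQuad (M.kill r (rate r)) (Function.leftLim π r) i := by
  refine (h.eq t ⟨ht.1, ht.2.trans he⟩ i).trans ?_
  refine congrArg₂ (· - ·) rfl ?_
  refine intervalIntegral.integral_congr_ae (ae_of_all _ fun r hr' => ?_)
  rw [uIoc_of_le ht.1] at hr'
  have hr2 : r ∈ Ioc t0 M.T := ⟨hr'.1, hr'.2.trans (ht.2.trans he)⟩
  exact sum_integral_mul_upd hM ⟨h0.trans hr2.1.le, hr2.2⟩ (hr r ⟨hr'.1, hr'.2.trans ht.2⟩)
    (h.leftLim_mem hr2) i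

/-- Two different rates that agree on `(t0, e]` are allowed. This is what the state equation needs,
where each solution has its own selling rate and the two rates are identified only up to the end of
a segment. -/
theorem SolvesKS.unique (hM : M.RegularJumps) (h0 : 0 ≤ t0) (hτ : M.IsReturnPath t0 τ ζ)
    {rate' : ℝ → ℝ} {π' : ℝ → Fin K → ℝ} (h : M.SolvesKS t0 π0 τ ζ rate π)
    (h' : M.SolvesKS t0 π0 τ ζ rate' π') {e : ℝ} (he : e ≤ M.T)
    (hr : ∀ r ∈ Ioc t0 e, rate r ∈ Icc 0 M.νmax) (hrr : ∀ r ∈ Ioc t0 e, rate r = rate' r)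
    (hrm : AEMeasurable rate (volume.restrict (Ioc t0 e))) : EqOn π π' (Icc t0 e) := by
  have hr' : ∀ r ∈ Ioc t0 e, rate' r ∈ Icc 0 M.νmax := fun r hrm => hrr r hrm ▸ hr r hrm
  have hsub : Ioc t0 e ⊆ Ioc t0 M.T := Ioc_subset_Ioc le_rfl he
  set C := M.killBound with hC
  set Λ := genNorm M.q + 2 * C with hΛ
  have hC0 : 0 ≤ C := killBound_nonneg hM
  have hΛ0 : 0 ≤ Λ := add_nonneg (genNorm_nonneg _) (by positivity)
  set l := Function.leftLim π with hl
  set l' := Function.leftLim π' with hl'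
  have hm : ∀ {rate π}, M.SolvesKS t0 π0 τ ζ rate π →
      AEMeasurable π (volume.restrict (Ioc t0 e)) := by
    intro rate π h
    have : AEMeasurable π (volume.restrict (Ioo t0 e)) :=
      aemeasurable_of_continuousWithinAt_Ici measurableSet_Ioo fun t ht =>
        h.right_cont t ⟨ht.1.le, ht.2.trans_le he⟩
    rwa [Measure.restrict_congr_set Ioo_ae_eq_Ioc] at this
  have hlm : ∀ {rate π}, M.SolvesKS t0 π0 τ ζ rate π →
      AEMeasurable (Function.leftLim π) (volume.restrict (Ioc t0 e)) := fun h =>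
    aemeasurable_leftLim measurableSet_Ioc fun t ht => h.left_lim t (hsub ht)
  have hkm : AEMeasurable (fun r => M.kill r (rate r)) (volume.restrict (Ioc t0 e)) :=
    M.measurable_kill.comp_aemeasurable (aemeasurable_id.prodMk hrm)
  have hev : ∀ {f : ℝ → Fin K → ℝ}, AEMeasurable f (volume.restrict (Ioc t0 e)) → ∀ i,
      AEMeasurable (fun r => f r i) (volume.restrict (Ioc t0 e)) := fun hf i =>
    (measurable_pi_apply i).comp_aemeasurable hf
  have hbdd : ∀ {f : ℝ → ℝ} {D : ℝ}, AEMeasurable f (volume.restrict (Ioc t0 e)) →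
      (∀ r ∈ Ioc t0 e, |f r| ≤ D) → ∀ t ∈ Icc t0 e, IntervalIntegrable f volume t0 t := by
    intro f D hf hD t ht
    rw [intervalIntegrable_iff_integrableOn_Ioc_of_le ht.1]
    refine IntegrableOn.mono_set (t := Ioc t0 e) ?_ (Ioc_subset_Ioc le_rfl ht.2)
    refine Integrable.of_bound hf.aestronglyMeasurable D ?_
    filter_upwards [ae_restrict_mem measurableSet_Ioc] with r hr using hD r hr
  have hA : ∀ {rate π}, M.SolvesKS t0 π0 τ ζ rate π → ∀ i, ∀ t ∈ Icc t0 e,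
      IntervalIntegrable (fun r => ∑ j, M.q j i * π r j) volume t0 t := fun {rate π} h i =>
    hbdd (D := genNorm M.q) (Finset.aemeasurable_fun_sum _ fun j _ => (hev (hm h) j).const_mul _)
      fun r hr => abs_gen_le _ (h.mem r ⟨hr.1.le, hr.2.trans he⟩) i
  have hQ : ∀ {rate' π}, M.SolvesKS t0 π0 τ ζ rate' π → ∀ i, ∀ t ∈ Icc t0 e,
      IntervalIntegrable (fun r => filterQuad (M.kill r (rate r)) (Function.leftLim π r) i)
        volume t0 t := fun {rate' π} h i =>
    hbdd (D := C) ((hev (hlm h) i).mul ((hev hkm i).sub (Finset.aemeasurable_fun_sum _ fun j _ =>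
      (hev (hlm h) j).mul (hev hkm j)))) fun r hr =>
      abs_quad_le (h.leftLim_mem (hsub hr)) (kill_mem hM _ _) i
  set D : ℝ → ℝ := fun r => ∑ j, |π r j - π' r j| with hD
  -- The compensator involves left limits, so their distance has to be controlled as well as `D`. It
  -- is switched off at `t0`, where the equation says nothing about the left limit.
  set D' : ℝ → ℝ := (Ioi t0).indicator fun r => ∑ j, |l r j - l' r j| with hD'
  have hDm : AEMeasurable D (volume.restrict (Ioc t0 e)) :=
    Finset.aemeasurable_fun_sum _ fun j _ => ((hev (hm h) j).sub (hev (hm h') j)).abs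
  have hD'm : AEMeasurable D' (volume.restrict (Ioc t0 e)) :=
    (Finset.aemeasurable_fun_sum _ fun j _ =>
      ((hev (hlm h) j).sub (hev (hlm h') j)).abs).indicator measurableSet_Ioi
  have h2 : ∀ {p p' : Fin K → ℝ}, p ∈ stdSimplex ℝ (Fin K) → p' ∈ stdSimplex ℝ (Fin K) →
      abs (∑ j, |p j - p' j|) ≤ 2 := by
    intro p p' hp hp'
    rw [abs_of_nonneg (Finset.sum_nonneg fun _ _ => abs_nonneg _)]
    calc ∑ j, |p j - p' j| ≤ ∑ j, (p j + p' j) := Finset.sum_le_sum fun j _ =>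
          (abs_sub _ _).trans_eq (by rw [abs_of_nonneg (hp.1 j), abs_of_nonneg (hp'.1 j)])
      _ = 2 := by rw [Finset.sum_add_distrib, hp.2, hp'.2]; norm_num
  have hDi : ∀ t ∈ Icc t0 e, IntervalIntegrable D volume t0 t := hbdd (D := 2) hDm fun r hr =>
    h2 (h.mem r ⟨hr.1.le, hr.2.trans he⟩) (h'.mem r ⟨hr.1.le, hr.2.trans he⟩)
  have hD'i : ∀ t ∈ Icc t0 e, IntervalIntegrable D' volume t0 t := hbdd (D := 2) hD'm fun r hr => by
    rw [hD', indicator_of_mem (show r ∈ Ioi t0 from hr.1)]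
    exact h2 (h.leftLim_mem (hsub hr)) (h'.leftLim_mem (hsub hr))
  have hD0 : ∀ r, 0 ≤ D r := fun r => Finset.sum_nonneg fun _ _ => abs_nonneg _
  have hD'0 : ∀ r, 0 ≤ D' r := fun r =>
    indicator_nonneg (fun _ _ => Finset.sum_nonneg fun _ _ => abs_nonneg _) r
  set H : ℝ → ℝ := fun r => D r + D' r with hH
  have hH0 : ∀ r, 0 ≤ H r := fun r => add_nonneg (hD0 r) (hD'0 r)
  have hHi : ∀ t ∈ Icc t0 e, IntervalIntegrable H volume t0 t := fun t ht =>
    (hDi t ht).add (hD'i t ht)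
  have hHmono : ∀ s ∈ Icc t0 e, ∀ t ∈ Icc t0 e, s ≤ t → ∫ r in t0..s, H r ≤ ∫ r in t0..t, H r := by
    intro s hs t ht hst
    exact intervalIntegral.integral_mono_interval le_rfl hs.1 hst (ae_of_all _ fun r => hH0 r)
      (hHi t ht)
  -- Induction over the jumps. The step proves agreement before jump `m + 1`, which includes the
  -- instant of jump `m`; there the left limits already agree by the induction hypothesis.
  have key : ∀ m, ∀ t ∈ Icc t0 e, ENNReal.ofReal t < τ m → π t = π' t := by
    intro m
    induction m with
    | zero =>
      intro t ht hlt
      rw [hτ.initial] at hlt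
      exact absurd (ENNReal.ofReal_le_ofReal ht.1) (not_le.2 hlt)
    | succ m ih =>
      intro t ht hlt
      have hjump : ∀ s ∈ Icc t0 t, ∀ n, τ (n + 1) ≤ ENNReal.ofReal s →
          (τ (n + 1)).toReal ∈ Ioc t0 e ∧ l (τ (n + 1)).toReal = l' (τ (n + 1)).toReal := by
        intro s hs n hn
        have hτm : Monotone τ := monotone_nat_of_le_succ fun k => by
          by_cases hk : τ k = ⊤
          · rw [hk, (hτ.increasing k).2 hk]
          · exact ((hτ.increasing k).1 (lt_top_iff_ne_top.2 hk)).le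
        have hnm : n + 1 ≤ m := by
          by_contra! hcon
          have := (hτm (show m + 1 ≤ n + 1 from hcon)).trans hn
          exact absurd (this.trans (ENNReal.ofReal_le_ofReal hs.2)) (not_le.2 hlt)
        have hfin : τ (n + 1) ≠ ⊤ := (hn.trans_lt ENNReal.ofReal_lt_top).ne
        have hτn : τ n ≠ ⊤ := fun hcon => hfin ((hτ.increasing n).2 hcon)
        have hgt : t0 < (τ (n + 1)).toReal := by
          have h1 := (hτ.increasing n).1 (lt_top_iff_ne_top.2 hτn)
          have h3 : ENNReal.ofReal t0 < τ (n + 1) :=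
            (hτ.initial ▸ hτm (Nat.zero_le n) : ENNReal.ofReal t0 ≤ τ n).trans_lt h1
          exact (ENNReal.ofReal_lt_iff_lt_toReal h0 hfin).1 h3
        have hle : (τ (n + 1)).toReal ≤ s :=
          ENNReal.toReal_le_of_le_ofReal (h0.trans hs.1) hn
        have hmem : (τ (n + 1)).toReal ∈ Ioc t0 e := ⟨hgt, hle.trans (hs.2.trans ht.2)⟩
        refine ⟨hmem, tendsto_nhds_unique_of_eventuallyEq (h.tendsto_leftLim (hsub hmem))
          (h'.tendsto_leftLim (hsub hmem)) ?_⟩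
        filter_upwards [Ico_mem_nhdsLT hgt] with r hr
        refine ih r ⟨hr.1, hr.2.le.trans hmem.2⟩ ?_
        exact ((ENNReal.ofReal_lt_iff_lt_toReal (h0.trans hr.1) hfin).2 hr.2).trans_le (hτm hnm)
      have hone : ∀ s ∈ Icc t0 t, ∀ i, |π s i - π' s i| ≤ Λ * ∫ r in t0..s, H r := by
        intro s hs i
        have hs' : s ∈ Icc t0 e := ⟨hs.1, hs.2.trans ht.2⟩
        have e1 := h.eq' hM h0 he hr hs' i
        have e2 := h'.eq' hM h0 he hr' hs' i
        have e3 : ∫ r in t0..s, filterQuad (M.kill r (rate' r)) (l' r) i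
            = ∫ r in t0..s, filterQuad (M.kill r (rate r)) (l' r) i := by
          refine intervalIntegral.integral_congr_ae (ae_of_all _ fun r hr' => ?_)
          rw [uIoc_of_le hs.1] at hr'
          rw [hrr r ⟨hr'.1, hr'.2.trans hs'.2⟩]
        -- Every jump up to `s` occurs where the left limits and the rates agree, so the two series
        -- coincide term by term and summability plays no role.
        have e4 : ∑' n : ℕ, M.jumpTerm τ ζ rate l s i n = ∑' n : ℕ, M.jumpTerm τ ζ rate' l' s i n
            := by
          congr 1
          ext n
          unfold jumpTerm
          split_ifs with hn
          · obtain ⟨hj1, hj2⟩ := hjump s hs n hn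
            rw [hj2, hrr _ hj1]
          · rfl
        rw [e1, e2, e3, e4]
        have e5 : ∀ (p a a' b b' c : ℝ), p + a + c - b - (p + a' + c - b') = (a - a') - (b - b') :=
          fun p a a' b b' c => by ring
        rw [e5, ← intervalIntegral.integral_sub (hA h i s hs') (hA h' i s hs'),
          ← intervalIntegral.integral_sub (hQ h i s hs') (hQ h' i s hs'),
          ← intervalIntegral.integral_sub ((hA h i s hs').sub (hA h' i s hs'))
            ((hQ h i s hs').sub (hQ h' i s hs')), ← intervalIntegral.integral_const_mul,
          ← Real.norm_eq_abs]
        refine intervalIntegral.norm_integral_le_of_norm_le hs.1 (ae_of_all _ fun r hr'' => ?_)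
          ((hHi s hs').const_mul _)
        have hr1 : r ∈ Ioc t0 e := ⟨hr''.1, hr''.2.trans hs'.2⟩
        have hr2 : r ∈ Icc t0 M.T := ⟨hr1.1.le, hr1.2.trans he⟩
        have b1 := abs_gen_sub_le M.q (π r) (π' r) i
        have b2 := abs_quad_sub_le (h.leftLim_mem (hsub hr1)) (h'.leftLim_mem (hsub hr1))
          (kill_mem hM r (rate r)) i
        have b3 : D' r = ∑ j, |l r j - l' r j| := indicator_of_mem (show r ∈ Ioi t0 from hr''.1) _
        have b4 := mul_nonneg (genNorm_nonneg M.q) (hD'0 r)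
        have b5 : 0 ≤ 2 * C * D r := mul_nonneg (by positivity) (hD0 r)
        refine (abs_sub _ _).trans ((add_le_add b1 b2).trans ?_)
        rw [← b3, hΛ, hH]
        change genNorm M.q * D r + 2 * C * D' r ≤ (genNorm M.q + 2 * C) * (D r + D' r)
        linarith
      -- The factor `K` counts components, and the factor `2` counts `D` and `D'`. The bound for
      -- `D'` is the limit from the left of the bounds for `D`, as the integral of `H` is monotone
      -- in its upper limit.
      have htwo : ∀ s ∈ Icc t0 t, H s ≤ (2 * K * Λ) * ∫ r in t0..s, H r := by
        intro s hs
        have c1 : D s ≤ K * (Λ * ∫ r in t0..s, H r) := by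
          calc D s ≤ ∑ _j : Fin K, Λ * ∫ r in t0..s, H r := Finset.sum_le_sum fun j _ => hone s hs j
            _ = _ := by simp
        have c0 : 0 ≤ K * (Λ * ∫ r in t0..s, H r) := (hD0 s).trans c1
        have c2 : D' s ≤ K * (Λ * ∫ r in t0..s, H r) := by
          by_cases hst : t0 < s
          · have hs1 : s ∈ Ioc t0 M.T := ⟨hst, hs.2.trans (ht.2.trans he)⟩
            rw [hD', indicator_of_mem (show s ∈ Ioi t0 from hst)]
            calc ∑ j, |l s j - l' s j| ≤ ∑ _j : Fin K, Λ * ∫ r in t0..s, H r := by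
                  refine Finset.sum_le_sum fun j _ => ?_
                  have c3 : Tendsto (fun r => |π r j - π' r j|) (𝓝[<] s) (𝓝 |l s j - l' s j|) :=
                    (((continuous_apply j).tendsto _).comp (h.tendsto_leftLim hs1)).sub
                      (((continuous_apply j).tendsto _).comp (h'.tendsto_leftLim hs1)) |>.abs
                  refine le_of_tendsto c3 ?_
                  filter_upwards [Ico_mem_nhdsLT hst] with r hr
                  refine (hone r ⟨hr.1, hr.2.le.trans hs.2⟩ j).trans
                    (mul_le_mul_of_nonneg_left ?_ hΛ0)
                  exact hHmono r ⟨hr.1, hr.2.le.trans (hs.2.trans ht.2)⟩ s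
                    ⟨hs.1, hs.2.trans ht.2⟩ hr.2.le
              _ = _ := by simp
          · rw [hD', indicator_of_notMem (show s ∉ Ioi t0 from hst)]
            exact c0
        calc H s = D s + D' s := rfl
          _ ≤ _ := add_le_add c1 c2
          _ = _ := by ring
      have hz := eq_zero_of_le_integral (hHi t ht) (fun s _ => hH0 s) htwo t ⟨ht.1, le_rfl⟩
      have hz' : D t = 0 := le_antisymm (by linarith [hD'0 t, show D t + D' t = 0 from hz]) (hD0 t)
      ext i
      have := (Finset.sum_eq_zero_iff_of_nonneg fun i _ => abs_nonneg _).1 hz' i (Finset.mem_univ i)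
      exact sub_eq_zero.1 (abs_eq_zero.1 this)
  obtain ⟨N, hN⟩ := hτ.finite
  exact fun t ht => key N t ht (hN ▸ ENNReal.ofReal_lt_top)

end SolvesKS

end Model
end
end Liquidation

namespace Liquidation

noncomputable section

variable {K : ℕ}

theorem exists_le_lt_succ {τ : ℕ → ℝ≥0∞} {a : ℝ≥0∞} (h0 : τ 0 ≤ a) (hfin : ∃ n, τ n = ⊤)
    (ha : a ≠ ⊤) : ∃ m, τ m ≤ a ∧ a < τ (m + 1) := by
  by_contra! hcon
  obtain ⟨n, hn⟩ := hfin
  have h : ∀ m, τ m ≤ a := fun m => by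
    induction m with
    | zero => exact h0
    | succ m ih => exact hcon m ih
  exact ha (top_le_iff.1 (hn ▸ h n))

theorem exists_lt_le_succ {τ : ℕ → ℝ≥0∞} {a : ℝ≥0∞} (h0 : τ 0 < a) (hfin : ∃ n, τ n = ⊤) :
    ∃ m, τ m < a ∧ a ≤ τ (m + 1) := by
  by_contra! hcon
  obtain ⟨n, hn⟩ := hfin
  have h : ∀ m, τ m < a := fun m => by
    induction m with
    | zero => exact h0
    | succ m ih => exact hcon m ih
  exact not_top_lt (hn ▸ h n)

namespace Model

variable {M : Model K}

/-! ### Return paths -/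

section ReturnPath

variable {t0 : ℝ} {τ : ℕ → ℝ≥0∞} {ζ : ℕ → ℝ}

theorem IsReturnPath.monotone (h : M.IsReturnPath t0 τ ζ) : Monotone τ :=
  monotone_nat_of_le_succ fun k => by
    by_cases hk : τ k = ⊤
    · rw [hk, (h.increasing k).2 hk]
    · exact ((h.increasing k).1 (lt_top_iff_ne_top.2 hk)).le

theorem IsReturnPath.ne_top_of_succ (h : M.IsReturnPath t0 τ ζ) {m : ℕ} (hm : τ (m + 1) ≠ ⊤) :
    τ m ≠ ⊤ := fun hcon => hm ((h.increasing m).2 hcon)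

theorem IsReturnPath.toReal_mem (h : M.IsReturnPath t0 τ ζ) {m : ℕ}
    (hm : τ m ≠ ⊤) : (τ m).toReal ∈ Icc t0 M.T := by
  refine ⟨?_, ENNReal.toReal_le_of_le_ofReal M.T_pos.le (h.le_horizon m (lt_top_iff_ne_top.2 hm))⟩
  rw [← ENNReal.ofReal_le_iff_le_toReal hm, ← h.initial]
  exact h.monotone (Nat.zero_le m)

theorem IsReturnPath.toReal_zero (h : M.IsReturnPath t0 τ ζ) (h0 : 0 ≤ t0) : (τ 0).toReal = t0 := by
  rw [h.initial, ENNReal.toReal_ofReal h0]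

theorem IsReturnPath.toReal_lt_succ (h : M.IsReturnPath t0 τ ζ) {m : ℕ} (hm : τ (m + 1) ≠ ⊤) :
    (τ m).toReal < (τ (m + 1)).toReal :=
  (ENNReal.toReal_lt_toReal (h.ne_top_of_succ hm) hm).2
    ((h.increasing m).1 (lt_top_iff_ne_top.2 (h.ne_top_of_succ hm)))

/-- The end of the time interval between the `m`-th jump and the next one. -/
def segEnd (M : Model K) (τ : ℕ → ℝ≥0∞) (m : ℕ) : ℝ := (min (τ (m + 1)) (ENNReal.ofReal M.T)).toReal

theorem segEnd_eq (h : M.IsReturnPath t0 τ ζ) {m : ℕ} (hm : τ (m + 1) ≠ ⊤) :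
    M.segEnd τ m = (τ (m + 1)).toReal := by
  rw [segEnd, min_eq_left (h.le_horizon _ (lt_top_iff_ne_top.2 hm))]

theorem segEnd_le (τ : ℕ → ℝ≥0∞) (m : ℕ) : M.segEnd τ m ≤ M.T :=
  ENNReal.toReal_le_of_le_ofReal M.T_pos.le (min_le_right _ _)

theorem le_segEnd (h : M.IsReturnPath t0 τ ζ) {m : ℕ} (hm : τ m ≠ ⊤) :
    (τ m).toReal ≤ M.segEnd τ m := by
  by_cases hm' : τ (m + 1) = ⊤
  · rw [segEnd, hm', min_eq_right le_top, ENNReal.toReal_ofReal M.T_pos.le]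
    exact (h.toReal_mem hm).2
  · rw [segEnd_eq h hm']
    exact (h.toReal_lt_succ hm').le

theorem le_segEnd_of_le {t : ℝ} {τ : ℕ → ℝ≥0∞} {m : ℕ} (ht : t ≤ M.T)
    (hm : ENNReal.ofReal t ≤ τ (m + 1)) : t ≤ M.segEnd τ m := by
  rw [segEnd, ← ENNReal.ofReal_le_iff_le_toReal (ne_top_of_le_ne_top ENNReal.ofReal_ne_top
    (min_le_right _ _))]
  exact le_min hm (ENNReal.ofReal_le_ofReal ht)

theorem lt_succ_of_lt_segEnd {t : ℝ} {τ : ℕ → ℝ≥0∞} (ht0 : 0 ≤ t) {m : ℕ}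
    (ht : t < M.segEnd τ m) : ENNReal.ofReal t < τ (m + 1) :=
  ((ENNReal.ofReal_lt_iff_lt_toReal ht0 (ne_top_of_le_ne_top ENNReal.ofReal_ne_top
    (min_le_right _ _))).2 ht).trans_le (min_le_left _ _)

end ReturnPath

/-! ### Solutions of the Kushner-Stratonovich equation from their pieces -/

/-- `π` is composed of the curves `c m`, which solve the filter equation between the jumps. -/
structure IsPieced (M : Model K) (π0 : Fin K → ℝ) (τ : ℕ → ℝ≥0∞) (ζ : ℕ → ℝ)
    (rate : ℝ → ℝ) (c : ℕ → ℝ → Fin K → ℝ) (π : ℝ → Fin K → ℝ) : Prop where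
  mem : ∀ m, τ m ≠ ⊤ → ∀ t ∈ Icc (τ m).toReal (M.segEnd τ m), c m t ∈ stdSimplex ℝ (Fin K)
  integrable : ∀ m, τ m ≠ ⊤ → ∀ i, IntervalIntegrable
    (fun r => filterField M.q (M.kill r (rate r)) (c m r) i) volume (τ m).toReal (M.segEnd τ m)
  ode : ∀ m, τ m ≠ ⊤ → ∀ t ∈ Icc (τ m).toReal (M.segEnd τ m), ∀ i, c m t i = c m (τ m).toReal i
    + ∫ r in (τ m).toReal..t, filterField M.q (M.kill r (rate r)) (c m r) i
  eq : ∀ m, τ m ≠ ⊤ → ∀ t ∈ Icc (τ m).toReal M.T, ENNReal.ofReal t < τ (m + 1) → π t = c m t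
  initial : c 0 (τ 0).toReal = π0
  jump : ∀ m, τ (m + 1) ≠ ⊤ → ∀ i, c (m + 1) (τ (m + 1)).toReal i = c m (τ (m + 1)).toReal i *
    (1 + M.upd i (τ (m + 1)).toReal (rate (τ (m + 1)).toReal) (c m (τ (m + 1)).toReal) (ζ (m + 1)))

section IsPieced

variable {t0 : ℝ} {π0 : Fin K → ℝ} {τ : ℕ → ℝ≥0∞} {ζ : ℕ → ℝ} {rate : ℝ → ℝ}
  {c : ℕ → ℝ → Fin K → ℝ} {π : ℝ → Fin K → ℝ}

theorem IsPieced.continuousOn (h : M.IsPieced π0 τ ζ rate c π) (hτ : M.IsReturnPath t0 τ ζ)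
    {m : ℕ} (hm : τ m ≠ ⊤) :
    ContinuousOn (c m) (Icc (τ m).toReal (M.segEnd τ m)) := by
  have hle := le_segEnd hτ hm
  have hu : uIcc (τ m).toReal (M.segEnd τ m) = Icc (τ m).toReal (M.segEnd τ m) := uIcc_of_le hle
  refine continuousOn_pi.2 fun i => ContinuousOn.congr (f := fun t => c m (τ m).toReal i
    + ∫ r in (τ m).toReal..t, filterField M.q (M.kill r (rate r)) (c m r) i)
    (continuousOn_const.add ?_) fun t ht => h.ode m hm t ht i
  refine hu ▸ intervalIntegral.continuousOn_primitive_interval ?_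
  rw [hu]
  exact (intervalIntegrable_iff_integrableOn_Icc_of_le hle).1 (h.integrable m hm i)

theorem IsPieced.eq_of_lt_segEnd (h : M.IsPieced π0 τ ζ rate c π)
    {m : ℕ} (hm : τ m ≠ ⊤) {t : ℝ} (ht : t ∈ Ico (τ m).toReal (M.segEnd τ m)) : π t = c m t :=
  h.eq m hm t ⟨ht.1, ht.2.le.trans (segEnd_le τ m)⟩
    (lt_succ_of_lt_segEnd (ENNReal.toReal_nonneg.trans ht.1) ht.2)

theorem IsPieced.tendsto (h : M.IsPieced π0 τ ζ rate c π) (hτ : M.IsReturnPath t0 τ ζ)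
    {m : ℕ} (hm : τ m ≠ ⊤) {t : ℝ} (ht : t ∈ Ioc (τ m).toReal (M.segEnd τ m)) :
    Tendsto π (𝓝[<] t) (𝓝 (c m t)) := by
  have h1 : Tendsto (c m) (𝓝[<] t) (𝓝 (c m t)) :=
    ((h.continuousOn hτ hm) t ⟨ht.1.le, ht.2⟩).mono_of_mem_nhdsWithin
      (mem_of_superset (Ico_mem_nhdsLT ht.1) fun r hr => ⟨hr.1, hr.2.le.trans ht.2⟩)
  refine h1.congr' ?_
  filter_upwards [Ico_mem_nhdsLT ht.1] with r hr
  exact (h.eq_of_lt_segEnd hm ⟨hr.1, hr.2.trans_le ht.2⟩).symm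

theorem IsPieced.leftLim_eq (h : M.IsPieced π0 τ ζ rate c π) (hτ : M.IsReturnPath t0 τ ζ)
    {m : ℕ} (hm : τ m ≠ ⊤) {t : ℝ} (ht : t ∈ Ioc (τ m).toReal (M.segEnd τ m)) :
    Function.leftLim π t = c m t := leftLim_eq_of_tendsto (h.tendsto hτ hm ht)

theorem IsReturnPath.exists_seg (hτ : M.IsReturnPath t0 τ ζ) (h0 : 0 ≤ t0) {t : ℝ}
    (ht : t ∈ Icc t0 M.T) : ∃ m, τ m ≠ ⊤ ∧ t ∈ Icc (τ m).toReal (M.segEnd τ m) ∧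
      τ m ≤ ENNReal.ofReal t ∧ ENNReal.ofReal t < τ (m + 1) := by
  obtain ⟨m, h1, h2⟩ := exists_le_lt_succ (a := ENNReal.ofReal t)
    (by rw [hτ.initial]; exact ENNReal.ofReal_le_ofReal ht.1) hτ.finite ENNReal.ofReal_ne_top
  have hm : τ m ≠ ⊤ := (h1.trans_lt ENNReal.ofReal_lt_top).ne
  exact ⟨m, hm, ⟨ENNReal.toReal_le_of_le_ofReal (h0.trans ht.1) h1,
    le_segEnd_of_le ht.2 h2.le⟩, h1, h2⟩

theorem IsReturnPath.exists_seg_left (hτ : M.IsReturnPath t0 τ ζ) (h0 : 0 ≤ t0) {t : ℝ}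
    (ht : t ∈ Ioc t0 M.T) : ∃ m, τ m ≠ ⊤ ∧ t ∈ Ioc (τ m).toReal (M.segEnd τ m) ∧
      τ m < ENNReal.ofReal t ∧ ENNReal.ofReal t ≤ τ (m + 1) := by
  obtain ⟨m, h1, h2⟩ := exists_lt_le_succ (a := ENNReal.ofReal t)
    (by rw [hτ.initial]; exact (ENNReal.ofReal_lt_ofReal_iff (h0.trans_lt ht.1)).2 ht.1) hτ.finite
  have hm : τ m ≠ ⊤ := (h1.trans ENNReal.ofReal_lt_top).ne
  exact ⟨m, hm, ⟨(ENNReal.lt_ofReal_iff_toReal_lt hm).1 h1,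
    le_segEnd_of_le ht.2 h2⟩, h1, h2⟩

/-- Summing the ODE over the segments and the update rule over the jumps telescopes to the integral
equation. -/
theorem IsPieced.solvesKS (hM : M.RegularJumps) (h : M.IsPieced π0 τ ζ rate c π)
    (hτ : M.IsReturnPath t0 τ ζ) (h0 : 0 ≤ t0)
    (hr : ∀ r ∈ Ioc t0 M.T, rate r ∈ Icc 0 M.νmax) : M.SolvesKS t0 π0 τ ζ rate π := by
  have hmem : ∀ t ∈ Icc t0 M.T, π t ∈ stdSimplex ℝ (Fin K) := by
    intro t ht
    obtain ⟨m, hm, h1, h2, h3⟩ := hτ.exists_seg h0 ht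
    rw [h.eq m hm t ⟨h1.1, ht.2⟩ h3]
    exact h.mem m hm t h1
  have hrc : ∀ t ∈ Ico t0 M.T, ContinuousWithinAt π (Ici t) t := by
    intro t ht
    obtain ⟨m, hm, h1, h2, h3⟩ := hτ.exists_seg h0 ⟨ht.1, ht.2.le⟩
    have hlt : t < M.segEnd τ m := by
      rw [segEnd, ← ENNReal.ofReal_lt_iff_lt_toReal (h0.trans ht.1) (ne_top_of_le_ne_top
        ENNReal.ofReal_ne_top (min_le_right _ _))]
      exact lt_min h3 ((ENNReal.ofReal_lt_ofReal_iff M.T_pos).2 ht.2)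
    have hc : ContinuousWithinAt (c m) (Ici t) t :=
      ((h.continuousOn hτ hm) t h1).mono_of_mem_nhdsWithin
        (mem_of_superset (Ico_mem_nhdsGE hlt) fun r hr => ⟨h1.1.trans hr.1, hr.2.le⟩)
    refine hc.congr_of_eventuallyEq ?_ (h.eq_of_lt_segEnd hm ⟨h1.1, hlt⟩)
    filter_upwards [Ico_mem_nhdsGE hlt] with r hr
    exact h.eq_of_lt_segEnd hm ⟨h1.1.trans hr.1, hr.2⟩
  have hll : ∀ t ∈ Ioc t0 M.T, ∃ l, Tendsto π (𝓝[<] t) (𝓝 l) := by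
    intro t ht
    obtain ⟨m, hm, h1, -⟩ := hτ.exists_seg_left h0 ht
    exact ⟨_, h.tendsto hτ hm h1⟩
  have hlmem : ∀ t ∈ Ioc t0 M.T, Function.leftLim π t ∈ stdSimplex ℝ (Fin K) := by
    intro t ht
    obtain ⟨m, hm, h1, -⟩ := hτ.exists_seg_left h0 ht
    rw [h.leftLim_eq hτ hm h1]
    exact h.mem m hm t ⟨h1.1.le, h1.2⟩
  refine ⟨hmem, hrc, hll, fun t ht i => ?_⟩
  set F : ℝ → ℝ := fun r => filterField M.q (M.kill r (rate r)) (π r) i with hF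
  set J : ℕ → ℝ := fun n => Function.leftLim π (τ (n + 1)).toReal i *
    M.upd i (τ (n + 1)).toReal (rate (τ (n + 1)).toReal)
      (Function.leftLim π (τ (n + 1)).toReal) (ζ (n + 1)) with hJ
  -- At the right end of a segment `π` may already have jumped while `c m` carries the left limit.
  -- Agreement on the open interval is enough for integrals.
  have hFc : ∀ m, τ m ≠ ⊤ → ∀ r ∈ Ioo (τ m).toReal (M.segEnd τ m),
      F r = filterField M.q (M.kill r (rate r)) (c m r) i := fun m hm r hr => by
    rw [hF]
    simp only [h.eq_of_lt_segEnd hm ⟨hr.1.le, hr.2⟩]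
  have hFi : ∀ m, τ m ≠ ⊤ → IntervalIntegrable F volume (τ m).toReal (M.segEnd τ m) := by
    intro m hm
    have hle := le_segEnd hτ hm
    have h1 := (intervalIntegrable_iff_integrableOn_Ioo_of_le hle).1 (h.integrable m hm i)
    exact (intervalIntegrable_iff_integrableOn_Ioo_of_le hle).2
      (h1.congr_fun (fun r hr => (hFc m hm r hr).symm) measurableSet_Ioo)
  have hode : ∀ m, τ m ≠ ⊤ → ∀ t ∈ Icc (τ m).toReal (M.segEnd τ m),
      c m t i = c m (τ m).toReal i + ∫ r in (τ m).toReal..t, F r := by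
    intro m hm t ht
    rw [h.ode m hm t ht i]
    congr 1
    rw [intervalIntegral.integral_of_le ht.1, intervalIntegral.integral_of_le ht.1,
      integral_Ioc_eq_integral_Ioo, integral_Ioc_eq_integral_Ioo]
    exact setIntegral_congr_fun measurableSet_Ioo fun r hr =>
      (hFc m hm r ⟨hr.1, hr.2.trans_le ht.2⟩).symm
  have hsum : ∀ m, τ m ≠ ⊤ → IntervalIntegrable F volume t0 (M.segEnd τ m) ∧
      ∀ t ∈ Icc (τ m).toReal (M.segEnd τ m),
        c m t i = π0 i + (∫ r in t0..t, F r) + ∑ n ∈ Finset.range m, J n := by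
    intro m
    induction m with
    | zero =>
      intro hm
      have hz := hτ.toReal_zero h0
      refine ⟨hz ▸ hFi 0 hm, fun t ht => ?_⟩
      rw [hode 0 hm t ht, h.initial, hz]
      simp
    | succ m ih =>
      intro hm
      have hm' := hτ.ne_top_of_succ hm
      obtain ⟨ih1, ih2⟩ := ih hm'
      have hlt := hτ.toReal_lt_succ hm
      have he := segEnd_eq hτ hm
      rw [he] at ih1 ih2
      refine ⟨ih1.trans (hFi _ hm), fun t ht => ?_⟩
      have hl : Function.leftLim π (τ (m + 1)).toReal = c m (τ (m + 1)).toReal :=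
        h.leftLim_eq hτ hm' ⟨hlt, he.ge⟩
      have hsub : IntervalIntegrable F volume (τ (m + 1)).toReal t := (hFi _ hm).mono_set (by
        rw [uIcc_of_le ht.1, uIcc_of_le (ht.1.trans ht.2)]; exact Icc_subset_Icc le_rfl ht.2)
      have hJm : J m = c m (τ (m + 1)).toReal i * M.upd i (τ (m + 1)).toReal
          (rate (τ (m + 1)).toReal) (c m (τ (m + 1)).toReal) (ζ (m + 1)) := by simp only [hJ, hl]
      rw [hode _ hm t ht, h.jump m hm i, Finset.sum_range_succ, hJm,
        ← intervalIntegral.integral_add_adjacent_intervals ih1 hsub]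
      linear_combination ih2 _ ⟨hlt.le, le_rfl⟩
  obtain ⟨m, hm, h1, h2, h3⟩ := hτ.exists_seg h0 ht
  obtain ⟨hs1, hs2⟩ := hsum m hm
  have hFt : IntervalIntegrable F volume t0 t := hs1.mono_set (by
    rw [uIcc_of_le ht.1, uIcc_of_le (ht.1.trans h1.2)]; exact Icc_subset_Icc le_rfl h1.2)
  have hπm : AEMeasurable π (volume.restrict (Ioc t0 t)) := by
    have : AEMeasurable π (volume.restrict (Ioo t0 t)) :=
      aemeasurable_of_continuousWithinAt_Ici measurableSet_Ioo fun r hr =>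
        hrc r ⟨hr.1.le, hr.2.trans_le ht.2⟩
    rwa [Measure.restrict_congr_set Ioo_ae_eq_Ioc] at this
  have hA : IntervalIntegrable (fun r => ∑ j, M.q j i * π r j) volume t0 t := by
    rw [intervalIntegrable_iff_integrableOn_Ioc_of_le ht.1]
    refine Integrable.of_bound (Finset.aemeasurable_fun_sum _ fun j _ =>
      ((measurable_pi_apply j).comp_aemeasurable hπm).const_mul _).aestronglyMeasurable
      (genNorm M.q) ?_
    filter_upwards [ae_restrict_mem measurableSet_Ioc] with r hr
    exact abs_gen_le M.q (hmem r ⟨hr.1.le, hr.2.trans ht.2⟩) i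
  have hQ : IntervalIntegrable (fun r => filterQuad (M.kill r (rate r)) (π r) i) volume t0 t := by
    have := hA.sub hFt
    exact this.congr fun r _ => by simp only [hF, filterField, filterQuad]; ring
  have hFsplit : ∫ r in t0..t, F r = (∫ r in t0..t, ∑ j, M.q j i * π r j)
      - ∫ r in t0..t, filterQuad (M.kill r (rate r)) (π r) i := by
    rw [← intervalIntegral.integral_sub hA hQ]
    rfl
  have hcomp : ∫ r in t0..t, ∑ j, Function.leftLim π r j *
      ∫ z, Function.leftLim π r i * M.upd i r (rate r) (Function.leftLim π r) z
        ∂(M.ηP r j (rate r)) = ∫ r in t0..t, filterQuad (M.kill r (rate r)) (π r) i := by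
    refine intervalIntegral.integral_congr_ae ?_
    -- Left limits differ from values at most at jump times, which form a null set, so `π` may
    -- replace its left limit in the compensator.
    have hcount : ∀ᵐ r ∂(volume : Measure ℝ), r ∉ range fun n => (τ n).toReal :=
      (countable_range _).ae_notMem _
    filter_upwards [hcount] with r hrn hrt
    rw [uIoc_of_le ht.1] at hrt
    have hr2 : r ∈ Ioc t0 M.T := ⟨hrt.1, hrt.2.trans ht.2⟩
    rw [sum_integral_mul_upd hM ⟨h0.trans hr2.1.le, hr2.2⟩ (hr r hr2) (hlmem r hr2) i]
    obtain ⟨k, hk, hk1, hk2, hk3⟩ := hτ.exists_seg_left h0 hr2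
    have hne : r ≠ M.segEnd τ k ∨ τ (k + 1) = ⊤ := by
      by_cases hk' : τ (k + 1) = ⊤
      · exact Or.inr hk'
      · left
        rw [segEnd_eq hτ hk']
        exact fun hcon => hrn ⟨k + 1, hcon.symm⟩
    have hlt : ENNReal.ofReal r < τ (k + 1) := by
      rcases hne with hne | hne
      · exact lt_succ_of_lt_segEnd (h0.trans hr2.1.le) (lt_of_le_of_ne hk1.2 hne)
      · rw [hne]; exact ENNReal.ofReal_lt_top
    have : Function.leftLim π r = π r := by
      rw [h.leftLim_eq hτ hk hk1, h.eq k hk r ⟨hk1.1.le, hr2.2⟩ hlt]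
    rw [this]
    rfl
  have hjump : ∑' n : ℕ, M.jumpTerm τ ζ rate (Function.leftLim π) t i n
      = ∑ n ∈ Finset.range m, J n := by
    -- Exactly the jumps `1, …, m` have occurred by time `t`, because `τ m ≤ t < τ (m + 1)`; the
    -- other terms vanish.
    rw [tsum_eq_sum (s := Finset.range m)]
    · refine Finset.sum_congr rfl fun n hn => if_pos ?_
      exact (hτ.monotone (Finset.mem_range.1 hn)).trans h2
    · intro n hn
      rw [Finset.mem_range, not_lt] at hn
      exact if_neg (not_le.2 (h3.trans_le (hτ.monotone (Nat.succ_le_succ hn))))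
  rw [hcomp]
  refine Eq.trans ?_ (congrArg (fun S => π0 i + (∫ r in t0..t, ∑ j, M.q j i * π r j) + S
      - ∫ r in t0..t, filterQuad (M.kill r (rate r)) (π r) i) hjump.symm)
  rw [h.eq m hm t ⟨h1.1, ht.2⟩ h3, hs2 t h1, hFsplit]
  ring

end IsPieced

end Model
end
end Liquidation

/-! ### Explicit solutions along return paths and their adaptedness. -/

namespace Liquidation

noncomputable section

variable {K : ℕ}

/-! ### The segment containing a given time -/

/-- The number of jumps up to time `t`. -/
def segIdx (τ : ℕ → ℝ≥0∞) (t : ℝ) : ℕ := sInf {m | ENNReal.ofReal t < τ (m + 1)}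

theorem segIdx_eq {τ : ℕ → ℝ≥0∞} (hτ : Monotone τ) {t : ℝ} {m : ℕ} (h1 : τ m ≤ ENNReal.ofReal t)
    (h2 : ENNReal.ofReal t < τ (m + 1)) : segIdx τ t = m := by
  refine le_antisymm (Nat.sInf_le h2) (le_csInf ⟨m, h2⟩ fun k hk => ?_)
  by_contra! hlt
  exact absurd ((mem_ofPred_eq.mp hk).trans_le (hτ hlt)) (not_lt.2 h1)

theorem measurable_segIdx {Ω : Type*} [MeasurableSpace Ω] {τ : ℕ → Ω → ℝ≥0∞}
    (hm : ∀ n, Measurable (τ n)) (t : ℝ) : Measurable fun ω => segIdx (fun n => τ n ω) t := by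
  classical
  have hlt : ∀ n, MeasurableSet {ω | ENNReal.ofReal t < τ (n + 1) ω} := fun n =>
    measurableSet_lt measurable_const (hm (n + 1))
  -- The infimum of the empty set is `0` by default. Adding the second alternative makes a least
  -- index always exist, and it equals `0` in precisely that degenerate case.
  have hfin : ∀ ω, ∃ n, ENNReal.ofReal t < τ (n + 1) ω ∨ ∀ k, τ (k + 1) ω ≤ ENNReal.ofReal t := by
    intro ω
    by_contra! hcon
    obtain ⟨k, hk⟩ := (hcon 0).2
    exact absurd hk (not_lt.2 (hcon k).1)
  have hall : MeasurableSet {ω | ∀ k, τ (k + 1) ω ≤ ENNReal.ofReal t} := by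
    have : {ω | ∀ k, τ (k + 1) ω ≤ ENNReal.ofReal t}
        = ⋂ k, {ω | ENNReal.ofReal t < τ (k + 1) ω}ᶜ := by ext; simp
    rw [this]
    exact MeasurableSet.iInter fun k => (hlt k).compl
  have h := measurable_find hfin fun n => (hlt n).union hall
  refine (congrArg Measurable (funext fun ω => ?_)).mpr h
  by_cases hne : {m | ENNReal.ofReal t < τ (m + 1) ω}.Nonempty
  · refine le_antisymm (Nat.sInf_le ?_) (Nat.find_min' _ (Or.inl (Nat.sInf_mem hne)))
    obtain ⟨k, hk⟩ := hne
    exact (Nat.find_spec (hfin ω)).resolve_right fun hcon => absurd hk (not_lt.2 (hcon k))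
  · have he := not_nonempty_iff_eq_empty.1 hne
    rw [segIdx, he, Nat.sInf_empty]
    refine ((Nat.find_eq_zero (hfin ω)).2 (Or.inr fun k => not_lt.1 fun hk => hne ⟨k, hk⟩)).symm

theorem measurable_comp_nat {Ω E : Type*} [MeasurableSpace Ω] [MeasurableSpace E] {f : ℕ → Ω → E}
    (hf : ∀ n, Measurable (f n)) {N : Ω → ℕ} (hN : Measurable N) :
    Measurable fun ω => f (N ω) ω :=
  (measurable_from_prod_countable_right (f := fun p : ℕ × Ω => f p.1 p.2) hf).comp
    (hN.prodMk measurable_id)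

/-! ### Truncated return paths -/

open Classical in
/-- The jump times up to time `t`. -/
def truncTime (τ : ℕ → ℝ≥0∞) (t : ℝ) (n : ℕ) : ℝ≥0∞ :=
  if τ n ≤ ENNReal.ofReal t then τ n else ⊤

open Classical in
/-- The jump sizes up to time `t`. -/
def truncSize (τ : ℕ → ℝ≥0∞) (ζ : ℕ → ℝ) (t : ℝ) (n : ℕ) : ℝ :=
  if τ n ≤ ENNReal.ofReal t then ζ n else 0

theorem truncTime_eq {τ : ℕ → ℝ≥0∞} {t : ℝ} {n : ℕ} (h : τ n ≤ ENNReal.ofReal t) :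
    truncTime τ t n = τ n := if_pos h

theorem truncSize_eq {τ : ℕ → ℝ≥0∞} {ζ : ℕ → ℝ} {t : ℝ} {n : ℕ} (h : τ n ≤ ENNReal.ofReal t) :
    truncSize τ ζ t n = ζ n := if_pos h

theorem truncTime_top {τ : ℕ → ℝ≥0∞} {t : ℝ} {n : ℕ} (h : ENNReal.ofReal t < τ n) :
    truncTime τ t n = ⊤ := if_neg (not_le.2 h)

theorem truncTime_monotone {τ : ℕ → ℝ≥0∞} (hτ : Monotone τ) (t : ℝ) : Monotone (truncTime τ t) := by
  intro a b hab
  unfold truncTime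
  split_ifs with h1 h2 h2
  · exact hτ hab
  · exact le_top
  · exact absurd ((hτ hab).trans h2) h1
  · exact le_rfl

theorem measurable_truncTime_succ {Ω : Type*} (τ : ℕ → Ω → ℝ≥0∞) (ζ : ℕ → Ω → ℝ) (t : ℝ)
    (n : ℕ) :
    Measurable[Model.returnFiltration τ ζ t] fun ω => truncTime (fun n => τ n ω) t (n + 1) := by
  let _ : MeasurableSpace Ω := Model.returnFiltration τ ζ t
  refine measurable_of_Iic fun a => ?_
  by_cases ha : a = ⊤
  · simp [ha]
  -- For finite `a` the truncated time is at most `a` exactly when the jump occurs by `min a t`,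
  -- which is a generating event with `B = univ`.
  have hs : (fun ω => truncTime (fun n => τ n ω) t (n + 1)) ⁻¹' Iic a
      = {ω | τ (n + 1) ω ≤ ENNReal.ofReal (min a.toReal t) ∧ ζ (n + 1) ω ∈ (univ : Set ℝ)} := by
    ext ω
    have hmin : ENNReal.ofReal (min a.toReal t) = min a (ENNReal.ofReal t) := by
      rw [ENNReal.ofReal_min, ENNReal.ofReal_toReal ha]
    simp only [mem_preimage, mem_Iic, truncTime, hmin, mem_univ, and_true, mem_ofPred_eq,
        le_min_iff]
    split_ifs with h
    · exact ⟨fun h' => ⟨h', h⟩, fun h' => h'.1⟩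
    · exact ⟨fun h' => absurd (top_le_iff.1 h') ha, fun h' => absurd h'.2 h⟩
  rw [hs]
  exact MeasurableSpace.measurableSet_generateFrom
    ⟨n, min a.toReal t, min_le_right _ _, univ, MeasurableSet.univ, rfl⟩

theorem measurable_truncSize_succ {Ω : Type*} (τ : ℕ → Ω → ℝ≥0∞) (ζ : ℕ → Ω → ℝ) (t : ℝ)
    (n : ℕ) : Measurable[Model.returnFiltration τ ζ t]
      fun ω => truncSize (fun n => τ n ω) (fun n => ζ n ω) t (n + 1) := by
  let _ : MeasurableSpace Ω := Model.returnFiltration τ ζ t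
  intro B hB
  have hgen : ∀ B : Set ℝ, MeasurableSet B →
      MeasurableSet {ω | τ (n + 1) ω ≤ ENNReal.ofReal t ∧ ζ (n + 1) ω ∈ B} := fun B hB =>
    MeasurableSpace.measurableSet_generateFrom ⟨n, t, le_rfl, B, hB, rfl⟩
  -- The default size `0` marks jumps that have not happened yet. If `0 ∈ B` the preimage contains
  -- all these outcomes, and its complement is a generating event instead.
  by_cases h0 : (0 : ℝ) ∈ B
  · have hs : (fun ω => truncSize (fun n => τ n ω) (fun n => ζ n ω) t (n + 1)) ⁻¹' B
        = {ω | τ (n + 1) ω ≤ ENNReal.ofReal t ∧ ζ (n + 1) ω ∈ Bᶜ}ᶜ := by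
      ext ω
      simp only [mem_preimage, truncSize, mem_compl_iff, mem_ofPred_eq]
      split_ifs with h <;> simp [h, h0]
    rw [hs]
    exact (hgen _ hB.compl).compl
  · have hs : (fun ω => truncSize (fun n => τ n ω) (fun n => ζ n ω) t (n + 1)) ⁻¹' B
        = {ω | τ (n + 1) ω ≤ ENNReal.ofReal t ∧ ζ (n + 1) ω ∈ B} := by
      ext ω
      simp only [mem_preimage, truncSize, mem_ofPred_eq]
      split_ifs with h <;> simp [h, h0]
    rw [hs]
    exact hgen _ hB

namespace Model

variable {M : Model K}

theorem IsReturnPath.segIdx_spec {t0 : ℝ} {τ : ℕ → ℝ≥0∞} {ζ : ℕ → ℝ} (hτ : M.IsReturnPath t0 τ ζ)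
    (h0 : 0 ≤ t0) {t : ℝ} (ht : t ∈ Icc t0 M.T) :
    τ (segIdx τ t) ≤ ENNReal.ofReal t ∧ ENNReal.ofReal t < τ (segIdx τ t + 1) := by
  obtain ⟨m, -, -, h1, h2⟩ := hτ.exists_seg h0 ht
  rw [segIdx_eq hτ.monotone h1 h2]
  exact ⟨h1, h2⟩

theorem IsReturnPath.segIdx_truncTime {t0 : ℝ} {τ : ℕ → ℝ≥0∞} {ζ : ℕ → ℝ}
    (hτ : M.IsReturnPath t0 τ ζ) (h0 : 0 ≤ t0) {t : ℝ} (ht : t ∈ Icc t0 M.T) :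
    segIdx (truncTime τ t) t = segIdx τ t := by
  obtain ⟨h1, h2⟩ := hτ.segIdx_spec h0 ht
  refine segIdx_eq (truncTime_monotone hτ.monotone t) ?_ ?_
  · rwa [truncTime_eq h1]
  · rw [truncTime_top h2]
    exact ENNReal.ofReal_lt_top

theorem IsReturnPath.measurable_truncTime {Ω : Type*} {t0 : ℝ} {τ : ℕ → Ω → ℝ≥0∞}
    {ζ : ℕ → Ω → ℝ} (hτ : ∀ ω, M.IsReturnPath t0 (fun n => τ n ω) (fun n => ζ n ω)) (t : ℝ)
    (n : ℕ) :
    Measurable[Model.returnFiltration τ ζ t] fun ω => truncTime (fun n => τ n ω) t n := by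
  let _ : MeasurableSpace Ω := Model.returnFiltration τ ζ t
  cases n with
  | zero =>
    -- The filtration is generated by the actual jumps, of index at least one. The time of index `0`
    -- is measurable because it is the constant `t0`.
    have : (fun ω => truncTime (fun n => τ n ω) t 0)
        = fun _ => truncTime (fun _ => ENNReal.ofReal t0) t 0 := by
      ext ω
      simp only [truncTime, (hτ ω).initial]
    rw [this]
    exact measurable_const
  | succ n => exact measurable_truncTime_succ τ ζ t n

theorem IsReturnPath.measurable_segIdx {Ω : Type*} {t0 : ℝ} {τ : ℕ → Ω → ℝ≥0∞}
    {ζ : ℕ → Ω → ℝ} (hτ : ∀ ω, M.IsReturnPath t0 (fun n => τ n ω) (fun n => ζ n ω)) (t : ℝ) :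
    Measurable[Model.returnFiltration τ ζ t]
      fun ω => segIdx (truncTime (fun n => τ n ω) t) t := by
  let _ : MeasurableSpace Ω := Model.returnFiltration τ ζ t
  exact Liquidation.measurable_segIdx (τ := fun n ω => truncTime (fun n => τ n ω) t n)
    (IsReturnPath.measurable_truncTime hτ t) t

/-! ### The solution for a given selling rate -/

/-- A translation of time from `[0, e - s]` to `[s, e]`. The coefficients need to match only on `(s,
e]`, because the left endpoint is negligible for the integrals. -/
theorem filterSol_shift (hM : M.RegularJumps) {a : ℝ → Fin K → ℝ} (ha : Measurable a)
    (haC : ∀ r k, a r k ∈ Icc 0 M.killBound) {ρ : Fin K → ℝ} (hρ : ρ ∈ stdSimplex ℝ (Fin K))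
    {s e : ℝ} (hse : s ≤ e) {rate : ℝ → ℝ}
    (har : ∀ r ∈ Ioc s e, a (r - s) = M.kill r (rate r)) :
    (∀ t ∈ Icc s e, filterSol M.q M.killBound a ρ (t - s) ∈ stdSimplex ℝ (Fin K)) ∧
    (∀ i, IntervalIntegrable (fun r => filterField M.q (M.kill r (rate r))
      (filterSol M.q M.killBound a ρ (r - s)) i) volume s e) ∧
    ∀ t ∈ Icc s e, ∀ i, filterSol M.q M.killBound a ρ (t - s) i = ρ i + ∫ r in s..t,
      filterField M.q (M.kill r (rate r)) (filterSol M.q M.killBound a ρ (r - s)) i := by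
  have hC := killBound_nonneg hM
  have hspec := fun t ht => filterSol_spec (t := t) M.isGenerator ha haC hC hρ ht
  have hmeas : Measurable fun r => filterSol M.q M.killBound a ρ r :=
    (measurable_filterSol (Θ := Unit) M.q M.killBound (a := fun _ => a) (π0 := fun _ => ρ)
      (ha.comp measurable_snd) measurable_const).comp (measurable_const.prodMk measurable_id)
      (g := fun p : Unit × ℝ => filterSol M.q M.killBound a ρ p.2) (f := fun r => ((), r))
  refine ⟨fun t ht => (hspec _ (sub_nonneg.2 ht.1)).1, fun i => ?_, fun t ht i => ?_⟩
  · rw [intervalIntegrable_iff_integrableOn_Ioc_of_le hse]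
    have : IntegrableOn (fun r => filterField M.q (a (r - s))
        (filterSol M.q M.killBound a ρ (r - s)) i) (Ioc s e) := by
      refine Measure.integrableOn_of_bounded (M := genNorm M.q + M.killBound) (by simp)
        (measurable_filterField (ha.comp (measurable_id.sub_const s))
          (hmeas.comp (measurable_id.sub_const s)) i).aestronglyMeasurable ?_
      filter_upwards [ae_restrict_mem measurableSet_Ioc] with r hr
      exact abs_filterField_le (hspec _ (sub_nonneg.2 hr.1.le)).1 (haC _) i
    exact this.congr_fun (fun r hr => by simp only [har r hr]) measurableSet_Ioc
  · rw [(hspec _ (sub_nonneg.2 ht.1)).2 i]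
    congr 1
    have := intervalIntegral.integral_comp_sub_right (a := s) (b := t) (fun r =>
      filterField M.q (a r) (filterSol M.q M.killBound a ρ r) i) s
    rw [sub_self] at this
    rw [← this, intervalIntegral.integral_of_le ht.1, intervalIntegral.integral_of_le ht.1]
    exact setIntegral_congr_fun measurableSet_Ioc fun r hr => by
      simp only [har r ⟨hr.1, hr.2.trans ht.2⟩]

/-- The curve of the filter after a jump at time `s` to the state `ρ`. -/
def ksCurve (M : Model K) (rate : ℝ → ℝ) (s : ℝ) (ρ : Fin K → ℝ) (t : ℝ) : Fin K → ℝ :=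
  filterSol M.q M.killBound (fun u => M.kill (s + u) (rate (s + u))) ρ (t - s)

/-- The state of the filter after the `m`-th jump. -/
def ksState (M : Model K) (π0 : Fin K → ℝ) (τ : ℕ → ℝ≥0∞) (ζ : ℕ → ℝ) (rate : ℝ → ℝ) :
    ℕ → Fin K → ℝ
  | 0 => π0
  | m + 1 => fun i =>
      M.ksCurve rate (τ m).toReal (M.ksState π0 τ ζ rate m) (τ (m + 1)).toReal i *
        (1 + M.upd i (τ (m + 1)).toReal (rate (τ (m + 1)).toReal)
          (M.ksCurve rate (τ m).toReal (M.ksState π0 τ ζ rate m) (τ (m + 1)).toReal) (ζ (m + 1)))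

/-- The filter for a given selling rate. -/
def ksSol (M : Model K) (π0 : Fin K → ℝ) (τ : ℕ → ℝ≥0∞) (ζ : ℕ → ℝ) (rate : ℝ → ℝ) (t : ℝ) :
    Fin K → ℝ :=
  M.ksCurve rate (τ (segIdx τ t)).toReal (M.ksState π0 τ ζ rate (segIdx τ t)) t

theorem ksCurve_self (hM : M.RegularJumps) {rate : ℝ → ℝ} (hr : Measurable rate) (s : ℝ)
    {ρ : Fin K → ℝ} (hρ : ρ ∈ stdSimplex ℝ (Fin K)) : M.ksCurve rate s ρ s = ρ := by
  have ha : Measurable fun u => M.kill (s + u) (rate (s + u)) :=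
    M.measurable_kill.comp ((measurable_id.const_add s).prodMk
      (hr.comp (measurable_id.const_add s)))
  rw [ksCurve, sub_self]
  exact filterSol_zero M.isGenerator ha (fun r k => kill_mem hM _ _ k) (killBound_nonneg hM) hρ

theorem isPieced_ksSol (hM : M.RegularJumps) {t0 : ℝ} (h0 : 0 ≤ t0) {π0 : Fin K → ℝ}
    (hπ : π0 ∈ stdSimplex ℝ (Fin K)) {τ : ℕ → ℝ≥0∞} {ζ : ℕ → ℝ} (hτ : M.IsReturnPath t0 τ ζ)
    {rate : ℝ → ℝ} (hr : Measurable rate) (hrm : ∀ r ∈ Icc t0 M.T, rate r ∈ Icc 0 M.νmax) :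
    M.IsPieced π0 τ ζ rate (fun m => M.ksCurve rate (τ m).toReal (M.ksState π0 τ ζ rate m))
      (M.ksSol π0 τ ζ rate) := by
  have hcurve := fun (m : ℕ) (hm : τ m ≠ ⊤) (ρ : Fin K → ℝ) (hρ : ρ ∈ stdSimplex ℝ (Fin K)) =>
    filterSol_shift hM (a := fun u => M.kill ((τ m).toReal + u) (rate ((τ m).toReal + u)))
      (M.measurable_kill.comp ((measurable_id.const_add _).prodMk
        (hr.comp (measurable_id.const_add _)))) (fun r k => kill_mem hM _ _ k) hρ
      (le_segEnd hτ hm) (rate := rate) (fun r _ => by simp only [add_sub_cancel])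
  have hstate : ∀ m, τ m ≠ ⊤ → M.ksState π0 τ ζ rate m ∈ stdSimplex ℝ (Fin K) := by
    intro m
    induction m with
    | zero => exact fun _ => hπ
    | succ m ih =>
      intro hm
      have hm' := hτ.ne_top_of_succ hm
      have hc := (hcurve m hm' _ (ih hm')).1 (τ (m + 1)).toReal
        ⟨(hτ.toReal_lt_succ hm).le, (segEnd_eq hτ hm).ge⟩
      have ht := hτ.toReal_mem hm
      -- Inventory `0` and price `1` are dummies that complete the filter to a point of the state
      -- space, so that `jumpTo_mem` yields the simplex property after the update.
      have hx : (((τ (m + 1)).toReal, 0, 1, M.ksCurve rate (τ m).toReal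
          (M.ksState π0 τ ζ rate m) (τ (m + 1)).toReal) : State K) ∈ M.stateSpace :=
        ⟨⟨h0.trans ht.1, ht.2⟩, ⟨le_rfl, M.w0_pos.le⟩, mem_Ioi.2 one_pos, hc⟩
      exact (jumpTo_mem hM hx (hrm _ ht) (hτ.size m (lt_top_iff_ne_top.2 hm)).1).2.2.2
  refine ⟨fun m hm => (hcurve m hm _ (hstate m hm)).1, fun m hm =>
      (hcurve m hm _ (hstate m hm)).2.1,
    fun m hm t ht i => ?_, fun m hm t ht hlt => ?_, ?_, fun m hm i => ?_⟩
  · rw [ksCurve_self hM hr _ (hstate m hm)]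
    exact (hcurve m hm _ (hstate m hm)).2.2 t ht i
  · rw [ksSol, segIdx_eq hτ.monotone ((ENNReal.le_ofReal_iff_toReal_le hm
      (ENNReal.toReal_nonneg.trans ht.1)).2 ht.1) hlt]
  · exact ksCurve_self hM hr _ hπ
  · simp only [ksCurve_self hM hr _ (hstate (m + 1) hm)]
    rfl

theorem SolvesKS.congr_rate {t0 : ℝ} {π0 : Fin K → ℝ} {τ : ℕ → ℝ≥0∞} {ζ : ℕ → ℝ}
    (hτ : M.IsReturnPath t0 τ ζ) {rate rate' : ℝ → ℝ} {π : ℝ → Fin K → ℝ}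
    (h : M.SolvesKS t0 π0 τ ζ rate π) (hr : ∀ r ∈ Icc t0 M.T, rate r = rate' r) :
    M.SolvesKS t0 π0 τ ζ rate' π := by
  refine ⟨h.mem, h.right_cont, h.left_lim, fun t ht i => (h.eq t ht i).trans ?_⟩
  refine congrArg₂ (· - ·) (congrArg₂ (· + ·) rfl (tsum_congr fun n => ?_))
    (intervalIntegral.integral_congr fun r hr' => ?_)
  · by_cases hn : τ (n + 1) ≤ ENNReal.ofReal t
    · have hn' : τ (n + 1) ≠ ⊤ := (hn.trans_lt ENNReal.ofReal_lt_top).ne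
      rw [if_pos hn, if_pos hn, hr _ (hτ.toReal_mem hn')]
    · rw [if_neg hn, if_neg hn]
  · rw [uIcc_of_le ht.1] at hr'
    simp only [hr r ⟨hr'.1, hr'.2.trans ht.2⟩]

theorem ksState_congr {π0 : Fin K → ℝ} {τ τ' : ℕ → ℝ≥0∞} (hτ : Monotone τ) {ζ ζ' : ℕ → ℝ}
    {rate rate' : ℝ → ℝ} {m : ℕ} (hm : τ m ≠ ⊤)
    (h : ∀ n ≤ m, τ n = τ' n) (h' : ∀ n ≤ m, ζ n = ζ' n)
    (hr : ∀ r ∈ Icc (τ 0).toReal (τ m).toReal, rate r = rate' r) :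
    ∀ k ≤ m, M.ksState π0 τ ζ rate k = M.ksState π0 τ' ζ' rate' k := by
  intro k
  induction k with
  | zero => exact fun _ => rfl
  | succ k ih =>
    intro hk
    have hk' : k ≤ m := (Nat.le_succ k).trans hk
    have hle : (τ (k + 1)).toReal ≤ (τ m).toReal := ENNReal.toReal_mono hm (hτ hk)
    have hmono : ∀ j ≤ m, (τ 0).toReal ≤ (τ j).toReal := fun j hj =>
      ENNReal.toReal_mono (ne_top_of_le_ne_top hm (hτ hj)) (hτ (Nat.zero_le j))
    have hc : M.ksCurve rate (τ k).toReal (M.ksState π0 τ ζ rate k) (τ (k + 1)).toReal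
        = M.ksCurve rate' (τ' k).toReal (M.ksState π0 τ' ζ' rate' k) (τ' (k + 1)).toReal := by
      rw [← h k hk', ← h (k + 1) hk, ← ih hk']
      exact filterSol_congr fun r hr' => by
        rw [hr _ ⟨by linarith [hr'.1, hmono k hk'], by linarith [hr'.2]⟩]
    simp only [ksState, hc]
    rw [← h (k + 1) hk, ← h' (k + 1) hk, hr _ ⟨hmono _ hk, hle⟩]

/-- The filter at time `t` depends only on the information up to time `t`. -/
theorem ksSol_congr {t0 : ℝ} (h0 : 0 ≤ t0) {π0 : Fin K → ℝ} {τ : ℕ → ℝ≥0∞} {ζ : ℕ → ℝ}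
    (hτ : M.IsReturnPath t0 τ ζ) {rate rate' : ℝ → ℝ} {t : ℝ} (ht : t ∈ Icc t0 M.T)
    (hr : ∀ r ∈ Icc t0 t, rate r = rate' r) :
    M.ksSol π0 τ ζ rate t = M.ksSol π0 (truncTime τ t) (truncSize τ ζ t) rate' t := by
  obtain ⟨h1, h2⟩ := hτ.segIdx_spec h0 ht
  have hm : τ (segIdx τ t) ≠ ⊤ := (h1.trans_lt ENNReal.ofReal_lt_top).ne
  have hn : ∀ n ≤ segIdx τ t, τ n ≤ ENNReal.ofReal t := fun n hn => (hτ.monotone hn).trans h1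
  have ht' : (τ (segIdx τ t)).toReal ≤ t := ENNReal.toReal_le_of_le_ofReal (h0.trans ht.1) h1
  rw [ksSol, ksSol, hτ.segIdx_truncTime h0 ht, truncTime_eq h1,
    ksState_congr hτ.monotone hm (fun n hn' => (truncTime_eq (hn n hn')).symm)
      (fun n hn' => (truncSize_eq (hn n hn')).symm)
      (fun r hr' => hr r ⟨(hτ.toReal_zero h0).symm.le.trans hr'.1, hr'.2.trans ht'⟩) _ le_rfl]
  exact filterSol_congr fun r hr' => by
    rw [hr _ ⟨by linarith [hr'.1, (hτ.toReal_mem hm).1], by linarith [hr'.2]⟩]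

section Measurability

variable {Ω : Type*} [MeasurableSpace Ω]

theorem measurable_ksCurve {rate : Ω → ℝ → ℝ} (hr : Measurable fun p : Ω × ℝ => rate p.1 p.2)
    {s t : Ω → ℝ} {ρ : Ω → Fin K → ℝ} (hs : Measurable s) (hρ : Measurable ρ) (ht : Measurable t) :
    Measurable fun ω => M.ksCurve (rate ω) (s ω) (ρ ω) (t ω) := by
  have hadd : Measurable fun p : Ω × ℝ => s p.1 + p.2 := (hs.comp measurable_fst).add measurable_snd
  have ha : Measurable fun p : Ω × ℝ => M.kill (s p.1 + p.2) (rate p.1 (s p.1 + p.2)) := by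
    have h2 : Measurable fun p : Ω × ℝ => rate p.1 (s p.1 + p.2) :=
      Measurable.comp (g := fun p : Ω × ℝ => rate p.1 p.2)
        (f := fun p : Ω × ℝ => (p.1, s p.1 + p.2)) hr (measurable_fst.prodMk hadd)
    exact Measurable.comp (g := fun p : ℝ × ℝ => M.kill p.1 p.2) M.measurable_kill (hadd.prodMk h2)
  have h := measurable_filterSol M.q M.killBound
    (a := fun ω u => M.kill (s ω + u) (rate ω (s ω + u))) ha hρ
  have hp : Measurable fun ω => (ω, t ω - s ω) := measurable_id.prodMk (ht.sub hs)
  exact (h.comp hp :)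

theorem measurable_ksState {π0 : Fin K → ℝ} {τ : ℕ → Ω → ℝ≥0∞} {ζ : ℕ → Ω → ℝ}
    {rate : Ω → ℝ → ℝ} (hτ : ∀ n, Measurable (τ n)) (hζ : ∀ n, Measurable (ζ (n + 1)))
    (hr : Measurable fun p : Ω × ℝ => rate p.1 p.2) (m : ℕ) :
    Measurable fun ω => M.ksState π0 (fun n => τ n ω) (fun n => ζ n ω) (rate ω) m := by
  induction m with
  | zero => exact measurable_const
  | succ m ih =>
    have ht := (hτ (m + 1)).ennreal_toReal
    have hc := measurable_ksCurve (M := M) hr (hτ m).ennreal_toReal ih ht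
    have hj := M.measurable_jumpTo.comp (((ht.prodMk (measurable_const (a := (0 : ℝ)) |>.prodMk
      ((measurable_const (a := (1 : ℝ))).prodMk hc))).prodMk
      (hr.comp (measurable_id.prodMk ht))).prodMk (hζ m))
    exact measurable_snd.comp (measurable_snd.comp (measurable_snd.comp hj))

end Measurability

/-- The Kushner-Stratonovich equation for a given selling rate. -/
theorem exists_solvesKS (hM : M.RegularJumps) {t0 : ℝ} (h0 : t0 ∈ Icc 0 M.T) {π0 : Fin K → ℝ}
    (hπ : π0 ∈ stdSimplex ℝ (Fin K)) {Ω : Type*} (τ : ℕ → Ω → ℝ≥0∞) (ζ : ℕ → Ω → ℝ)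
    (rate : ℝ → Ω → ℝ) (hτ : ∀ ω, M.IsReturnPath t0 (fun n => τ n ω) (fun n => ζ n ω))
    (hr : ∀ t ∈ Icc t0 M.T, ∀ ω, rate t ω ∈ Icc 0 M.νmax)
    (hrm : ∀ t ∈ Icc t0 M.T, Measurable[(returnFiltration τ ζ t).prod inferInstance]
      fun p : Ω × Icc t0 t => rate p.2 p.1) :
    ∃ π : ℝ → Ω → Fin K → ℝ,
      (∀ t ∈ Icc t0 M.T, Measurable[returnFiltration τ ζ t] (π t)) ∧
      ∀ ω, M.SolvesKS t0 π0 (fun n => τ n ω) (fun n => ζ n ω)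
          (fun t => rate t ω) (fun t => π t ω) ∧
        ∀ π' : ℝ → Fin K → ℝ,
          M.SolvesKS t0 π0 (fun n => τ n ω) (fun n => ζ n ω) (fun t => rate t ω) π' →
            EqOn π' (fun t => π t ω) (Icc t0 M.T) := by
  -- The rate is frozen outside `[t0, t]`. Progressive measurability then gives joint measurability
  -- on `Ω × ℝ` with respect to the information at time `t`.
  let rb : ℝ → Ω → ℝ → ℝ := fun t ω r => rate (max t0 (min r t)) ω
  have hrb : ∀ t ω, ∀ r ∈ Icc t0 t, rate r ω = rb t ω r := fun t ω r hr' => by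
    simp only [rb, min_eq_left hr'.2, max_eq_right hr'.1]
  have hrbm : ∀ t ∈ Icc t0 M.T, Measurable[(returnFiltration τ ζ t).prod inferInstance]
      fun p : Ω × ℝ => rb t p.1 p.2 := by
    intro t ht
    let _ : MeasurableSpace Ω := returnFiltration τ ζ t
    have hproj : Measurable fun p : Ω × ℝ => (p.1,
        (⟨max t0 (min p.2 t), le_max_left _ _, max_le ht.1 (min_le_right _ _)⟩ : Icc t0 t)) := by
      refine measurable_fst.prodMk (Measurable.subtype_mk ?_)
      fun_prop
    exact (hrm t ht).comp hproj
  have hT : M.T ∈ Icc t0 M.T := ⟨h0.2, le_rfl⟩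
  have hrω : ∀ ω, Measurable (rb M.T ω) := by
    intro ω
    let _ : MeasurableSpace Ω := returnFiltration τ ζ M.T
    exact (hrbm M.T hT).comp (measurable_const.prodMk measurable_id)
  refine ⟨fun t ω => M.ksSol π0 (fun n => τ n ω) (fun n => ζ n ω) (rb M.T ω) t,
    fun t ht => ?_, fun ω => ?_⟩
  · let _ : MeasurableSpace Ω := returnFiltration τ ζ t
    -- The value at time `t` is unchanged if jump times, jump sizes and rate are cut off at `t`, and
    -- the cut-off data are measurable at time `t`.
    have he : (fun ω => M.ksSol π0 (fun n => τ n ω) (fun n => ζ n ω) (rb M.T ω) t)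
        = fun ω => M.ksSol π0 (truncTime (fun n => τ n ω) t)
          (truncSize (fun n => τ n ω) (fun n => ζ n ω) t) (rb t ω) t := by
      funext ω
      exact ksSol_congr h0.1 (hτ ω) ht fun r hr' => by
        rw [← hrb M.T ω r ⟨hr'.1, hr'.2.trans ht.2⟩, hrb t ω r hr']
    refine (congrArg Measurable he).mpr ?_
    have hτm := IsReturnPath.measurable_truncTime hτ t
    exact measurable_comp_nat (f := fun m ω => M.ksCurve (rb t ω)
        (truncTime (fun n => τ n ω) t m).toReal
        (M.ksState π0 (truncTime (fun n => τ n ω) t)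
          (truncSize (fun n => τ n ω) (fun n => ζ n ω) t) (rb t ω) m) t)
      (fun m => measurable_ksCurve (hrbm t ht) (hτm m).ennreal_toReal
        (measurable_ksState (τ := fun n ω => truncTime (fun n => τ n ω) t n)
          (ζ := fun n ω => truncSize (fun n => τ n ω) (fun n => ζ n ω) t n) hτm
          (measurable_truncSize_succ τ ζ t) (hrbm t ht) m) measurable_const)
      (IsReturnPath.measurable_segIdx hτ t)
  · have hs : M.SolvesKS t0 π0 (fun n => τ n ω) (fun n => ζ n ω) (fun t => rate t ω)
        (M.ksSol π0 (fun n => τ n ω) (fun n => ζ n ω) (rb M.T ω)) := by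
      have hmem : ∀ r ∈ Icc t0 M.T, rb M.T ω r ∈ Icc 0 M.νmax := fun r hr' => by
        rw [← hrb M.T ω r hr']
        exact hr r hr' ω
      exact ((isPieced_ksSol hM h0.1 hπ (hτ ω) (hrω ω) hmem).solvesKS hM (hτ ω) h0.1
        fun r hr' => hmem r ⟨hr'.1.le, hr'.2⟩).congr_rate (hτ ω) fun r hr' => (hrb M.T ω r hr').symm
    refine ⟨hs, fun π' h' => h'.unique hM h0.1 (hτ ω) hs le_rfl
      (fun r hr' => hr r ⟨hr'.1.le, hr'.2⟩ ω) (fun _ _ => rfl) ?_⟩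
    refine (hrω ω).aemeasurable.congr ?_
    filter_upwards [ae_restrict_mem measurableSet_Ioc] with r hr'
    exact (hrb M.T ω r ⟨hr'.1.le, hr'.2⟩).symm

end Model

namespace Model

variable {M : Model K} {ν : ℕ → State K → ℝ → ℝ}

/-! ### The state under an open-loop strategy -/

/-- The state after the `m`-th jump under an open-loop strategy. -/
def olState (M : Model K) (ν : ℕ → State K → ℝ → ℝ) (x : State K) (τ : ℕ → ℝ≥0∞) (ζ : ℕ → ℝ) :
    ℕ → State K
  | 0 => x
  | m + 1 => M.jumpTo
      (M.flowSol (ν m) (M.olState ν x τ ζ m) ((τ (m + 1)).toReal - (τ m).toReal))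
      (M.polRate (ν m) (M.olState ν x τ ζ m) ((τ (m + 1)).toReal - (τ m).toReal)) (ζ (m + 1))

/-- The state under an open-loop strategy. -/
def olSol (M : Model K) (ν : ℕ → State K → ℝ → ℝ) (x : State K) (τ : ℕ → ℝ≥0∞) (ζ : ℕ → ℝ)
    (t : ℝ) : State K :=
  M.flowSol (ν (segIdx τ t)) (M.olState ν x τ ζ (segIdx τ t)) (t - (τ (segIdx τ t)).toReal)

section Measurability

variable {Ω : Type*} [MeasurableSpace Ω]

theorem measurable_olState (hν : M.IsAdmissible ν) (x : State K) {τ : ℕ → Ω → ℝ≥0∞}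
    {ζ : ℕ → Ω → ℝ} (hτ : ∀ n, Measurable (τ n)) (hζ : ∀ n, Measurable (ζ (n + 1))) (m : ℕ) :
    Measurable fun ω => M.olState ν x (fun n => τ n ω) (fun n => ζ n ω) m := by
  induction m with
  | zero => exact measurable_const
  | succ m ih =>
    have hp := ih.prodMk ((hτ (m + 1)).ennreal_toReal.sub (hτ m).ennreal_toReal)
    have h1 := (measurable_flowSol (hν.isPolicy m)).comp hp
    have h2 := (measurable_polRate (hν.isPolicy m)).comp hp
    exact (M.measurable_jumpTo.comp ((h1.prodMk h2).prodMk (hζ m)) :)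

end Measurability

theorem olState_congr {x : State K} {τ τ' : ℕ → ℝ≥0∞} {ζ ζ' : ℕ → ℝ} {m : ℕ}
    (h : ∀ n ≤ m, τ n = τ' n) (h' : ∀ n ≤ m, ζ n = ζ' n) :
    ∀ k ≤ m, M.olState ν x τ ζ k = M.olState ν x τ' ζ' k := by
  intro k
  induction k with
  | zero => exact fun _ => rfl
  | succ k ih =>
    intro hk
    have hk' : k ≤ m := (Nat.le_succ k).trans hk
    simp only [olState, ih hk', h k hk', h (k + 1) hk, h' (k + 1) hk]

/-- The state at time `t` depends only on the information up to time `t`. -/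
theorem olSol_congr {x : State K} (h0 : 0 ≤ x.1) {τ : ℕ → ℝ≥0∞} {ζ : ℕ → ℝ}
    (hτ : M.IsReturnPath x.1 τ ζ) {t : ℝ} (ht : t ∈ Icc x.1 M.T) :
    M.olSol ν x τ ζ t = M.olSol ν x (truncTime τ t) (truncSize τ ζ t) t := by
  obtain ⟨h1, h2⟩ := hτ.segIdx_spec h0 ht
  have hn : ∀ n ≤ segIdx τ t, τ n ≤ ENNReal.ofReal t := fun n hn => (hτ.monotone hn).trans h1
  rw [olSol, olSol, hτ.segIdx_truncTime h0 ht, truncTime_eq h1,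
    olState_congr (fun n hn' => (truncTime_eq (hn n hn')).symm)
      (fun n hn' => (truncSize_eq (ζ := ζ) (hn n hn')).symm) _ le_rfl]

theorem measurable_olSol (hν : M.IsAdmissible ν) {x : State K} (h0 : 0 ≤ x.1) {Ω : Type*}
    {τ : ℕ → Ω → ℝ≥0∞} {ζ : ℕ → Ω → ℝ}
    (hτ : ∀ ω, M.IsReturnPath x.1 (fun n => τ n ω) (fun n => ζ n ω)) {t : ℝ}
    (ht : t ∈ Icc x.1 M.T) : Measurable[returnFiltration τ ζ t]
      fun ω => M.olSol ν x (fun n => τ n ω) (fun n => ζ n ω) t := by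
  let _ : MeasurableSpace Ω := returnFiltration τ ζ t
  refine (congrArg Measurable (funext fun ω => olSol_congr h0 (hτ ω) ht)).mpr ?_
  have hτm := IsReturnPath.measurable_truncTime hτ t
  refine measurable_comp_nat (f := fun m ω => M.flowSol (ν m)
    (M.olState ν x (truncTime (fun n => τ n ω) t)
      (truncSize (fun n => τ n ω) (fun n => ζ n ω) t) m)
    (t - (truncTime (fun n => τ n ω) t m).toReal)) (fun m => ?_)
    (IsReturnPath.measurable_segIdx hτ t)
  have hs := measurable_olState hν x (τ := fun n ω => truncTime (fun n => τ n ω) t n)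
    (ζ := fun n ω => truncSize (fun n => τ n ω) (fun n => ζ n ω) t n) hτm
    (measurable_truncSize_succ τ ζ t) m
  exact ((measurable_flowSol (hν.isPolicy m)).comp
    (hs.prodMk ((hτm m).ennreal_toReal.const_sub t)) :)

section OpenLoop

variable {x : State K} {τ : ℕ → ℝ≥0∞} {ζ : ℕ → ℝ}

theorem olState_mem (hM : M.RegularJumps) (hν : M.IsAdmissible ν) (hx : x ∈ M.stateSpace)
    (hτ : M.IsReturnPath x.1 τ ζ) (m : ℕ) (hm : τ m ≠ ⊤) :
    M.olState ν x τ ζ m ∈ M.stateSpace ∧ (M.olState ν x τ ζ m).1 = (τ m).toReal := by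
  induction m with
  | zero => exact ⟨hx, (hτ.toReal_zero hx.1.1).symm⟩
  | succ m ih =>
    obtain ⟨h1, h2⟩ := ih (hτ.ne_top_of_succ hm)
    have ht := hτ.toReal_mem hm
    have hu : (τ (m + 1)).toReal - (τ m).toReal ∈ Icc 0 (M.T - (M.olState ν x τ ζ m).1) := by
      rw [h2]
      exact ⟨sub_nonneg.2 (hτ.toReal_lt_succ hm).le, sub_le_sub_right ht.2 _⟩
    refine ⟨jumpTo_mem hM (flowSol_mem hM (hν.isPolicy m) h1 hu) (polRate_mem _ _)
      (hτ.size m (lt_top_iff_ne_top.2 hm)).1, ?_⟩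
    change (M.olState ν x τ ζ m).1 + ((τ (m + 1)).toReal - (τ m).toReal) = _
    rw [h2, add_sub_cancel]

theorem olSol_eq (hτ : M.IsReturnPath x.1 τ ζ) {m : ℕ} (hm : τ m ≠ ⊤) {t : ℝ}
    (ht : (τ m).toReal ≤ t) (hlt : ENNReal.ofReal t < τ (m + 1)) :
    M.olSol ν x τ ζ t = M.flowSol (ν m) (M.olState ν x τ ζ m) (t - (τ m).toReal) := by
  rw [olSol, segIdx_eq hτ.monotone ((ENNReal.le_ofReal_iff_toReal_le hm
      (ENNReal.toReal_nonneg.trans ht)).2 ht) hlt]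

theorem sub_mem_horizon (hM : M.RegularJumps) (hν : M.IsAdmissible ν) (hx : x ∈ M.stateSpace)
    (hτ : M.IsReturnPath x.1 τ ζ) {m : ℕ} (hm : τ m ≠ ⊤) {t : ℝ}
    (ht : t ∈ Icc (τ m).toReal (M.segEnd τ m)) :
    t - (τ m).toReal ∈ Icc 0 (M.T - (M.olState ν x τ ζ m).1) := by
  rw [(olState_mem hM hν hx hτ m hm).2]
  exact ⟨sub_nonneg.2 ht.1, sub_le_sub_right (ht.2.trans (segEnd_le τ m)) _⟩

theorem olSol_self (hM : M.RegularJumps) (hν : M.IsAdmissible ν) (hx : x ∈ M.stateSpace)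
    (hτ : M.IsReturnPath x.1 τ ζ) {m : ℕ} (hm : τ m ≠ ⊤) :
    M.olSol ν x τ ζ (τ m).toReal = M.olState ν x τ ζ m := by
  rw [olSol_eq hτ hm le_rfl (by
    rw [ENNReal.ofReal_toReal hm]; exact (hτ.increasing m).1 (lt_top_iff_ne_top.2 hm)), sub_self,
    flowSol_zero hM (hν.isPolicy m) (olState_mem hM hν hx hτ m hm).1]

theorem inventory_antitone {β : State K → ℝ → ℝ} (hβ : M.IsPolicy β) {y : State K}
    {a b : ℝ} (hab : a ≤ b) : (M.flowSol β y b).2.1 ≤ (M.flowSol β y a).2.1 := by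
  have := monotone_primitive_of_mem_Icc (measurable_polRate_right hβ y) (polRate_mem y) hab
  change y.2.1 - _ ≤ y.2.1 - _
  simp only at this
  linarith

theorem inventory_olState_antitone (hν : M.IsAdmissible ν) (hτ : M.IsReturnPath x.1 τ ζ) {k m : ℕ}
    (hkm : k ≤ m) (hm : τ m ≠ ⊤) :
    (M.olState ν x τ ζ m).2.1 ≤ (M.olState ν x τ ζ k).2.1 := by
  induction m, hkm using Nat.le_induction with
  | base => exact le_rfl
  | succ m hkm ih =>
    refine le_trans ?_ (ih (hτ.ne_top_of_succ hm))
    have := inventory_antitone (hν.isPolicy m) (y := M.olState ν x τ ζ m)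
      (sub_nonneg.2 (hτ.toReal_lt_succ hm).le)
    exact this.trans_eq (by simp [flowSol])

/-- The inventory is at least the inventory after a later jump. -/
theorem inventory_olSol_ge (hν : M.IsAdmissible ν) (hx : x ∈ M.stateSpace)
    (hτ : M.IsReturnPath x.1 τ ζ) {m : ℕ} (hm : τ m ≠ ⊤) {r : ℝ}
    (hr : r ∈ Ico x.1 (τ m).toReal) : (M.olState ν x τ ζ m).2.1 ≤ (M.olSol ν x τ ζ r).2.1 := by
  obtain ⟨k, hk, h1, h2, h3⟩ := hτ.exists_seg hx.1.1 ⟨hr.1, hr.2.le.trans (hτ.toReal_mem hm).2⟩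
  have hkm : k < m := by
    by_contra! hcon
    exact absurd (hr.2.trans_le ((ENNReal.toReal_mono hk (hτ.monotone hcon)).trans h1.1))
        (lt_irrefl _)
  have hk1 : τ (k + 1) ≠ ⊤ := ne_top_of_le_ne_top hm (hτ.monotone hkm)
  rw [olSol_eq hτ hk h1.1 h3]
  refine (inventory_olState_antitone hν hτ hkm hm).trans ?_
  have := h1.2
  rw [segEnd_eq hτ hk1] at this
  exact inventory_antitone (hν.isPolicy k) (sub_le_sub_right this _)

-- The intervals `(τ n, τ (n + 1)]` are disjoint, so a single term of the defining series can be
-- nonzero.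
open Classical in
theorem sellingRate_eq {t0 : ℝ} (hτ : Monotone τ) (X : ℝ → State K) {m : ℕ} {t : ℝ}
    (h1 : τ m < ENNReal.ofReal t) (h2 : ENNReal.ofReal t ≤ τ (m + 1)) :
    sellingRate ν t0 τ X t = if ∀ r ∈ Ico t0 t, 0 < (X r).2.1 then
      ν m (X (τ m).toReal) (t - (τ m).toReal) else 0 := by
  rw [sellingRate, tsum_eq_single m]
  · simp only [h1, h2, true_and]
  · intro n hn
    refine if_neg fun hcon => ?_
    rcases lt_or_gt_of_ne hn with h | h
    · exact absurd (h1.trans_le hcon.2.1) (not_lt.2 (hτ h))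
    · exact absurd (hcon.1.trans_le h2) (not_lt.2 (hτ h))

theorem pol_eq {β : State K → ℝ → ℝ} (hβ : M.IsPolicy β) {y : State K} (hy : y ∈ M.stateSpace)
    {u : ℝ} (hu : u ∈ Icc 0 M.T) : M.pol β y u = β y u := by
  rw [pol, M.clampT_eq hu, M.clampν_eq (hβ.mem_Icc y hy u hu)]

/-- Comparison of the selling rate with the effective rate of the current policy. -/
theorem sellingRate_eq_polRate (hν : M.IsAdmissible ν) {t0 : ℝ} (hτ : Monotone τ)
    {X : ℝ → State K} {m : ℕ} {t : ℝ} (h1 : τ m < ENNReal.ofReal t)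
    (h2 : ENNReal.ofReal t ≤ τ (m + 1)) (ht : t ∈ Icc 0 M.T) {y : State K} (hy : y ∈ M.stateSpace)
    (hXy : X (τ m).toReal = y) (hpast : ∀ r ∈ Ico t0 (τ m).toReal, y.2.1 ≤ (X r).2.1)
    (hD : (∀ r ∈ Ico t0 t, 0 < (X r).2.1) →
      ∀ v ∈ Ico 0 (t - (τ m).toReal), ∫ r in (0 : ℝ)..v, M.pol (ν m) y r < y.2.1)
    (hE : (∀ v ∈ Ico 0 (t - (τ m).toReal), ∫ r in (0 : ℝ)..v, M.pol (ν m) y r < y.2.1) →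
      ∀ r ∈ Ico (τ m).toReal t, 0 < (X r).2.1) :
    sellingRate ν t0 τ X t = M.polRate (ν m) y (t - (τ m).toReal) := by
  have hlt : (τ m).toReal < t := (ENNReal.lt_ofReal_iff_toReal_lt (h1.trans_le le_top).ne).1 h1
  rw [sellingRate_eq hτ X h1 h2, polRate, effRate, hXy, pol_eq (hν.isPolicy m) hy
    ⟨(sub_pos.2 hlt).le, (sub_le_self _ ENNReal.toReal_nonneg).trans ht.2⟩]
  classical
  -- The selling rate tests positivity of the inventory over the whole past, the effective rate only
  -- what was sold since the last jump. Before that jump the inventory was at least `y.2.1`, which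
  -- is positive by the test at `v = 0`.
  refine if_congr ⟨hD, fun hv r hr => ?_⟩ rfl rfl
  rcases lt_or_ge r (τ m).toReal with h | h
  · have := hv 0 ⟨le_rfl, sub_pos.2 hlt⟩
    rw [intervalIntegral.integral_same] at this
    exact this.trans_le (hpast r ⟨hr.1, h⟩)
  · exact hE hv r ⟨h, hr.2⟩

/-- Self-consistency of the construction: within a segment the inventory at `r` is positive exactly
when the amount the policy would have sold since the last jump is less than the inventory after that
jump. -/
theorem sellingRate_olSol (hM : M.RegularJumps) (hν : M.IsAdmissible ν) (hx : x ∈ M.stateSpace)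
    (hτ : M.IsReturnPath x.1 τ ζ) {m : ℕ} (hm : τ m ≠ ⊤) {t : ℝ}
    (ht : t ∈ Ioc (τ m).toReal (M.segEnd τ m)) :
    sellingRate ν x.1 τ (M.olSol ν x τ ζ) t
      = M.polRate (ν m) (M.olState ν x τ ζ m) (t - (τ m).toReal) := by
  have hy := (olState_mem hM hν hx hτ m hm).1
  have h0 : 0 ≤ t := ENNReal.toReal_nonneg.trans ht.1.le
  have h2 : ENNReal.ofReal t ≤ τ (m + 1) := by
    refine le_trans ?_ (min_le_left _ (ENNReal.ofReal M.T))
    exact ENNReal.ofReal_le_of_le_toReal ht.2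
  have hpos : ∀ r ∈ Ico (τ m).toReal t, 0 < (M.olSol ν x τ ζ r).2.1 ↔
      ∫ s in (0 : ℝ)..(r - (τ m).toReal), M.pol (ν m) (M.olState ν x τ ζ m) s
        < (M.olState ν x τ ζ m).2.1 := by
    intro r hr
    have hr0 : 0 ≤ r := ENNReal.toReal_nonneg.trans hr.1
    rw [olSol_eq hτ hm hr.1 (lt_succ_of_lt_segEnd hr0 (hr.2.trans_le ht.2)),
      inventory_flowSol (hν.isPolicy m) hy (sub_nonneg.2 hr.1), sub_pos, min_lt_iff]
    simp
  refine sellingRate_eq_polRate hν hτ.monotone ((ENNReal.lt_ofReal_iff_toReal_lt hm).2 ht.1) h2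
    ⟨h0, ht.2.trans (segEnd_le τ m)⟩ hy (olSol_self hM hν hx hτ hm)
    (fun r hr => inventory_olSol_ge hν hx hτ hm hr) (fun h v hv => ?_) (fun h r hr => ?_)
  · have hr : (τ m).toReal + v ∈ Ico (τ m).toReal t := ⟨by linarith [hv.1], by linarith [hv.2]⟩
    have := (hpos _ hr).1 (h _ ⟨(hτ.toReal_mem hm).1.trans hr.1, hr.2⟩)
    rwa [add_sub_cancel_left] at this
  · exact (hpos r hr).2 (h _ ⟨sub_nonneg.2 hr.1, sub_lt_sub_right hr.2 _⟩)

theorem sellingRate_olSol_mem (hM : M.RegularJumps) (hν : M.IsAdmissible ν) (hx : x ∈ M.stateSpace)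
    (hτ : M.IsReturnPath x.1 τ ζ) {t : ℝ} (ht : t ∈ Ioc x.1 M.T) :
    sellingRate ν x.1 τ (M.olSol ν x τ ζ) t ∈ Icc 0 M.νmax := by
  obtain ⟨m, hm, h1, -, -⟩ := hτ.exists_seg_left hx.1.1 ht
  rw [sellingRate_olSol hM hν hx hτ hm h1]
  exact polRate_mem _ _

/-- Segments are concatenated by induction; jumps leave the inventory unchanged. -/
theorem integral_sellingRate (hM : M.RegularJumps) (hν : M.IsAdmissible ν) (hx : x ∈ M.stateSpace)
    (hτ : M.IsReturnPath x.1 τ ζ) (m : ℕ) (hm : τ m ≠ ⊤) :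
    IntervalIntegrable (sellingRate ν x.1 τ (M.olSol ν x τ ζ)) volume x.1 (M.segEnd τ m) ∧
    ∀ t ∈ Icc (τ m).toReal (M.segEnd τ m),
      (M.flowSol (ν m) (M.olState ν x τ ζ m) (t - (τ m).toReal)).2.1
        = x.2.1 - ∫ r in x.1..t, sellingRate ν x.1 τ (M.olSol ν x τ ζ) r := by
  set F := sellingRate ν x.1 τ (M.olSol ν x τ ζ) with hF
  have hFi : ∀ m, τ m ≠ ⊤ → IntervalIntegrable F volume (τ m).toReal (M.segEnd τ m) := by
    intro m hm
    rw [intervalIntegrable_iff_integrableOn_Ioc_of_le (le_segEnd hτ hm)]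
    have := (intervalIntegrable_of_mem_Icc
      (measurable_polRate_right (hν.isPolicy m) (M.olState ν x τ ζ m)) (polRate_mem _) 0
      (M.segEnd τ m - (τ m).toReal)).comp_sub_right (τ m).toReal
    rw [zero_add, sub_add_cancel, intervalIntegrable_iff_integrableOn_Ioc_of_le
      (le_segEnd hτ hm)] at this
    exact this.congr_fun (fun r hr => (sellingRate_olSol hM hν hx hτ hm hr).symm) measurableSet_Ioc
  have hloc : ∀ m, τ m ≠ ⊤ → ∀ t ∈ Icc (τ m).toReal (M.segEnd τ m),
      (M.flowSol (ν m) (M.olState ν x τ ζ m) (t - (τ m).toReal)).2.1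
        = (M.olState ν x τ ζ m).2.1 - ∫ r in (τ m).toReal..t, F r := by
    intro m hm t ht
    change (M.olState ν x τ ζ m).2.1 - _ = _
    have := intervalIntegral.integral_comp_sub_right (a := (τ m).toReal) (b := t)
      (M.polRate (ν m) (M.olState ν x τ ζ m)) (τ m).toReal
    rw [sub_self] at this
    rw [← this, intervalIntegral.integral_of_le ht.1, intervalIntegral.integral_of_le ht.1]
    congr 1
    exact setIntegral_congr_fun measurableSet_Ioc fun r hr =>
      (sellingRate_olSol hM hν hx hτ hm ⟨hr.1, hr.2.trans ht.2⟩).symm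
  induction m with
  | zero =>
    have hz := hτ.toReal_zero hx.1.1
    refine ⟨hz ▸ hFi 0 hm, fun t ht => ?_⟩
    rw [hloc 0 hm t ht, hz]
    rfl
  | succ m ih =>
    have hm' := hτ.ne_top_of_succ hm
    obtain ⟨ih1, ih2⟩ := ih hm'
    rw [segEnd_eq hτ hm] at ih1 ih2
    refine ⟨ih1.trans (hFi _ hm), fun t ht => ?_⟩
    have hsub : IntervalIntegrable F volume (τ (m + 1)).toReal t := (hFi _ hm).mono_set (by
      rw [uIcc_of_le ht.1, uIcc_of_le (ht.1.trans ht.2)]; exact Icc_subset_Icc le_rfl ht.2)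
    have he : (M.olState ν x τ ζ (m + 1)).2.1 = (M.flowSol (ν m) (M.olState ν x τ ζ m)
      ((τ (m + 1)).toReal - (τ m).toReal)).2.1 := rfl
    rw [hloc _ hm t ht, he, ih2 _ ⟨(hτ.toReal_lt_succ hm).le, le_rfl⟩,
      ← intervalIntegral.integral_add_adjacent_intervals ih1 hsub]
    ring

theorem price_olState (m : ℕ) :
    (M.olState ν x τ ζ m).2.2.1 = x.2.2.1 * ∏ n ∈ Finset.range m, (1 + ζ (n + 1)) := by
  induction m with
  | zero => simp [olState]
  | succ m ih =>
    rw [Finset.prod_range_succ, ← mul_assoc, ← ih]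
    rfl

theorem isPieced_olSol (hM : M.RegularJumps) (hν : M.IsAdmissible ν) (hx : x ∈ M.stateSpace)
    (hτ : M.IsReturnPath x.1 τ ζ) :
    M.IsPieced x.2.2.2 τ ζ (sellingRate ν x.1 τ (M.olSol ν x τ ζ))
      (fun m t => (M.flowSol (ν m) (M.olState ν x τ ζ m) (t - (τ m).toReal)).2.2.2)
      (fun t => (M.olSol ν x τ ζ t).2.2.2) := by
  have hself : ∀ m, τ m ≠ ⊤ → M.flowSol (ν m) (M.olState ν x τ ζ m)
      ((τ m).toReal - (τ m).toReal) = M.olState ν x τ ζ m := fun m hm => by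
    rw [sub_self, flowSol_zero hM (hν.isPolicy m) (olState_mem hM hν hx hτ m hm).1]
  have hcurve := fun (m : ℕ) (hm : τ m ≠ ⊤) =>
    filterSol_shift hM (a := M.killAlong (ν m) (M.olState ν x τ ζ m))
      (measurable_killAlong_right (hν.isPolicy m) _) (killAlong_mem hM _)
      (olState_mem hM hν hx hτ m hm).1.2.2.2
      (le_segEnd hτ hm) (rate := sellingRate ν x.1 τ (M.olSol ν x τ ζ)) (fun r hr => by
        rw [sellingRate_olSol hM hν hx hτ hm hr, killAlong, (olState_mem hM hν hx hτ m hm).2,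
          add_sub_cancel])
  refine ⟨fun m hm => (hcurve m hm).1, fun m hm => (hcurve m hm).2.1,
    fun m hm t ht i => ?_, fun m hm t ht hlt => ?_, ?_, fun m hm i => ?_⟩
  · simp only [hself m hm]
    exact (hcurve m hm).2.2 t ht i
  · simp only [olSol_eq hτ hm ht.1 hlt]
  · have h0 : τ 0 ≠ ⊤ := by rw [hτ.initial]; exact ENNReal.ofReal_ne_top
    simp only [hself 0 h0]
    rfl
  · have hm' := hτ.ne_top_of_succ hm
    simp only [hself _ hm]
    rw [sellingRate_olSol hM hν hx hτ hm' ⟨hτ.toReal_lt_succ hm, (segEnd_eq hτ hm).ge⟩]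
    have e : (M.flowSol (ν m) (M.olState ν x τ ζ m)
        ((τ (m + 1)).toReal - (τ m).toReal)).1 = (τ (m + 1)).toReal := by
      change (M.olState ν x τ ζ m).1 + _ = _
      rw [(olState_mem hM hν hx hτ m hm').2, add_sub_cancel]
    change _ * (1 + M.upd i (M.flowSol (ν m) (M.olState ν x τ ζ m)
        ((τ (m + 1)).toReal - (τ m).toReal)).1 _ _ _) = _
    rw [e]
    rfl

theorem solvesState_olSol (hM : M.RegularJumps) (hν : M.IsAdmissible ν) (hx : x ∈ M.stateSpace)
    (hτ : M.IsReturnPath x.1 τ ζ) : M.SolvesState ν x τ ζ (M.olSol ν x τ ζ) := by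
  refine ⟨fun t ht => ?_, fun t ht => ?_, fun t ht => ?_,
    (isPieced_olSol hM hν hx hτ).solvesKS hM hτ hx.1.1 fun r hr =>
      sellingRate_olSol_mem hM hν hx hτ hr⟩
  all_goals obtain ⟨m, hm, h1, h2, h3⟩ := hτ.exists_seg hx.1.1 ht
  · rw [olSol_eq hτ hm h1.1 h3]
    change (M.olState ν x τ ζ m).1 + _ = _
    rw [(olState_mem hM hν hx hτ m hm).2, add_sub_cancel]
  · rw [olSol_eq hτ hm h1.1 h3]
    exact (integral_sellingRate hM hν hx hτ m hm).2 t h1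
  · rw [olSol_eq hτ hm h1.1 h3]
    change (M.olState ν x τ ζ m).2.2.1 = _
    rw [price_olState, tprod_eq_prod (s := Finset.range m)]
    · congr 1
      refine Finset.prod_congr rfl fun n hn => (if_pos ?_).symm
      exact (hτ.monotone (Finset.mem_range.1 hn)).trans h2
    · intro n hn
      rw [Finset.mem_range, not_lt] at hn
      exact if_neg (not_le.2 (h3.trans_le (hτ.monotone (Nat.succ_le_succ hn))))

/-- The rate at `t` reads `X` only at jump times before `t` and through the sign of the inventory on
`[t0, t)`. -/
theorem sellingRate_congr {t0 : ℝ} (hτ : M.IsReturnPath t0 τ ζ) {X X' : ℝ → State K}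
    {t : ℝ} (h : EqOn X X' (Icc t0 t)) :
    sellingRate ν t0 τ X t = sellingRate ν t0 τ X' t := by
  refine tsum_congr fun n => ?_
  have hD : (∀ r ∈ Ico t0 t, 0 < (X r).2.1) ↔ ∀ r ∈ Ico t0 t, 0 < (X' r).2.1 :=
    forall₂_congr fun r hr => by rw [h ⟨hr.1, hr.2.le⟩]
  by_cases hn : τ n < ENNReal.ofReal t
  · have hn' : τ n ≠ ⊤ := (hn.trans_le le_top).ne
    rw [h ⟨(hτ.toReal_mem hn').1, ((ENNReal.lt_ofReal_iff_toReal_lt hn').1 hn).le⟩]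
    classical
    exact if_congr (and_congr Iff.rfl (and_congr Iff.rfl hD)) rfl rfl
  · rw [if_neg fun hc => hn hc.1, if_neg fun hc => hn hc.1]

/-- Two solutions that agree up to a jump agree up to the next one. -/
theorem SolvesState.eqOn_succ (hM : M.RegularJumps) (hν : M.IsAdmissible ν) (hx : x ∈ M.stateSpace)
    (hτ : M.IsReturnPath x.1 τ ζ) {X : ℝ → State K} (hX : M.SolvesState ν x τ ζ X) {m : ℕ}
    (hm : τ m ≠ ⊤) (hEq : EqOn X (M.olSol ν x τ ζ) (Icc x.1 (τ m).toReal)) :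
    EqOn X (M.olSol ν x τ ζ) (Icc x.1 (M.segEnd τ m)) := by
  set s := (τ m).toReal with hs
  set y := M.olState ν x τ ζ m with hydef
  have hy : y ∈ M.stateSpace := (olState_mem hM hν hx hτ m hm).1
  have hsol := solvesState_olSol hM hν hx hτ
  have hxs : x.1 ≤ s := (hτ.toReal_mem hm).1
  have hse : s ≤ M.segEnd τ m := le_segEnd hτ hm
  have hXy : X s = y := by rw [hEq ⟨hxs, le_rfl⟩, olSol_self hM hν hx hτ hm]
  set F := sellingRate ν x.1 τ X with hF
  set F0 := sellingRate ν x.1 τ (M.olSol ν x τ ζ) with hF0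
  have hFs : ∀ r ∈ Ioc x.1 s, F r = F0 r := fun r hr =>
    sellingRate_congr hτ (hEq.mono (Icc_subset_Icc le_rfl hr.2))
  have hF0i := (integral_sellingRate hM hν hx hτ m hm).1
  have hFi1 : IntervalIntegrable F volume x.1 s := by
    have : IntervalIntegrable F0 volume x.1 s := hF0i.mono_set (by
      rw [uIcc_of_le hxs, uIcc_of_le (hxs.trans hse)]; exact Icc_subset_Icc le_rfl hse)
    rw [intervalIntegrable_iff_integrableOn_Ioc_of_le hxs] at this ⊢
    exact this.congr_fun (fun r hr => (hFs r hr).symm) measurableSet_Ioc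
  -- The times not after liquidation form a lower set, hence a measurable one, although nothing is
  -- known about the measurability of `X`. On the new segment the rate is `α (r - s)` on `D` and `0`
  -- elsewhere, so it is integrable.
  set D : Set ℝ := {t | ∀ r ∈ Ico x.1 t, 0 < (X r).2.1} with hD
  have hDlower : IsLowerSet D := fun a b hba ha r hr => ha r ⟨hr.1, hr.2.trans_le hba⟩
  have hDm : MeasurableSet D := hDlower.ordConnected.measurableSet
  set α := M.pol (ν m) y with hα
  have hαm : Measurable α := (measurable_pol (hν.isPolicy m)).of_uncurry_left
  have hαi : ∀ a b, IntervalIntegrable (fun r => α (r - s)) volume a b := fun a b =>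
    intervalIntegrable_of_mem_Icc (hαm.comp (measurable_id.sub_const s)) (fun u => pol_mem y _) a b
  have hlt1 : ∀ t ∈ Ioc s (M.segEnd τ m), τ m < ENNReal.ofReal t := fun t ht =>
    (ENNReal.lt_ofReal_iff_toReal_lt hm).2 ht.1
  have hlt2 : ∀ t ∈ Ioc s (M.segEnd τ m), ENNReal.ofReal t ≤ τ (m + 1) := fun t ht =>
    (ENNReal.ofReal_le_of_le_toReal ht.2).trans (min_le_left _ (ENNReal.ofReal M.T))
  have hpol : ∀ t ∈ Icc s (M.segEnd τ m), α (t - s) = ν m y (t - s) := fun t ht =>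
    pol_eq (hν.isPolicy m) hy (mem_Icc_of_horizon hy (sub_mem_horizon hM hν hx hτ hm ht))
  have hFD : ∀ t ∈ Ioc s (M.segEnd τ m), F t = D.indicator (fun r => α (r - s)) t := by
    classical
    intro t ht
    rw [hF, sellingRate_eq hτ.monotone X (hlt1 t ht) (hlt2 t ht), indicator_apply, ← hs, hXy,
      hpol t ⟨ht.1.le, ht.2⟩]
    rfl
  have hFi : ∀ t ∈ Icc s (M.segEnd τ m), IntervalIntegrable F volume s t := by
    intro t ht
    rw [intervalIntegrable_iff_integrableOn_Ioc_of_le ht.1]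
    have := (intervalIntegrable_iff_integrableOn_Ioc_of_le ht.1).1 (hαi s t)
    exact IntegrableOn.congr_fun (Integrable.indicator this hDm)
      (fun r hr => (hFD r ⟨hr.1, hr.2.trans ht.2⟩).symm) measurableSet_Ioc
  have hW : ∀ t ∈ Icc s (M.segEnd τ m), (X t).2.1 = y.2.1 - ∫ r in s..t, F r := by
    intro t ht
    have h1 := hX.inventory t ⟨hxs.trans ht.1, ht.2.trans (segEnd_le τ m)⟩
    have h2 := hX.inventory s ⟨hxs, hse.trans (segEnd_le τ m)⟩
    rw [hXy] at h2
    rw [h1, h2, ← intervalIntegral.integral_add_adjacent_intervals hFi1 (hFi t ht)]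
    ring
  have hshift : ∀ t, ∫ r in s..t, α (r - s) = ∫ r in (0 : ℝ)..(t - s), α r := fun t => by
    rw [intervalIntegral.integral_comp_sub_right (fun r => α r) s, sub_self]
  have hFeq : ∀ r ∈ Ioc x.1 (M.segEnd τ m), F r = F0 r := by
    intro t ht
    rcases le_or_gt t s with h | h
    · exact hFs t ⟨ht.1, h⟩
    have ht' : t ∈ Ioc s (M.segEnd τ m) := ⟨h, ht.2⟩
    rw [hF0, sellingRate_olSol hM hν hx hτ hm ht']
    refine sellingRate_eq_polRate hν hτ.monotone (hlt1 t ht') (hlt2 t ht')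
      ⟨hx.1.1.trans ht.1.le, ht.2.trans (segEnd_le τ m)⟩ hy hXy (fun r hr => ?_)
      (fun hd v hv => ?_) (fun he r hr => ?_)
    · rw [hEq ⟨hr.1, hr.2.le⟩]
      exact inventory_olSol_ge hν hx hτ hm hr
    · have hsv : s + v ∈ Icc s (M.segEnd τ m) := ⟨by linarith [hv.1], by linarith [hv.2, ht.2]⟩
      have hpos : 0 < (X (s + v)).2.1 := hd _ ⟨hxs.trans hsv.1, by linarith [hv.2]⟩
      -- As long as no liquidation has occurred, the rate of `X` is the full policy, so positive
      -- inventory bounds the amount the policy has sold.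
      have hint : ∫ r in s..s + v, F r = ∫ r in s..s + v, α (r - s) := by
        rw [intervalIntegral.integral_of_le hsv.1, intervalIntegral.integral_of_le hsv.1]
        refine setIntegral_congr_fun measurableSet_Ioc fun r hr => ?_
        have hrD : r ∈ D := hDlower (by linarith [hr.2, hv.2] : r ≤ t) hd
        change F r = α (r - s)
        rw [hFD r ⟨hr.1, hr.2.trans hsv.2⟩, indicator_of_mem hrD]
      rw [hW _ hsv, hint, hshift, add_sub_cancel_left] at hpos
      exact sub_pos.1 hpos
    · have hr' : r ∈ Icc s (M.segEnd τ m) := ⟨hr.1, hr.2.le.trans ht.2⟩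
      -- In the converse direction the rate of `X` never exceeds the policy. If even the policy has
      -- not exhausted the inventory, neither has `X`.
      have hle : ∫ u in s..r, F u ≤ ∫ u in s..r, α (u - s) := by
        refine intervalIntegral.integral_mono_on_of_le_Ioo hr.1 (hFi r hr') (hαi s r) fun u hu => ?_
        rw [hFD u ⟨hu.1, hu.2.le.trans hr'.2⟩]
        exact indicator_le_self' (fun _ _ => (pol_mem y _).1) u
      have := he (r - s) ⟨sub_nonneg.2 hr.1, sub_lt_sub_right hr.2 _⟩
      rw [hW r hr', sub_pos]
      exact (hle.trans_eq (hshift r)).trans_lt this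
  have hsub : Icc x.1 (M.segEnd τ m) ⊆ Icc x.1 M.T := Icc_subset_Icc le_rfl (segEnd_le τ m)
  have hπ := hX.filter.unique hM hx.1.1 hτ hsol.filter (segEnd_le τ m)
    (fun r hr => by
      change F r ∈ _
      rw [hFeq r hr]
      exact sellingRate_olSol_mem hM hν hx hτ ⟨hr.1, hr.2.trans (segEnd_le τ m)⟩) hFeq
    (by
      have h1 := ((intervalIntegrable_iff_integrableOn_Ioc_of_le (hxs.trans hse)).1
        hF0i).aestronglyMeasurable.aemeasurable
      refine h1.congr ?_
      filter_upwards [ae_restrict_mem measurableSet_Ioc] with r hr using (hFeq r hr).symm)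
  intro t ht
  refine Prod.ext ?_ (Prod.ext ?_ (Prod.ext ?_ (hπ ht)))
  · rw [hX.time t (hsub ht), hsol.time t (hsub ht)]
  · rw [hX.inventory t (hsub ht), hsol.inventory t (hsub ht),
      intervalIntegral.integral_of_le ht.1, intervalIntegral.integral_of_le ht.1]
    congr 1
    exact setIntegral_congr_fun measurableSet_Ioc fun r hr => hFeq r ⟨hr.1, hr.2.trans ht.2⟩
  · rw [hX.price t (hsub ht), hsol.price t (hsub ht)]

theorem SolvesState.eqOn_olSol (hM : M.RegularJumps) (hν : M.IsAdmissible ν) (hx : x ∈ M.stateSpace)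
    (hτ : M.IsReturnPath x.1 τ ζ) {X : ℝ → State K} (hX : M.SolvesState ν x τ ζ X) :
    EqOn X (M.olSol ν x τ ζ) (Icc x.1 M.T) := by
  have key : ∀ m, τ m ≠ ⊤ → EqOn X (M.olSol ν x τ ζ) (Icc x.1 (M.segEnd τ m)) := by
    intro m
    induction m with
    | zero =>
      intro hm
      refine hX.eqOn_succ hM hν hx hτ hm ?_
      rw [hτ.toReal_zero hx.1.1, Icc_self]
      rintro _ rfl
      have hsol := solvesState_olSol hM hν hx hτ
      have hmem : x.1 ∈ Icc x.1 M.T := ⟨le_rfl, hx.1.2⟩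
      -- At the initial time the filters are compared by `SolvesKS.unique` with `e = x.1`; its
      -- conditions on the rates concern an empty interval.
      refine Prod.ext ?_ (Prod.ext ?_ (Prod.ext ?_
        (hX.filter.unique hM hx.1.1 hτ hsol.filter hx.1.2 ?_ ?_ ?_ ⟨le_rfl, le_rfl⟩)))
      · rw [hX.time _ hmem, hsol.time _ hmem]
      · rw [hX.inventory _ hmem, hsol.inventory _ hmem]
        simp
      · rw [hX.price _ hmem, hsol.price _ hmem]
      · simp
      · simp
      · simp
    | succ m ih =>
      intro hm
      have := ih (hτ.ne_top_of_succ hm)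
      rw [segEnd_eq hτ hm] at this
      exact hX.eqOn_succ hM hν hx hτ hm this
  intro t ht
  obtain ⟨m, hm, h1, -⟩ := hτ.exists_seg hx.1.1 ht
  exact key m hm ⟨ht.1, h1.2⟩

end OpenLoop

end Model
end
end Liquidation

/-! ### The transition kernels of the marks: next jump time and next state. -/

namespace Liquidation

noncomputable section

variable {K : ℕ}

theorem abs_exp_neg_sub_le {x y : ℝ} (hx : 0 ≤ x) (hy : 0 ≤ y) :
    |Real.exp (-x) - Real.exp (-y)| ≤ |x - y| := by
  wlog h : x ≤ y generalizing x y
  · rw [abs_sub_comm, abs_sub_comm x y]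
    exact this hy hx (le_of_not_ge h)
  rw [abs_of_nonneg (sub_nonneg.2 (Real.exp_le_exp.2 (neg_le_neg h))), abs_sub_comm,
    abs_of_nonneg (sub_nonneg.2 h)]
  have e : Real.exp (-y) = Real.exp (-x) * Real.exp (-(y - x)) := by
    rw [← Real.exp_add]; congr 1; ring
  have h1 : Real.exp (-x) ≤ 1 := Real.exp_le_one_iff.2 (by linarith)
  have h2 : 1 - (y - x) ≤ Real.exp (-(y - x)) := Real.one_sub_le_exp_neg _
  have h3 : Real.exp (-(y - x)) ≤ 1 := Real.exp_le_one_iff.2 (by linarith)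
  rw [e]
  nlinarith [Real.exp_pos (-x)]

/-- The survival function of a bounded hazard rate. -/
theorem integral_mul_exp_neg {f : ℝ → ℝ} {L D : ℝ} (hf : IntervalIntegrable f volume 0 L)
    (hD : ∀ r ∈ Icc 0 L, f r ∈ Icc 0 D) {a b : ℝ} (ha : 0 ≤ a) (hab : a ≤ b) (hb : b ≤ L) :
    ∫ r in a..b, f r * Real.exp (-∫ s in (0 : ℝ)..r, f s)
      = Real.exp (-∫ s in (0 : ℝ)..a, f s) - Real.exp (-∫ s in (0 : ℝ)..b, f s) := by
  have hL : 0 ≤ L := ha.trans (hab.trans hb)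
  have h0L : uIcc 0 L = Icc 0 L := uIcc_of_le hL
  have hu : uIcc a b = Icc a b := uIcc_of_le hab
  have hsub : Icc a b ⊆ Icc 0 L := Icc_subset_Icc ha hb
  set F : ℝ → ℝ := fun t => ∫ s in (0 : ℝ)..t, f s with hF
  have hmono : ∀ s ∈ Icc 0 L, ∀ t ∈ Icc 0 L, IntervalIntegrable f volume s t :=
    fun s hs t ht => hf.mono_set (by rw [h0L]; exact uIcc_subset_Icc hs ht)
  have h0 : (0 : ℝ) ∈ Icc 0 L := ⟨le_rfl, hL⟩
  have hD0 : 0 ≤ D := (hD 0 h0).1.trans (hD 0 h0).2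
  have hF0 : ∀ t ∈ Icc 0 L, 0 ≤ F t := fun t ht =>
    intervalIntegral.integral_nonneg ht.1 fun r hr => (hD r ⟨hr.1, hr.2.trans ht.2⟩).1
  -- The rate is bounded and `x ↦ exp (-x)` is 1-Lipschitz on `[0, ∞)`, so the survival function is
  -- Lipschitz and is recovered from its almost everywhere derivative.
  have hac : AbsolutelyContinuousOnInterval (fun t => Real.exp (-F t)) a b := by
    apply LipschitzOnWith.absolutelyContinuousOnInterval (K := D.toNNReal)
    rw [hu]
    refine LipschitzOnWith.of_dist_le_mul fun s hs t ht => ?_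
    rw [Real.dist_eq, Real.dist_eq, Real.coe_toNNReal D hD0]
    refine (abs_exp_neg_sub_le (hF0 s (hsub hs)) (hF0 t (hsub ht))).trans ?_
    rw [hF, intervalIntegral.integral_interval_sub_left (hmono 0 h0 s (hsub hs))
      (hmono 0 h0 t (hsub ht))]
    refine intervalIntegral.norm_integral_le_of_norm_le_const (f := f) fun r hr => ?_
    have hr' := hD r (uIcc_subset_Icc (hsub ht) (hsub hs) (uIoc_subset_uIcc hr))
    rw [Real.norm_of_nonneg hr'.1]
    exact hr'.2
  have h1 := hac.integral_deriv_eq_sub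
  have h2 : ∫ x in a..b, deriv (fun t => Real.exp (-F t)) x
      = ∫ r in a..b, -(f r * Real.exp (-F r)) := by
    apply intervalIntegral.integral_congr_ae
    filter_upwards [hf.ae_hasDerivAt_integral] with x hx hxab
    have hx' : x ∈ uIcc 0 L := by
      rw [h0L]; exact hsub (hu ▸ uIoc_subset_uIcc hxab)
    have d1 : HasDerivAt F (f x) x := hx hx' 0 (by simp)
    rw [(d1.fun_neg.exp).deriv]
    ring
  rw [h2, intervalIntegral.integral_neg] at h1
  linarith

namespace Model

variable {M : Model K} {β : State K → ℝ → ℝ}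

/-! ### Jump rates along the flow -/

/-- The jump rate along the controlled flow. -/
def rateAlong (M : Model K) (β : State K → ℝ → ℝ) (y : State K) (u : ℝ) : ℝ :=
  ∑ j, (M.flowSol β y u).2.2.2 j * M.killAlong β y u j

/-- The cumulated jump rate along the controlled flow. -/
def cumAlong (M : Model K) (β : State K → ℝ → ℝ) (y : State K) (u : ℝ) : ℝ :=
  ∫ v in (0 : ℝ)..u, M.rateAlong β y v

theorem measurable_rateAlong (hβ : M.IsPolicy β) :
    Measurable fun p : State K × ℝ => M.rateAlong β p.1 p.2 := by
  have h1 : Measurable fun p : State K × ℝ => (M.flowSol β p.1 p.2).2.2.2 :=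
    (measurable_flowSol hβ).snd.snd.snd
  have h2 := measurable_pi_iff.1 h1
  have h3 := measurable_pi_iff.1 (measurable_killAlong hβ)
  exact Finset.measurable_fun_sum _ fun j _ => (h2 j).mul (h3 j)

theorem measurable_cumAlong (hβ : M.IsPolicy β) :
    Measurable fun p : State K × ℝ => M.cumAlong β p.1 p.2 := by
  have hr : Measurable (Function.uncurry fun (p : State K × ℝ) r => M.rateAlong β p.1 r) :=
    ((measurable_rateAlong hβ).comp ((measurable_fst.comp measurable_fst).prodMk measurable_snd) :)
  exact measurable_intervalIntegral hr measurable_const measurable_snd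

theorem rateAlong_mem (hM : M.RegularJumps) (hβ : M.IsPolicy β) {y : State K}
    (hy : y ∈ M.stateSpace) {u : ℝ} (hu : u ∈ Icc 0 (M.T - y.1)) :
    M.rateAlong β y u ∈ Icc 0 M.killBound :=
  simplex_sum_mem (flowSol_mem hM hβ hy hu).2.2.2 (killAlong_mem hM y u)

theorem jumpRate_flowSol (hM : M.RegularJumps) (hβ : M.IsPolicy β) {y : State K}
    (hy : y ∈ M.stateSpace) {u : ℝ} (hu : u ∈ Icc 0 (M.T - y.1)) :
    M.jumpRate (M.flowSol β y u) (M.polRate β y u) = M.rateAlong β y u :=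
  jumpRate_eq hM (flowSol_mem hM hβ hy hu) (polRate_mem y u)

theorem cumRate_eq (hM : M.RegularJumps) (hβ : M.IsPolicy β) {y : State K}
    (hy : y ∈ M.stateSpace) {u : ℝ} (hu : u ∈ Icc 0 (M.T - y.1)) :
    M.cumRate (β y) y u = M.cumAlong β y u := by
  refine intervalIntegral.integral_congr fun v hv => ?_
  rw [uIcc_of_le hu.1] at hv
  have hv' : v ∈ Icc 0 (M.T - y.1) := ⟨hv.1, hv.2.trans hu.2⟩
  simp only [flow_eq hM hβ hy hv', polRate_eq hβ hy (mem_Icc_of_horizon hy hv'),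
    jumpRate_flowSol hM hβ hy hv']

theorem intervalIntegrable_rateAlong (hM : M.RegularJumps) (hβ : M.IsPolicy β) {y : State K}
    (hy : y ∈ M.stateSpace) : IntervalIntegrable (M.rateAlong β y) volume 0 (M.T - y.1) := by
  rw [intervalIntegrable_iff_integrableOn_Icc_of_le (stateSpace_horizon hy)]
  refine Measure.integrableOn_of_bounded (M := M.killBound) (by simp)
    (measurable_rateAlong hβ).of_uncurry_left.aestronglyMeasurable (f := M.rateAlong β y) ?_
  filter_upwards [ae_restrict_mem measurableSet_Icc] with r hr
  have := rateAlong_mem hM hβ hy hr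
  rw [Real.norm_of_nonneg this.1]
  exact this.2

/-! ### The law of the next jump time -/

/-- The states after the jumps, marked with the jump times. -/
abbrev Mark (K : ℕ) : Type := ℝ≥0∞ × State K

/-- The marks of actual jumps. -/
def goodMark (M : Model K) : Set (Mark K) := {e | e.2 ∈ M.stateSpace ∧ e.1 = ENNReal.ofReal e.2.1}

theorem measurableSet_goodMark (M : Model K) : MeasurableSet M.goodMark :=
  (M.measurableSet_stateSpace.preimage measurable_snd).inter
    (measurableSet_eq_fun measurable_fst (measurable_fst.comp measurable_snd).ennreal_ofReal)

/-- The density of the next jump time. -/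
def timeDens (M : Model K) (β : State K → ℝ → ℝ) (e : Mark K) (t : ℝ) : ℝ≥0∞ :=
  {p : Mark K × ℝ | p.1 ∈ M.goodMark ∧ p.1.2.1 < p.2 ∧ p.2 ≤ M.T}.indicator
    (fun p => ENNReal.ofReal (M.rateAlong β p.1.2 (p.2 - p.1.2.1) *
      Real.exp (-M.cumAlong β p.1.2 (p.2 - p.1.2.1)))) (e, t)

/-- The probability that there is no further jump up to the horizon. -/
def noJumpProb (M : Model K) (β : State K → ℝ → ℝ) (e : Mark K) : ℝ≥0∞ :=
  M.goodMark.indicator (fun e => ENNReal.ofReal (Real.exp (-M.cumAlong β e.2 (M.T - e.2.1)))) e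
    + M.goodMarkᶜ.indicator 1 e

/-- The law of the next jump time. -/
def timeKernel (M : Model K) (β : State K → ℝ → ℝ) : Kernel (Mark K) ℝ≥0∞ :=
  ((Kernel.const (Mark K) (volume : Measure ℝ)).withDensity (M.timeDens β)).map ENNReal.ofReal +
    (Kernel.const (Mark K) (Measure.dirac ⊤)).withDensity fun e _ => M.noJumpProb β e

theorem measurable_timeDens (hβ : M.IsPolicy β) : Measurable (Function.uncurry (M.timeDens β)) := by
  have hp : Measurable fun p : Mark K × ℝ => (p.1.2, p.2 - p.1.2.1) := by fun_prop
  have h1 : Measurable fun p : Mark K × ℝ => M.rateAlong β p.1.2 (p.2 - p.1.2.1) :=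
    ((measurable_rateAlong hβ).comp hp :)
  have h2 : Measurable fun p : Mark K × ℝ => M.cumAlong β p.1.2 (p.2 - p.1.2.1) :=
    ((measurable_cumAlong hβ).comp hp :)
  refine Measurable.indicator (h1.mul h2.neg.exp).ennreal_ofReal ?_
  refine (M.measurableSet_goodMark.preimage measurable_fst).inter (MeasurableSet.inter
    (measurableSet_lt (f := fun p : Mark K × ℝ => p.1.2.1) (g := fun p => p.2) (by fun_prop)
      (by fun_prop)) (measurableSet_le (f := fun p : Mark K × ℝ => p.2) (g := fun _ => M.T)
      (by fun_prop) (by fun_prop)))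

theorem measurable_noJumpProb (hβ : M.IsPolicy β) : Measurable (M.noJumpProb β) := by
  have hp : Measurable fun e : Mark K => (e.2, M.T - e.2.1) := by fun_prop
  have h2 : Measurable fun e : Mark K => M.cumAlong β e.2 (M.T - e.2.1) :=
    ((measurable_cumAlong hβ).comp hp :)
  exact (h2.neg.exp.ennreal_ofReal.indicator M.measurableSet_goodMark).add
    (measurable_const.indicator M.measurableSet_goodMark.compl)

theorem lintegral_timeKernel (hβ : M.IsPolicy β) (e : Mark K) {φ : ℝ≥0∞ → ℝ≥0∞}
    (hφ : Measurable φ) : ∫⁻ r, φ r ∂(M.timeKernel β e)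
      = (∫⁻ t, M.timeDens β e t * φ (ENNReal.ofReal t)) + M.noJumpProb β e * φ ⊤ := by
  rw [timeKernel, FunLike.coe_add, Pi.add_apply, lintegral_add_measure,
    Kernel.map_apply _ ENNReal.measurable_ofReal, lintegral_map hφ ENNReal.measurable_ofReal,
    Kernel.lintegral_withDensity _ (measurable_timeDens hβ) e
      (g := fun t => φ (ENNReal.ofReal t)) (hφ.comp ENNReal.measurable_ofReal),
    Kernel.lintegral_withDensity (f := fun e _ => M.noJumpProb β e) _
      ((measurable_noJumpProb hβ).comp measurable_fst) e hφ,
    Kernel.const_apply, Kernel.const_apply, lintegral_dirac]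

theorem timeKernel_apply (hβ : M.IsPolicy β) (e : Mark K) {B : Set ℝ≥0∞} (hB : MeasurableSet B) :
    M.timeKernel β e B = (∫⁻ t in ENNReal.ofReal ⁻¹' B, M.timeDens β e t)
      + M.noJumpProb β e * B.indicator 1 ⊤ := by
  rw [← lintegral_indicator_one hB, lintegral_timeKernel hβ e (measurable_one.indicator hB),
    ← lintegral_indicator (ENNReal.measurable_ofReal hB)]
  congr 1
  refine lintegral_congr fun t => ?_
  by_cases ht : ENNReal.ofReal t ∈ B
  · rw [indicator_of_mem ht, indicator_of_mem (by exact ht), Pi.one_apply, mul_one]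
  · rw [indicator_of_notMem ht, indicator_of_notMem (by exact ht), mul_zero]

theorem timeDens_of_bad {e : Mark K} (he : e ∉ M.goodMark) (t : ℝ) : M.timeDens β e t = 0 :=
  indicator_of_notMem (fun h => he h.1) _

theorem timeDens_of_good {e : Mark K} (he : e ∈ M.goodMark) :
    M.timeDens β e = (Ioc e.2.1 M.T).indicator fun t => ENNReal.ofReal
      (M.rateAlong β e.2 (t - e.2.1) * Real.exp (-M.cumAlong β e.2 (t - e.2.1))) := by
  ext t
  by_cases ht : t ∈ Ioc e.2.1 M.T
  · rw [indicator_of_mem ht]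
    exact indicator_of_mem (s := {p : Mark K × ℝ | p.1 ∈ M.goodMark ∧ p.1.2.1 < p.2 ∧ p.2 ≤ M.T})
      (a := (e, t)) ⟨he, ht⟩ _
  · rw [indicator_of_notMem ht]
    exact indicator_of_notMem (fun h => ht h.2) _

theorem noJumpProb_of_good {e : Mark K} (he : e ∈ M.goodMark) :
    M.noJumpProb β e = ENNReal.ofReal (Real.exp (-M.cumAlong β e.2 (M.T - e.2.1))) := by
  rw [noJumpProb, indicator_of_mem he, indicator_of_notMem (notMem_compl_iff.2 he), add_zero]

theorem noJumpProb_of_bad {e : Mark K} (he : e ∉ M.goodMark) : M.noJumpProb β e = 1 := by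
  rw [noJumpProb, indicator_of_notMem he, indicator_of_mem (by exact he), zero_add, Pi.one_apply]

theorem timeKernel_of_bad (hβ : M.IsPolicy β) {e : Mark K} (he : e ∉ M.goodMark) :
    M.timeKernel β e = Measure.dirac ⊤ := by
  ext B hB
  rw [timeKernel_apply hβ e hB, noJumpProb_of_bad he, one_mul, Measure.dirac_apply' _ hB]
  simp [timeDens_of_bad he]

theorem setLIntegral_timeDens (hM : M.RegularJumps) (hβ : M.IsPolicy β) {e : Mark K}
    (he : e ∈ M.goodMark) {t : ℝ} (ht : t ∈ Icc e.2.1 M.T) :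
    ∫⁻ s in Ioi t, M.timeDens β e s = ENNReal.ofReal (Real.exp (-M.cumAlong β e.2 (t - e.2.1))
      - Real.exp (-M.cumAlong β e.2 (M.T - e.2.1))) := by
  have hy := he.1
  rw [timeDens_of_good he, lintegral_indicator measurableSet_Ioc,
    Measure.restrict_restrict measurableSet_Ioc, Ioc_inter_Ioi, max_eq_right ht.1]
  set G : ℝ → ℝ := fun u => M.rateAlong β e.2 u * Real.exp (-M.cumAlong β e.2 u) with hG
  have hint := intervalIntegrable_rateAlong hM hβ hy
  have hfin := integral_mul_exp_neg hint (fun r hr => rateAlong_mem hM hβ hy hr)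
    (sub_nonneg.2 ht.1) (sub_le_sub_right ht.2 e.2.1) le_rfl
  have hsub := intervalIntegral.integral_comp_sub_right (a := t) (b := M.T) G e.2.1
  have hGnn : ∀ s ∈ Ioc t M.T, 0 ≤ G (s - e.2.1) := fun s hs => mul_nonneg
    (rateAlong_mem hM hβ hy ⟨sub_nonneg.2 (ht.1.trans hs.1.le), sub_le_sub_right hs.2 _⟩).1
    (Real.exp_pos _).le
  have hGm : Measurable G := ((measurable_rateAlong hβ).of_uncurry_left (f := M.rateAlong β)).mul
    ((measurable_cumAlong hβ).of_uncurry_left (f := M.cumAlong β)).neg.exp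
  have hGi : IntegrableOn (fun s => G (s - e.2.1)) (Ioc t M.T) := by
    refine Measure.integrableOn_of_bounded (M := M.killBound) (by simp)
      (hGm.comp (measurable_id.sub_const _)).aestronglyMeasurable ?_
    filter_upwards [ae_restrict_mem measurableSet_Ioc] with s hs
    rw [Real.norm_of_nonneg (hGnn s hs)]
    have hu : s - e.2.1 ∈ Icc 0 (M.T - e.2.1) :=
      ⟨sub_nonneg.2 (ht.1.trans hs.1.le), sub_le_sub_right hs.2 _⟩
    have h1 := rateAlong_mem hM hβ hy hu
    refine (mul_le_of_le_one_right h1.1 (Real.exp_le_one_iff.2 (neg_nonpos.2 ?_))).trans h1.2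
    exact intervalIntegral.integral_nonneg hu.1 fun r hr =>
      (rateAlong_mem hM hβ hy ⟨hr.1, hr.2.trans hu.2⟩).1
  have e1 : ∫ s in Ioc t M.T, G (s - e.2.1) = Real.exp (-M.cumAlong β e.2 (t - e.2.1))
      - Real.exp (-M.cumAlong β e.2 (M.T - e.2.1)) := by
    rw [← intervalIntegral.integral_of_le ht.2, hsub]
    exact hfin
  rw [← e1, ofReal_integral_eq_lintegral_ofReal hGi]
  filter_upwards [ae_restrict_mem measurableSet_Ioc] with s hs using hGnn s hs

theorem cumAlong_mono (hM : M.RegularJumps) (hβ : M.IsPolicy β) {y : State K}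
    (hy : y ∈ M.stateSpace) {a b : ℝ} (ha : 0 ≤ a) (hab : a ≤ b) (hb : b ≤ M.T - y.1) :
    M.cumAlong β y a ≤ M.cumAlong β y b := by
  have hint := intervalIntegrable_rateAlong hM hβ hy
  have hL := stateSpace_horizon hy
  have hm : ∀ c ∈ Icc 0 (M.T - y.1), IntervalIntegrable (M.rateAlong β y) volume 0 c := fun c hc =>
    hint.mono_set (by rw [uIcc_of_le hL, uIcc_of_le hc.1]; exact Icc_subset_Icc le_rfl hc.2)
  have h := intervalIntegral.integral_interval_sub_left (hm b ⟨ha.trans hab, hb⟩)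
    (hm a ⟨ha, hab.trans hb⟩)
  have h2 : 0 ≤ ∫ r in a..b, M.rateAlong β y r := intervalIntegral.integral_nonneg hab fun r hr =>
    (rateAlong_mem hM hβ hy ⟨ha.trans hr.1, hr.2.trans hb⟩).1
  rw [← h] at h2
  exact sub_nonneg.1 h2

/-- The density on `(t, T]` contributes the difference of the survival probabilities at `t` and at
the horizon, and the atom at `⊤` contributes the latter. -/
theorem timeKernel_Ioi (hM : M.RegularJumps) (hβ : M.IsPolicy β) {e : Mark K}
    (he : e ∈ M.goodMark) {t : ℝ} (ht : t ∈ Icc e.2.1 M.T) :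
    M.timeKernel β e (Ioi (ENNReal.ofReal t))
      = ENNReal.ofReal (Real.exp (-M.cumAlong β e.2 (t - e.2.1))) := by
  have h0 : 0 ≤ t := he.1.1.1.trans ht.1
  have hpre : ENNReal.ofReal ⁻¹' Ioi (ENNReal.ofReal t) = Ioi t := by
    ext s
    exact ENNReal.ofReal_lt_ofReal_iff_of_nonneg h0
  rw [timeKernel_apply hβ e measurableSet_Ioi, hpre, setLIntegral_timeDens hM hβ he ht,
    noJumpProb_of_good he, indicator_of_mem (by exact ENNReal.ofReal_lt_top), Pi.one_apply, mul_one,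
    ← ENNReal.ofReal_add _ (Real.exp_pos _).le, sub_add_cancel]
  exact sub_nonneg.2 (Real.exp_le_exp.2 (neg_le_neg
    (cumAlong_mono hM hβ he.1 (sub_nonneg.2 ht.1) (sub_le_sub_right ht.2 _) le_rfl)))

theorem cumAlong_zero (y : State K) : M.cumAlong β y 0 = 0 := intervalIntegral.integral_same

theorem timeKernel_univ (hM : M.RegularJumps) (hβ : M.IsPolicy β) (e : Mark K) :
    M.timeKernel β e univ = 1 := by
  by_cases he : e ∈ M.goodMark
  -- At the time of the mark itself the survival probability is one, and the kernel charges only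
  -- later times. Its total mass is therefore one.
  · have hmem : e.2.1 ∈ Icc e.2.1 M.T := ⟨le_rfl, he.1.1.2⟩
    have h := timeKernel_Ioi hM hβ he hmem
    rw [sub_self, cumAlong_zero, neg_zero, Real.exp_zero, ENNReal.ofReal_one] at h
    rw [← h, timeKernel_apply hβ e MeasurableSet.univ, timeKernel_apply hβ e measurableSet_Ioi]
    congr 1
    · rw [preimage_univ, Measure.restrict_univ, timeDens_of_good he,
        lintegral_indicator measurableSet_Ioc, lintegral_indicator measurableSet_Ioc,
        Measure.restrict_restrict measurableSet_Ioc]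
      congr 2
      refine (inter_eq_left.2 fun s hs => ?_).symm
      exact (ENNReal.ofReal_lt_ofReal_iff_of_nonneg he.1.1.1).2 hs.1
    · rw [indicator_of_mem (mem_univ _), indicator_of_mem (by exact ENNReal.ofReal_lt_top)]
  · rw [timeKernel_of_bad hβ he]
    simp

theorem isMarkovKernel_timeKernel (hM : M.RegularJumps) (hβ : M.IsPolicy β) :
    IsMarkovKernel (M.timeKernel β) := ⟨fun e => ⟨timeKernel_univ hM hβ e⟩⟩

/-- Almost surely, the next jump takes place later, up to the horizon, and while the rate is
positive. -/
theorem ae_timeKernel (hβ : M.IsPolicy β) (e : Mark K) :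
    ∀ᵐ r ∂(M.timeKernel β e), r = ⊤ ∨ (e ∈ M.goodMark ∧ r ≠ ⊤ ∧ r.toReal ∈ Ioc e.2.1 M.T ∧
      0 < M.rateAlong β e.2 (r.toReal - e.2.1)) := by
  by_cases he : e ∈ M.goodMark
  · set A : Set ℝ≥0∞ := {r | r ≠ ⊤ ∧ ¬ (r.toReal ∈ Ioc e.2.1 M.T ∧
      0 < M.rateAlong β e.2 (r.toReal - e.2.1))} with hA
    have hr : Measurable (M.rateAlong β e.2) :=
      (measurable_rateAlong hβ).of_uncurry_left (f := M.rateAlong β)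
    have hAm : MeasurableSet A := by
      refine (measurableSet_singleton ⊤).compl.inter (MeasurableSet.compl (MeasurableSet.inter
        (ENNReal.measurable_toReal measurableSet_Ioc) (measurableSet_lt measurable_const
          (hr.comp (ENNReal.measurable_toReal.sub_const _)))))
    have hA0 : M.timeKernel β e A = 0 := by
      rw [timeKernel_apply hβ e hAm, indicator_of_notMem (fun h => h.1 rfl), mul_zero, add_zero,
        ← nonpos_iff_eq_zero, ← lintegral_indicator (ENNReal.measurable_ofReal hAm),
        timeDens_of_good he]
      refine le_of_eq ((lintegral_congr fun t => ?_).trans lintegral_zero)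
      by_cases ht : ENNReal.ofReal t ∈ A
      · rw [indicator_of_mem (by exact ht)]
        by_cases ht' : t ∈ Ioc e.2.1 M.T
        · rw [indicator_of_mem ht']
          have h2 := ht.2
          rw [ENNReal.toReal_ofReal (he.1.1.1.trans ht'.1.le)] at h2
          have h3 : M.rateAlong β e.2 (t - e.2.1) ≤ 0 := not_lt.1 fun h => h2 ⟨ht', h⟩
          exact ENNReal.ofReal_of_nonpos (mul_nonpos_of_nonpos_of_nonneg h3 (Real.exp_pos _).le)
        · rw [indicator_of_notMem ht']
      · rw [indicator_of_notMem (by exact ht)]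
    filter_upwards [measure_eq_zero_iff_ae_notMem.1 hA0] with r hrA
    by_contra! hcon
    obtain ⟨h1, h2⟩ := hcon
    exact hrA ⟨h1, fun h => not_lt.2 (h2 he h1 h.1) h.2⟩
  · rw [timeKernel_of_bad hβ he, ae_dirac_iff]
    · exact Or.inl rfl
    · have hr : Measurable (M.rateAlong β e.2) :=
        (measurable_rateAlong hβ).of_uncurry_left (f := M.rateAlong β)
      simp [he]

/-- The exponential moment by which jumps are counted. -/
def discount (M : Model K) (r : ℝ≥0∞) : ℝ≥0∞ :=
  ({⊤}ᶜ : Set ℝ≥0∞).indicator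
    (fun r => ENNReal.ofReal (Real.exp (-(2 * (M.killBound + 1)) * r.toReal))) r

theorem measurable_discount (M : Model K) : Measurable M.discount :=
  (ENNReal.measurable_toReal.const_mul _).exp.ennreal_ofReal.indicator
    (measurableSet_singleton ⊤).compl

/-- With `a = 2 (killBound + 1)` the density is at most `a / 2`, and `∫_s^∞ (a / 2) exp (-a t) dt =
exp (-a s) / 2`. The summand `1` keeps `a` positive when the bound is zero. -/
theorem lintegral_discount_timeKernel_le (hM : M.RegularJumps) (hβ : M.IsPolicy β) (e : Mark K) :
    ∫⁻ r, M.discount r ∂(M.timeKernel β e) ≤ 2⁻¹ * M.discount e.1 := by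
  rw [lintegral_timeKernel hβ e M.measurable_discount]
  have htop : M.discount ⊤ = 0 := indicator_of_notMem (by simp) _
  rw [htop, mul_zero, add_zero]
  by_cases he : e ∈ M.goodMark
  · have hy := he.1
    set a := 2 * (M.killBound + 1) with ha
    have hk := killBound_nonneg hM
    have ha0 : 0 < a := by positivity
    have hfin : ∀ t, M.discount (ENNReal.ofReal t)
        = ENNReal.ofReal (Real.exp (-a * (ENNReal.ofReal t).toReal)) := fun t =>
      indicator_of_mem (show ENNReal.ofReal t ∈ ({⊤}ᶜ : Set ℝ≥0∞) from ENNReal.ofReal_ne_top) _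
    have he1 : M.discount e.1 = ENNReal.ofReal (Real.exp (-a * e.2.1)) := by
      rw [he.2, hfin, ENNReal.toReal_ofReal hy.1.1]
    have hle : ∀ t, M.timeDens β e t * M.discount (ENNReal.ofReal t) ≤
        (Ioi e.2.1).indicator (fun t => ENNReal.ofReal (a / 2 * Real.exp (-a * t))) t := by
      intro t
      rw [timeDens_of_good he]
      by_cases ht : t ∈ Ioc e.2.1 M.T
      · rw [indicator_of_mem ht, indicator_of_mem (by exact ht.1), hfin,
          ENNReal.toReal_ofReal (hy.1.1.trans ht.1.le), ← ENNReal.ofReal_mul' (Real.exp_pos _).le]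
        refine ENNReal.ofReal_le_ofReal (mul_le_mul_of_nonneg_right ?_ (Real.exp_pos _).le)
        have hu : t - e.2.1 ∈ Icc 0 (M.T - e.2.1) :=
          ⟨sub_nonneg.2 ht.1.le, sub_le_sub_right ht.2 _⟩
        have h1 := rateAlong_mem hM hβ hy hu
        have h2 := cumAlong_mono hM hβ hy le_rfl hu.1 hu.2
        rw [cumAlong_zero] at h2
        refine (mul_le_of_le_one_right h1.1 (Real.exp_le_one_iff.2 (neg_nonpos.2 h2))).trans ?_
        rw [ha]
        linarith [h1.2]
      · rw [indicator_of_notMem ht, zero_mul]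
        exact zero_le
    refine (lintegral_mono hle).trans ?_
    rw [lintegral_indicator measurableSet_Ioi, he1]
    have hint : IntegrableOn (fun t => a / 2 * Real.exp (-a * t)) (Ioi e.2.1) :=
      (integrableOn_exp_mul_Ioi (neg_lt_zero.2 ha0) _).const_mul _
    rw [← ofReal_integral_eq_lintegral_ofReal hint
      (ae_of_all _ fun t => by positivity), integral_const_mul,
      integral_exp_mul_Ioi (neg_lt_zero.2 ha0)]
    have : (2⁻¹ : ℝ≥0∞) = ENNReal.ofReal 2⁻¹ := by
      rw [ENNReal.ofReal_inv_of_pos two_pos, ENNReal.ofReal_ofNat]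
    rw [this, ← ENNReal.ofReal_mul (by norm_num)]
    refine ENNReal.ofReal_le_ofReal (le_of_eq ?_)
    field_simp
  · simp [timeDens_of_bad he]

end Model

namespace Model

variable {M : Model K} {β : State K → ℝ → ℝ}

/-! ### The law of the state at the next jump -/

theorem measurable_jumpTo_right (x : State K) (ν : ℝ) : Measurable (M.jumpTo x ν) :=
  (M.measurable_jumpTo.comp ((measurable_const (a := (x, ν))).prodMk measurable_id) :)

/-- The jump kernel in terms of the reference measure. -/
theorem jumpKernel_apply {x : State K} (hx : x ∈ M.stateSpace) {ν : ℝ} (hν : 0 ≤ ν)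
    {A : Set (State K)} (hA : MeasurableSet A) :
    M.jumpKernel x ν A = (ENNReal.ofReal (M.jumpRate x ν))⁻¹ *
      ∑ j, ENNReal.ofReal (x.2.2.2 j) *
        ∫⁻ z, A.indicator 1 (M.jumpTo x ν z) * ENNReal.ofReal (M.dens x.1 j ν z) ∂M.ηQ := by
  rw [jumpKernel, Measure.smul_apply, jumpKernelBar, Measure.finsetSum_apply, smul_eq_mul]
  congr 1
  refine Finset.sum_congr rfl fun j _ => ?_
  have hpre := measurable_jumpTo_right (M := M) x ν hA
  rw [Measure.smul_apply, smul_eq_mul, Measure.map_apply (measurable_jumpTo_right x ν) hA,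
    M.ηP_eq _ hx.1 j ν hν, withDensity_apply _ hpre, ← lintegral_indicator hpre]
  congr 1
  refine lintegral_congr fun z => ?_
  by_cases hz : M.jumpTo x ν z ∈ A
  · rw [indicator_of_mem (by exact hz), indicator_of_mem hz, Pi.one_apply, one_mul]
  · rw [indicator_of_notMem (by exact hz), indicator_of_notMem hz, zero_mul]

/-- The total mass of the unnormalized kernel is the jump rate. Normalization is possible only where
the rate is positive, which is why good jumps require this. -/
theorem jumpKernel_univ (hM : M.RegularJumps) {x : State K} (hx : x ∈ M.stateSpace) {ν : ℝ}
    (hν : ν ∈ Icc 0 M.νmax) (hpos : 0 < M.jumpRate x ν) : M.jumpKernel x ν univ = 1 := by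
  rw [jumpKernel, Measure.smul_apply, jumpKernelBar, Measure.finsetSum_apply, smul_eq_mul]
  have e : ∑ j, (ENNReal.ofReal (x.2.2.2 j) • (M.ηP x.1 j ν).map (M.jumpTo x ν)) univ
      = ENNReal.ofReal (M.jumpRate x ν) := by
    rw [jumpRate_eq hM hx hν, ENNReal.ofReal_sum_of_nonneg fun j _ =>
      mul_nonneg (hx.2.2.2.1 j) (kill_mem hM _ _ j).1]
    refine Finset.sum_congr rfl fun j _ => ?_
    rw [Measure.smul_apply, smul_eq_mul, Measure.map_apply (measurable_jumpTo_right x ν)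
      MeasurableSet.univ, preimage_univ, ηP_univ hM hx.1 hν, ENNReal.ofReal_mul (hx.2.2.2.1 j)]
  rw [e]
  exact ENNReal.inv_mul_cancel (ENNReal.ofReal_pos.2 hpos).ne' ENNReal.ofReal_ne_top

theorem ae_jumpKernel (hM : M.RegularJumps) {x : State K} (hx : x ∈ M.stateSpace) {ν : ℝ}
    (hν : ν ∈ Icc 0 M.νmax) : ∀ᵐ y ∂(M.jumpKernel x ν), y ∈ M.stateSpace ∧ y.1 = x.1 := by
  have hA : MeasurableSet {y : State K | y ∈ M.stateSpace ∧ y.1 = x.1}ᶜ :=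
    (M.measurableSet_stateSpace.inter (measurableSet_eq_fun measurable_fst measurable_const)).compl
  refine ae_iff.2 ((jumpKernel_apply hx hν.1 hA).trans ?_)
  rw [Finset.sum_eq_zero, mul_zero]
  intro j _
  refine mul_eq_zero_of_right _ ((lintegral_congr_ae ?_).trans lintegral_zero)
  filter_upwards [M.ae_mem_support] with z hz
  have hz' : M.jumpTo x ν z ∈ {y : State K | y ∈ M.stateSpace ∧ y.1 = x.1} :=
    ⟨jumpTo_mem hM hx hν hz, rfl⟩
  rw [indicator_of_notMem (notMem_compl_iff.2 hz'), zero_mul]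

/-- The state and the selling rate immediately before a jump. -/
def preJump (M : Model K) (β : State K → ℝ → ℝ) (p : Mark K × ℝ≥0∞) : State K × ℝ :=
  (M.flowSol β p.1.2 (p.2.toReal - p.1.2.1), M.polRate β p.1.2 (p.2.toReal - p.1.2.1))

theorem measurable_elapsed :
    Measurable fun p : Mark K × ℝ≥0∞ => (p.1.2, p.2.toReal - p.1.2.1) :=
  (measurable_fst.snd).prodMk
    ((ENNReal.measurable_toReal.comp measurable_snd).sub measurable_fst.snd.fst)

theorem measurable_preJump (hβ : M.IsPolicy β) : Measurable (M.preJump β) :=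
  ((measurable_flowSol hβ).comp measurable_elapsed :).prodMk
    ((measurable_polRate hβ).comp measurable_elapsed :)

theorem preJump_rate_mem (p : Mark K × ℝ≥0∞) : (M.preJump β p).2 ∈ Icc 0 M.νmax := polRate_mem _ _

/-- The marks and next jump times at which the jump kernel is a probability measure. -/
def goodJump (M : Model K) (β : State K → ℝ → ℝ) : Set (Mark K × ℝ≥0∞) :=
  {p | p.2 ≠ ⊤ ∧ (M.preJump β p).1 ∈ M.stateSpace ∧
    0 < M.rateAlong β p.1.2 (p.2.toReal - p.1.2.1)}

theorem measurableSet_goodJump (hβ : M.IsPolicy β) : MeasurableSet (M.goodJump β) := by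
  have h : Measurable fun p : Mark K × ℝ≥0∞ => M.rateAlong β p.1.2 (p.2.toReal - p.1.2.1) :=
    ((measurable_rateAlong hβ).comp measurable_elapsed :)
  exact ((measurableSet_singleton ⊤).compl.preimage measurable_snd).inter
    ((M.measurableSet_stateSpace.preimage (measurable_preJump hβ).fst).inter
      (measurableSet_lt measurable_const h))

theorem jumpRate_preJump (hM : M.RegularJumps) {p : Mark K × ℝ≥0∞}
    (hp : (M.preJump β p).1 ∈ M.stateSpace) :
    M.jumpRate (M.preJump β p).1 (M.preJump β p).2
      = M.rateAlong β p.1.2 (p.2.toReal - p.1.2.1) :=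
  jumpRate_eq hM hp (polRate_mem _ _)

open Classical in
/-- The law of the state at the next jump, given the next jump time. -/
def stateKernel (hM : M.RegularJumps) (hβ : M.IsPolicy β) (x0 : State K) :
    Kernel (Mark K × ℝ≥0∞) (State K) where
  toFun p := if p ∈ M.goodJump β then M.jumpKernel (M.preJump β p).1 (M.preJump β p).2
    else Measure.dirac x0
  measurable' := by
    refine Measure.measurable_of_measurable_coe _ fun A hA => ?_
    have hrate : Measurable fun p : Mark K × ℝ≥0∞ =>
        M.rateAlong β p.1.2 (p.2.toReal - p.1.2.1) :=
      ((measurable_rateAlong hβ).comp measurable_elapsed :)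
    have hpre := measurable_preJump hβ
    have hjump : Measurable fun q : (Mark K × ℝ≥0∞) × ℝ =>
        M.jumpTo (M.preJump β q.1).1 (M.preJump β q.1).2 q.2 :=
      (M.measurable_jumpTo.comp ((hpre.comp measurable_fst).prodMk measurable_snd) :)
    have hdens : ∀ j, Measurable fun q : (Mark K × ℝ≥0∞) × ℝ =>
        ENNReal.ofReal (M.dens (M.preJump β q.1).1.1 j (M.preJump β q.1).2 q.2) := fun j =>
      (((M.dens_measurable j).comp (((hpre.comp measurable_fst).fst.fst).prodMk
        ((hpre.comp measurable_fst).snd.prodMk measurable_snd)) :)).ennreal_ofReal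
    have hint : ∀ j, Measurable fun p : Mark K × ℝ≥0∞ =>
        ∫⁻ z, A.indicator 1 (M.jumpTo (M.preJump β p).1 (M.preJump β p).2 z) *
          ENNReal.ofReal (M.dens (M.preJump β p).1.1 j (M.preJump β p).2 z) ∂M.ηQ := fun j =>
      Measurable.lintegral_prod_right' (ν := M.ηQ)
        (f := fun q : (Mark K × ℝ≥0∞) × ℝ =>
          A.indicator 1 (M.jumpTo (M.preJump β q.1).1 (M.preJump β q.1).2 q.2) *
            ENNReal.ofReal (M.dens (M.preJump β q.1).1.1 j (M.preJump β q.1).2 q.2))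
        (((measurable_one.indicator hA).comp hjump).mul (hdens j))
    have hπ : ∀ j, Measurable fun p : Mark K × ℝ≥0∞ =>
        ENNReal.ofReal ((M.preJump β p).1.2.2.2 j) := fun j =>
      (measurable_pi_iff.1 hpre.fst.snd.snd.snd j).ennreal_ofReal
    -- On good jumps the normalization is `rateAlong`, and integrals against `ηP` are integrals
    -- against the fixed measure `ηQ` with a jointly measurable density. Both are measurable in the
    -- mark and the jump time.
    have hmeas : Measurable fun p : Mark K × ℝ≥0∞ => if p ∈ M.goodJump β then
        (ENNReal.ofReal (M.rateAlong β p.1.2 (p.2.toReal - p.1.2.1)))⁻¹ *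
          ∑ j, ENNReal.ofReal ((M.preJump β p).1.2.2.2 j) *
            ∫⁻ z, A.indicator 1 (M.jumpTo (M.preJump β p).1 (M.preJump β p).2 z) *
              ENNReal.ofReal (M.dens (M.preJump β p).1.1 j (M.preJump β p).2 z) ∂M.ηQ
        else Measure.dirac x0 A :=
      Measurable.ite (measurableSet_goodJump hβ) (hrate.ennreal_ofReal.inv.mul
        (Finset.measurable_fun_sum _ fun j _ => (hπ j).mul (hint j))) measurable_const
    refine (congrArg Measurable (funext fun p => ?_)).mpr hmeas
    by_cases hp : p ∈ M.goodJump β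
    · rw [if_pos hp, if_pos hp, jumpKernel_apply hp.2.1 (preJump_rate_mem p).1 hA,
        jumpRate_preJump hM hp.2.1]
    · rw [if_neg hp, if_neg hp]

theorem stateKernel_of_good (hM : M.RegularJumps) (hβ : M.IsPolicy β) (x0 : State K)
    {p : Mark K × ℝ≥0∞} (hp : p ∈ M.goodJump β) :
    stateKernel hM hβ x0 p = M.jumpKernel (M.preJump β p).1 (M.preJump β p).2 := if_pos hp

theorem stateKernel_top (hM : M.RegularJumps) (hβ : M.IsPolicy β) (x0 : State K) (e : Mark K) :
    stateKernel hM hβ x0 (e, ⊤) = Measure.dirac x0 := if_neg fun h => h.1 rfl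

instance isMarkovKernel_stateKernel (hM : M.RegularJumps) (hβ : M.IsPolicy β) (x0 : State K) :
    IsMarkovKernel (stateKernel hM hβ x0) := by
  refine ⟨fun p => ?_⟩
  by_cases hp : p ∈ M.goodJump β
  · rw [stateKernel_of_good hM hβ x0 hp]
    exact ⟨jumpKernel_univ hM hp.2.1 (preJump_rate_mem p)
        (by rw [jumpRate_preJump hM hp.2.1]; exact hp.2.2)⟩
  · have : stateKernel hM hβ x0 p = Measure.dirac x0 := if_neg hp
    rw [this]
    infer_instance

theorem goodJump_of_good (hM : M.RegularJumps) (hβ : M.IsPolicy β) {e : Mark K}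
    (he : e ∈ M.goodMark) {r : ℝ≥0∞} (hr : r ≠ ⊤) (hr' : r.toReal ∈ Ioc e.2.1 M.T)
    (hpos : 0 < M.rateAlong β e.2 (r.toReal - e.2.1)) : (e, r) ∈ M.goodJump β :=
  ⟨hr, flowSol_mem hM hβ he.1 ⟨sub_nonneg.2 hr'.1.le, sub_le_sub_right hr'.2 _⟩, hpos⟩

/-! ### The chain of the marks -/

/-- The last mark of a history. -/
def lastMark (n : ℕ) (h : Finset.Iic n → Mark K) : Mark K := h ⟨n, Finset.mem_Iic.2 le_rfl⟩

theorem measurable_lastMark (n : ℕ) : Measurable (lastMark (K := K) n) := measurable_pi_apply _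

/-- The law of the next jump time given the history. -/
def histTime (M : Model K) (β : State K → ℝ → ℝ) (n : ℕ) :
    Kernel (Finset.Iic n → Mark K) ℝ≥0∞ :=
  (M.timeKernel β).comap (lastMark n) (measurable_lastMark n)

/-- The law of the next state given the history and the next jump time. -/
def histState (hM : M.RegularJumps) (hβ : M.IsPolicy β) (x0 : State K) (n : ℕ) :
    Kernel ((Finset.Iic n → Mark K) × ℝ≥0∞) (State K) :=
  (stateKernel hM hβ x0).comap (fun p => (lastMark n p.1, p.2))
    (((measurable_lastMark n).comp measurable_fst).prodMk measurable_snd)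

/-- The law of the next mark given the history. -/
def histKernel (hM : M.RegularJumps) (hβ : M.IsPolicy β) (x0 : State K) (n : ℕ) :
    Kernel (Finset.Iic n → Mark K) (Mark K) :=
  histTime M β n ⊗ₖ histState hM hβ x0 n

theorem isMarkovKernel_histTime (hM : M.RegularJumps) (hβ : M.IsPolicy β) (n : ℕ) :
    IsMarkovKernel (histTime M β n) :=
  have := isMarkovKernel_timeKernel hM hβ
  Kernel.IsMarkovKernel.comap _ _

instance isMarkovKernel_histState (hM : M.RegularJumps) (hβ : M.IsPolicy β) (x0 : State K)
    (n : ℕ) : IsMarkovKernel (histState hM hβ x0 n) := Kernel.IsMarkovKernel.comap _ _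

instance isMarkovKernel_histKernel (hM : M.RegularJumps) (hβ : M.IsPolicy β) (x0 : State K)
    (n : ℕ) : IsMarkovKernel (histKernel hM hβ x0 n) :=
  have := isMarkovKernel_histTime hM hβ n
  inferInstanceAs (IsMarkovKernel (histTime M β n ⊗ₖ histState hM hβ x0 n))

/-- The possible transitions of the chain of the marks. -/
def markStep (M : Model K) : Set (Mark K × Mark K) :=
  {p | p.2.1 = ⊤ ∨ (p.1 ∈ M.goodMark ∧ p.2 ∈ M.goodMark ∧ p.1.1 < p.2.1)}

theorem measurableSet_markStep (M : Model K) : MeasurableSet M.markStep :=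
  ((measurableSet_singleton ⊤).preimage measurable_snd.fst).union
    ((M.measurableSet_goodMark.preimage measurable_fst).inter
      ((M.measurableSet_goodMark.preimage measurable_snd).inter
        (measurableSet_lt measurable_fst.fst measurable_snd.fst)))

theorem ae_histKernel (hM : M.RegularJumps) (hβ : M.IsPolicy β) (x0 : State K) (n : ℕ)
    (h : Finset.Iic n → Mark K) :
    ∀ᵐ e ∂(histKernel hM hβ x0 n h), (lastMark n h, e) ∈ M.markStep := by
  have := isMarkovKernel_histTime hM hβ n
  refine Kernel.ae_compProd_of_ae_ae (p := fun e => (lastMark n h, e) ∈ M.markStep)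
    (M.measurableSet_markStep.preimage measurable_prodMk_left) ?_
  have h1 := ae_timeKernel hβ (lastMark n h)
  change ∀ᵐ r ∂(M.timeKernel β (lastMark n h)), _
  filter_upwards [h1] with r hr
  rcases hr with rfl | ⟨he, hr, hr', hpos⟩
  · exact ae_of_all _ fun _ => Or.inl rfl
  · have hg := goodJump_of_good hM hβ he hr hr' hpos
    have e1 : histState hM hβ x0 n (h, r) = M.jumpKernel _ _ := stateKernel_of_good hM hβ x0 hg
    rw [e1]
    filter_upwards [ae_jumpKernel hM hg.2.1 (preJump_rate_mem _)] with y hy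
    have hy1 : y.1 = r.toReal := by
      rw [hy.2]
      exact add_sub_cancel _ _
    refine Or.inr ⟨he, ⟨hy.1, ?_⟩, ?_⟩
    · change r = ENNReal.ofReal y.1
      rw [hy1, ENNReal.ofReal_toReal hr]
    · change (lastMark n h).1 < r
      rw [he.2, ENNReal.ofReal_lt_iff_lt_toReal he.1.1.1 hr]
      exact hr'.1

end Model

/-! ### The process built from the chain of marks. -/

namespace Model

variable {M : Model K} {β : State K → ℝ → ℝ} {ν : ℕ → State K → ℝ → ℝ} {x : State K}

/-- The possible next jump times. -/
def timeStep (M : Model K) (β : State K → ℝ → ℝ) : Set (Mark K × ℝ≥0∞) :=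
  {p | p.2 = ⊤ ∨ (p.1 ∈ M.goodMark ∧ p.2.toReal ∈ Ioc p.1.2.1 M.T ∧ p ∈ M.goodJump β)}

theorem measurableSet_timeStep (hβ : M.IsPolicy β) : MeasurableSet (M.timeStep β) :=
  ((measurableSet_singleton ⊤).preimage measurable_snd).union
    ((M.measurableSet_goodMark.preimage measurable_fst).inter
      (((measurableSet_lt measurable_fst.snd.fst measurable_snd.ennreal_toReal).inter
        (measurableSet_le measurable_snd.ennreal_toReal measurable_const)).inter
        (measurableSet_goodJump hβ)))

theorem ae_timeKernel_timeStep (hM : M.RegularJumps) (hβ : M.IsPolicy β) (e : Mark K) :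
    ∀ᵐ r ∂(M.timeKernel β e), (e, r) ∈ M.timeStep β := by
  filter_upwards [ae_timeKernel hβ e] with r hr
  rcases hr with hr | ⟨he, hr, hr', hpos⟩
  · exact Or.inl hr
  · exact Or.inr ⟨he, hr', goodJump_of_good hM hβ he hr hr' hpos⟩

theorem ae_timeStep (hM : M.RegularJumps) (hβ : M.IsPolicy β) {n : ℕ}
    {μ : Measure (Finset.Iic n → Mark K)} [SFinite μ] :
    ∀ᵐ p ∂(μ ⊗ₘ histTime M β n), (lastMark n p.1, p.2) ∈ M.timeStep β :=
  have := isMarkovKernel_histTime hM hβ n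
  Measure.ae_compProd_of_ae_ae ((measurableSet_timeStep hβ).preimage
    (((measurable_lastMark n).comp measurable_fst).prodMk measurable_snd))
    (ae_of_all _ fun h => ae_timeKernel_timeStep hM hβ (lastMark n h))

/-- The sequences of the marks of the process. -/
structure IsMarkPath (M : Model K) (x : State K) (s : ℕ → Mark K) : Prop where
  initial : s 0 = (ENNReal.ofReal x.1, x)
  step : ∀ n, (s n, s (n + 1)) ∈ M.markStep

theorem IsMarkPath.good (hx : x ∈ M.stateSpace) {s : ℕ → Mark K} (hs : M.IsMarkPath x s) {n : ℕ}
    (hn : (s n).1 ≠ ⊤) : s n ∈ M.goodMark := by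
  cases n with
  | zero => rw [hs.initial]; exact ⟨hx, rfl⟩
  | succ n => exact ((hs.step n).resolve_left hn).2.1

theorem IsMarkPath.increasing {s : ℕ → Mark K} (hs : M.IsMarkPath x s) (n : ℕ) :
    ((s n).1 < ⊤ → (s n).1 < (s (n + 1)).1) ∧ ((s n).1 = ⊤ → (s (n + 1)).1 = ⊤) := by
  rcases hs.step n with h | h
  · exact ⟨fun hlt => hlt.trans_eq (Eq.symm h), fun _ => h⟩
  · refine ⟨fun _ => h.2.2, fun htop => ?_⟩
    have := h.1.2
    rw [htop] at this
    exact absurd this ENNReal.ofReal_ne_top.symm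

theorem IsMarkPath.monotone {s : ℕ → Mark K} (hs : M.IsMarkPath x s) : Monotone fun n => (s n).1 :=
  monotone_nat_of_le_succ fun n => by
    rcases eq_or_ne (s n).1 ⊤ with h | h
    · rw [h, (hs.increasing n).2 h]
    · exact ((hs.increasing n).1 (lt_top_iff_ne_top.2 h)).le

/-- The state at time `t` for a given sequence of marks. -/
def chainState (M : Model K) (ν : ℕ → State K → ℝ → ℝ) (s : ℕ → Mark K) (t : ℝ) : State K :=
  M.flowSol (ν (segIdx (fun n => (s n).1) t)) (s (segIdx (fun n => (s n).1) t)).2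
    (t - (s (segIdx (fun n => (s n).1) t)).2.1)

theorem measurable_chainState (hν : M.IsAdmissible ν) (t : ℝ) :
    Measurable fun s => M.chainState ν s t := by
  have hc : ∀ n, Measurable fun s : ℕ → Mark K => s n := measurable_pi_apply
  refine measurable_comp_nat
    (f := fun m (s : ℕ → Mark K) => M.flowSol (ν m) (s m).2 (t - (s m).2.1)) (fun m => ?_)
    (measurable_segIdx (τ := fun n (s : ℕ → Mark K) => (s n).1) (fun n => (hc n).fst) t)
  exact ((measurable_flowSol (hν.isPolicy m)).comp
      ((hc m).snd.prodMk ((hc m).snd.fst.const_sub t)) :)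

theorem chainState_eq (hM : M.RegularJumps) (hν : M.IsAdmissible ν) (hx : x ∈ M.stateSpace)
    {s : ℕ → Mark K} (hs : M.IsMarkPath x s) {n : ℕ} {t : ℝ} (h0 : 0 ≤ t) (ht : t ≤ M.T)
    (h1 : (s n).1 ≤ ENNReal.ofReal t) (h2 : ENNReal.ofReal t < (s (n + 1)).1) :
    M.chainState ν s t = M.flow (ν n (s n).2) (s n).2 (t - (s n).2.1) := by
  have hne : (s n).1 ≠ ⊤ := (h1.trans_lt ENNReal.ofReal_lt_top).ne
  have hg := hs.good hx hne
  rw [chainState, segIdx_eq (τ := fun n => (s n).1) hs.monotone h1 h2]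
  rw [hg.2, ENNReal.ofReal_le_ofReal_iff h0] at h1
  exact (flow_eq hM (hν.isPolicy n) hg.1 ⟨sub_nonneg.2 h1, sub_le_sub_right ht _⟩).symm

/-- The law of the chain of the marks. -/
def chainLaw (hM : M.RegularJumps) (hν : M.IsAdmissible ν) (x : State K) : Measure (ℕ → Mark K) :=
  Kernel.trajMeasure (X := fun _ => Mark K) (Measure.dirac (ENNReal.ofReal x.1, x))
    fun n => histKernel hM (hν.isPolicy n) x n

instance (hM : M.RegularJumps) (hν : M.IsAdmissible ν) (x : State K) :
    IsProbabilityMeasure (chainLaw hM hν x) := by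
  unfold chainLaw
  infer_instance

/-- The history of a sequence of marks. -/
def hist (n : ℕ) (s : ℕ → Mark K) : Finset.Iic n → Mark K := fun k => s k

theorem measurable_hist (n : ℕ) : Measurable (hist (K := K) n) :=
  measurable_pi_lambda _ fun _ => measurable_pi_apply _

/-- The defining property of the Ionescu-Tulcea measure. It is the only information about the
transitions that is used later. -/
theorem chainLaw_step (hM : M.RegularJumps) (hν : M.IsAdmissible ν) (x : State K) (n : ℕ) :
    (chainLaw hM hν x).map (fun s => (hist n s, s (n + 1)))
      = (chainLaw hM hν x).map (hist n) ⊗ₘ histKernel hM (hν.isPolicy n) x n :=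
  (Kernel.map_frestrictLe_trajMeasure_compProd_eq_map_trajMeasure (X := fun _ => Mark K)
    (κ := fun n => histKernel hM (hν.isPolicy n) x n) (a := n)).symm

theorem chainLaw_initial (hM : M.RegularJumps) (hν : M.IsAdmissible ν) (x : State K) :
    ∀ᵐ s ∂(chainLaw hM hν x), s 0 = (ENNReal.ofReal x.1, x) := by
  have h : (chainLaw hM hν x).map (Preorder.frestrictLe (π := fun _ => Mark K) 0)
      = (Measure.dirac (ENNReal.ofReal x.1, x)).map
        (MeasurableEquiv.piUnique fun _ : Finset.Iic 0 => Mark K).symm := by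
    rw [chainLaw, Kernel.trajMeasure, Measure.map_comp _ _ (by fun_prop),
      Kernel.traj_map_frestrictLe, Kernel.partialTraj_self, Measure.id_comp]
  replace h := h.trans (Measure.map_dirac' (MeasurableEquiv.measurable _) _)
  have h2 : (chainLaw hM hν x).map (fun s => s 0) = Measure.dirac (ENNReal.ofReal x.1, x) := by
    have e : (fun s : ℕ → Mark K => s 0)
        = (fun f : Finset.Iic 0 → Mark K => f ⟨0, by simp⟩) ∘ Preorder.frestrictLe 0 := rfl
    rw [e, ← Measure.map_map (measurable_pi_apply _) (by fun_prop), h,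
      Measure.map_dirac' (measurable_pi_apply _)]
    rfl
  have h3 : ∀ᵐ e ∂((chainLaw hM hν x).map (fun s => s 0)), e = (ENNReal.ofReal x.1, x) := by
    rw [h2, ae_dirac_eq]
    exact rfl
  exact ae_of_ae_map (measurable_pi_apply 0).aemeasurable h3

section Step

variable {Ω : Type*} [MeasurableSpace Ω] {P : Measure Ω} [IsFiniteMeasure P] {n : ℕ}
  {V : Ω → Finset.Iic n → Mark K} {E : Ω → Mark K}

theorem map_time_of_step (hM : M.RegularJumps) (hβ : M.IsPolicy β) (hV : Measurable V)
    (hE : Measurable E)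
    (h : P.map (fun ω => (V ω, E ω)) = P.map V ⊗ₘ histKernel hM hβ x n) :
    P.map (fun ω => (V ω, (E ω).1)) = P.map V ⊗ₘ histTime M β n := by
  have := isMarkovKernel_histTime hM hβ n
  have e := congrArg (Measure.map (Prod.map id Prod.fst)) h
  rw [Measure.map_map (measurable_id.prodMap measurable_fst) (hV.prodMk hE),
    ← Measure.compProd_map measurable_fst] at e
  rw [show (fun ω => (V ω, (E ω).1)) = Prod.map id Prod.fst ∘ fun ω => (V ω, E ω) from rfl, e,
    histKernel, ← Kernel.fst_eq, Kernel.fst_compProd]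

theorem map_state_of_step (hM : M.RegularJumps) (hβ : M.IsPolicy β) (hV : Measurable V)
    (hE : Measurable E)
    (h : P.map (fun ω => (V ω, E ω)) = P.map V ⊗ₘ histKernel hM hβ x n) :
    P.map (fun ω => ((V ω, (E ω).1), (E ω).2))
      = P.map (fun ω => (V ω, (E ω).1)) ⊗ₘ histState hM hβ x n := by
  rw [map_time_of_step hM hβ hV hE h, ← Measure.compProd_assoc, ← histKernel, ← h,
    Measure.map_map (MeasurableEquiv.measurable _) (hV.prodMk hE)]
  rfl

end Step

theorem ae_isMarkPath (hM : M.RegularJumps) (hν : M.IsAdmissible ν) (x : State K) :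
    ∀ᵐ s ∂(chainLaw hM hν x), M.IsMarkPath x s := by
  have hstep : ∀ n, ∀ᵐ s ∂(chainLaw hM hν x), (s n, s (n + 1)) ∈ M.markStep := by
    intro n
    have h : ∀ᵐ p ∂((chainLaw hM hν x).map (fun s => (hist n s, s (n + 1)))),
        (lastMark n p.1, p.2) ∈ M.markStep := by
      rw [chainLaw_step]
      exact Measure.ae_compProd_of_ae_ae (M.measurableSet_markStep.preimage
        (((measurable_lastMark n).comp measurable_fst).prodMk measurable_snd))
        (ae_of_all _ fun h => ae_histKernel hM (hν.isPolicy n) x n h)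
    exact ae_of_ae_map ((measurable_hist n).prodMk (measurable_pi_apply _)).aemeasurable h
  filter_upwards [chainLaw_initial hM hν x, ae_all_iff.2 hstep] with s h0 h using ⟨h0, h⟩

/-- The expected discount of the `n`-th jump time is at most `2⁻¹ ^ n`. On the event of infinitely
many jumps, every jump time is at most `T`, so the discount is bounded below by a positive constant
and the event has probability zero. -/
theorem chainLaw_nonexplosive (hM : M.RegularJumps) (hν : M.IsAdmissible ν)
    (hx : x ∈ M.stateSpace) : ∀ᵐ s ∂(chainLaw hM hν x), ∃ n, (s n).1 = ⊤ := by
  set P := chainLaw hM hν x with hP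
  have hk := killBound_nonneg hM
  have hdle : ∀ r, M.discount r ≤ 1 := fun r => by
    by_cases hr : r = ⊤
    · rw [hr]
      exact (indicator_of_notMem (by simp) _).trans_le zero_le_one
    · refine (indicator_of_mem (show r ∈ ({⊤}ᶜ : Set ℝ≥0∞) from hr) _).trans_le ?_
      refine ENNReal.ofReal_le_one.2 (Real.exp_le_one_iff.2 ?_)
      have : 0 ≤ r.toReal := ENNReal.toReal_nonneg
      nlinarith
  have hE : ∀ n, ∫⁻ s, M.discount (s n).1 ∂P ≤ 2⁻¹ ^ n := by
    intro n
    induction n with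
    | zero =>
      rw [pow_zero]
      refine (lintegral_mono fun s => hdle _).trans ?_
      rw [lintegral_const, measure_univ, one_mul]
    | succ n ih =>
      have := isMarkovKernel_histTime hM (hν.isPolicy n) n
      have ht := map_time_of_step hM (hν.isPolicy n) (P := P) (measurable_hist n)
        (measurable_pi_apply (n + 1)) (chainLaw_step hM hν x n)
      calc ∫⁻ s, M.discount (s (n + 1)).1 ∂P
          = ∫⁻ p, M.discount p.2 ∂(P.map fun s => (hist n s, (s (n + 1)).1)) :=
            (lintegral_map (M.measurable_discount.comp measurable_snd)
              ((measurable_hist n).prodMk (measurable_pi_apply (n + 1)).fst)).symm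
        _ = ∫⁻ h, ∫⁻ r, M.discount r ∂(M.timeKernel (ν n) (lastMark n h)) ∂(P.map (hist n)) := by
            rw [ht, Measure.lintegral_compProd (f := fun p => M.discount p.2)
                (M.measurable_discount.comp measurable_snd)]
            rfl
        _ ≤ ∫⁻ h, 2⁻¹ * M.discount (lastMark n h).1 ∂(P.map (hist n)) :=
            lintegral_mono fun h => lintegral_discount_timeKernel_le hM (hν.isPolicy n) _
        _ = 2⁻¹ * ∫⁻ s, M.discount (s n).1 ∂P := by
            rw [lintegral_const_mul (f := fun h => M.discount (lastMark n h).1) _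
              (M.measurable_discount.comp (measurable_lastMark n).fst),
              lintegral_map (f := fun h => M.discount (lastMark n h).1)
                  (M.measurable_discount.comp (measurable_lastMark n).fst)
                (measurable_hist n)]
            rfl
        _ ≤ 2⁻¹ ^ (n + 1) := by
            rw [pow_succ']
            gcongr
  set A : Set (ℕ → Mark K) := {s | ∀ n, (s n).1 ≠ ⊤} with hA
  have hAm : MeasurableSet A := by
    have : A = ⋂ n, {s | (s n).1 ≠ ⊤} := by ext; simp [hA]
    rw [this]
    exact MeasurableSet.iInter fun n =>
      (measurableSet_singleton ⊤).compl.preimage (measurable_pi_apply n).fst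
  set c : ℝ≥0∞ := ENNReal.ofReal (Real.exp (-(2 * (M.killBound + 1)) * M.T)) with hc
  have hle : ∀ n, c * P A ≤ 2⁻¹ ^ n := by
    intro n
    refine le_trans ?_ (hE n)
    rw [← lintegral_indicator_const hAm]
    refine lintegral_mono_ae ?_
    filter_upwards [ae_isMarkPath hM hν x] with s hs
    by_cases hsA : s ∈ A
    · rw [indicator_of_mem hsA]
      have hg := hs.good hx (hsA n)
      refine le_trans ?_ (indicator_of_mem (show (s n).1 ∈ ({⊤}ᶜ : Set ℝ≥0∞) from hsA n) _).ge
      refine ENNReal.ofReal_le_ofReal (Real.exp_le_exp.2 ?_)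
      have : (s n).1.toReal ≤ M.T := by
        rw [hg.2, ENNReal.toReal_ofReal hg.1.1.1]
        exact hg.1.1.2
      nlinarith
    · rw [indicator_of_notMem hsA]
      exact zero_le
  have h0 : c * P A ≤ 0 := ge_of_tendsto'
    (ENNReal.tendsto_pow_atTop_nhds_zero_of_lt_one ENNReal.one_half_lt_one) fun n => hle n
  have hPA : P A = 0 := by
    rcases mul_eq_zero.1 (nonpos_iff_eq_zero.1 h0) with h | h
    · exact absurd h (ENNReal.ofReal_pos.2 (Real.exp_pos _)).ne'
    · exact h
  filter_upwards [measure_eq_zero_iff_ae_notMem.1 hPA] with s hs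
  by_contra! hcon
  exact hs hcon

/-- The disintegrations of the chain identify the kernels with the conditional distributions of the
next time and the next state. The kernels are evaluated on the almost sure set of genuine mark
paths, where they equal the prescribed survival and jump laws. -/
theorem isPDMPWith_chain (hM : M.RegularJumps) (hν : M.IsAdmissible ν) (hx : x ∈ M.stateSpace) :
    M.IsPDMPWith ν x (chainLaw hM hν x) (fun t s => M.chainState ν s t) (fun n s => (s n).1)
      (fun n s => (s n).2) := by
  have hc : ∀ n, Measurable fun s : ℕ → Mark K => s n := measurable_pi_apply
  refine ⟨fun t _ => measurable_chainState hν t, fun n => (hc n).fst, fun n => (hc n).snd,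
    ?_, ?_, chainLaw_nonexplosive hM hν hx, ?_, ?_, fun n t ht => ?_, fun n A hA => ?_⟩
  · filter_upwards [chainLaw_initial hM hν x] with s hs
    rw [hs]
    exact ⟨rfl, rfl⟩
  · filter_upwards [ae_isMarkPath hM hν x] with s hs using hs.increasing
  · filter_upwards [ae_isMarkPath hM hν x] with s hs n hn
    have := hs.good hx hn.ne
    exact ⟨this.1, this.2.symm⟩
  · filter_upwards [ae_isMarkPath hM hν x] with s hs n t ht h1 h2
    exact chainState_eq hM hν hx hs (hx.1.1.trans ht.1) ht.2 h1 h2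
  · have := isMarkovKernel_histTime hM (hν.isPolicy n) n
    have h1 := condDistrib_ae_eq_condExp (μ := chainLaw hM hν x) (X := hist n)
      (Y := fun s => (s (n + 1)).1) (s := Ioi (ENNReal.ofReal t)) (measurable_hist n)
      (hc (n + 1)).fst measurableSet_Ioi
    have h2 := ae_of_ae_map (measurable_hist n).aemeasurable
      (condDistrib_ae_eq_of_measure_eq_compProd_of_measurable (measurable_hist n) (hc (n + 1)).fst
        (map_time_of_step hM (hν.isPolicy n) (measurable_hist n) (hc (n + 1))
          (chainLaw_step hM hν x n)))
    filter_upwards [h1, h2, ae_isMarkPath hM hν x] with s e1 e2 hs hle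
    refine e1.symm.trans ?_
    have hg := hs.good hx (hle.trans_lt ENNReal.ofReal_lt_top).ne
    have ht' : t ∈ Icc (s n).2.1 M.T := by
      rw [hg.2, ENNReal.ofReal_le_ofReal_iff (hx.1.1.trans ht.1)] at hle
      exact ⟨hle, ht.2⟩
    rw [e2, measureReal_def]
    change (M.timeKernel (ν n) (s n) (Ioi (ENNReal.ofReal t))).toReal = _
    rw [timeKernel_Ioi hM (hν.isPolicy n) hg ht', ENNReal.toReal_ofReal (Real.exp_pos _).le,
      cumRate_eq hM (hν.isPolicy n) hg.1 ⟨sub_nonneg.2 ht'.1, sub_le_sub_right ht'.2 _⟩]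
  · have := isMarkovKernel_histTime hM (hν.isPolicy n) n
    have hVT : Measurable fun s : ℕ → Mark K => (hist n s, (s (n + 1)).1) :=
      (measurable_hist n).prodMk (hc (n + 1)).fst
    have h1 := condDistrib_ae_eq_condExp (μ := chainLaw hM hν x)
      (X := fun s => (hist n s, (s (n + 1)).1)) (Y := fun s => (s (n + 1)).2) (s := A) hVT
      (hc (n + 1)).snd hA
    have e0 : MeasurableSpace.comap (fun s : ℕ → Mark K => (hist n s, (s (n + 1)).1)) inferInstance
        = MeasurableSpace.comap (hist n) inferInstance
          ⊔ MeasurableSpace.comap (fun s : ℕ → Mark K => (s (n + 1)).1) inferInstance :=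
      MeasurableSpace.comap_prodMk _ _
    rw [e0] at h1
    have h2 := ae_of_ae_map hVT.aemeasurable
      (condDistrib_ae_eq_of_measure_eq_compProd_of_measurable hVT (hc (n + 1)).snd
        (map_state_of_step hM (hν.isPolicy n) (measurable_hist n) (hc (n + 1))
          (chainLaw_step hM hν x n)))
    have h3 : ∀ᵐ s ∂(chainLaw hM hν x), (s n, (s (n + 1)).1) ∈ M.timeStep (ν n) := by
      have := ae_timeStep hM (hν.isPolicy n) (n := n) (μ := (chainLaw hM hν x).map (hist n))
      rw [← map_time_of_step hM (hν.isPolicy n) (measurable_hist n) (hc (n + 1))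
        (chainLaw_step hM hν x n)] at this
      exact ae_of_ae_map hVT.aemeasurable this
    filter_upwards [h1, h2, h3] with s e1 e2 hs hlt
    refine e1.symm.trans ?_
    obtain ⟨hg, hr, hj⟩ := hs.resolve_left hlt.ne
    have hu : (s (n + 1)).1.toReal - (s n).2.1 ∈ Icc 0 (M.T - (s n).2.1) :=
      ⟨sub_nonneg.2 hr.1.le, sub_le_sub_right hr.2 _⟩
    rw [e2]
    change (stateKernel hM (hν.isPolicy n) x (s n, (s (n + 1)).1)).real A = _
    rw [stateKernel_of_good hM (hν.isPolicy n) x hj, flow_eq hM (hν.isPolicy n) hg.1 hu,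
      polRate_eq (hν.isPolicy n) hg.1 (mem_Icc_of_horizon hg.1 hu)]
    rfl

end Model
end
end Liquidation

namespace Liquidation

noncomputable section

/-! ### Uniqueness of the process in law -/

section CondProb

variable {Ω : Type*} {m mΩ : MeasurableSpace Ω} {P : Measure Ω}

theorem condExp_indicator_empty : P⟦(∅ : Set Ω) | m⟧ = fun _ => 0 := by
  rw [indicator_empty]
  exact condExp_zero

variable [IsProbabilityMeasure P]

/-- Conditional probabilities of events that agree on a set of the conditioning `σ`-algebra agree
on this set. -/
theorem condExp_indicator_congr_on {S A B : Set Ω} (hS : MeasurableSet[m] S)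
    (hA : MeasurableSet A) (hB : MeasurableSet B) (h : ∀ᵐ ω ∂P, ω ∈ S → (ω ∈ A ↔ ω ∈ B)) :
    ∀ᵐ ω ∂P, ω ∈ S → (P⟦A | m⟧) ω = (P⟦B | m⟧) ω := by
  have hint : ∀ {A : Set Ω}, MeasurableSet A → Integrable (A.indicator fun _ => (1 : ℝ)) P :=
    fun hA => (integrable_const _).indicator hA
  have e : S.indicator (A.indicator fun _ => (1 : ℝ)) =ᵐ[P]
      S.indicator (B.indicator fun _ => (1 : ℝ)) := by
    filter_upwards [h] with ω hω
    by_cases hωS : ω ∈ S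
    · rw [indicator_of_mem hωS, indicator_of_mem hωS]
      by_cases hωA : ω ∈ A
      · rw [indicator_of_mem hωA, indicator_of_mem ((hω hωS).1 hωA)]
      · rw [indicator_of_notMem hωA, indicator_of_notMem fun hb => hωA ((hω hωS).2 hb)]
    · rw [indicator_of_notMem hωS, indicator_of_notMem hωS]
  filter_upwards [(condExp_indicator (hint hA) hS).symm.trans
    ((condExp_congr_ae e).trans (condExp_indicator (hint hB) hS))] with ω hω hωS
  rwa [indicator_of_mem hωS, indicator_of_mem hωS] at hω

theorem condExp_indicator_univ (hm : m ≤ mΩ) : P⟦(univ : Set Ω) | m⟧ = fun _ => 1 := by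
  rw [indicator_univ, condExp_const hm]

/-- A joint law is determined by the conditional probabilities of the sets of a `π`-system. -/
theorem map_prodMk_eq_compProd {α γ : Type*} [MeasurableSpace α] [mγ : MeasurableSpace γ]
    (hm : m ≤ mΩ) {V : Ω → α} {Y : Ω → γ} (hV : Measurable[m] V) (hY : Measurable Y)
    {κ : Kernel α γ} [IsMarkovKernel κ] {C : Set (Set γ)} (hC : mγ = MeasurableSpace.generateFrom C)
    (hpi : IsPiSystem C)
    (h : ∀ B ∈ C, ∀ᵐ ω ∂P, (P⟦Y ⁻¹' B | m⟧) ω = (κ (V ω)).real B) :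
    P.map (fun ω => (V ω, Y ω)) = P.map V ⊗ₘ κ := by
  have hV' : Measurable V := hV.mono hm le_rfl
  have hCm : ∀ B ∈ C, MeasurableSet B := fun B hB => by
    rw [hC]; exact MeasurableSpace.measurableSet_generateFrom hB
  have : IsProbabilityMeasure (P.map V) := Measure.isProbabilityMeasure_map hV'.aemeasurable
  have : IsProbabilityMeasure (P.map fun ω => (V ω, Y ω)) :=
    Measure.isProbabilityMeasure_map (hV'.prodMk hY).aemeasurable
  refine Measure.ext_prod fun {A B} hA hB => ?_
  -- For fixed `A` both sides are finite measures in the second coordinate, so agreement on the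
  -- `π`-system and of the total masses suffices. The former comes from integrating the conditional
  -- probability over `V ⁻¹' A`.
  have key : ((P.restrict (V ⁻¹' A)).map Y) = (κ ∘ₘ ((P.map V).restrict A)) := by
    refine ext_of_generate_finite C hC hpi (fun B hB => ?_) ?_
    · rw [Measure.map_apply hY (hCm B hB), Measure.restrict_apply (hY (hCm B hB)),
        Measure.bind_apply (hCm B hB) κ.aemeasurable, Measure.restrict_map hV' hA,
        lintegral_map (κ.measurable_coe (hCm B hB)) hV']
      have hκ : Measurable fun ω => (κ (V ω)).real B :=
        ((κ.measurable_coe (hCm B hB)).comp hV').ennreal_toReal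
      have h1 : ∫ ω in V ⁻¹' A, (κ (V ω)).real B ∂P
          = ∫ ω in V ⁻¹' A, (Y ⁻¹' B).indicator (fun _ => (1 : ℝ)) ω ∂P := by
        rw [← setIntegral_condExp (f := (Y ⁻¹' B).indicator fun _ => (1 : ℝ)) hm
          ((integrable_const _).indicator (hY (hCm B hB))) (hV hA)]
        exact setIntegral_congr_ae (hm _ (hV hA)) ((h B hB).mono fun ω hω _ => hω.symm)
      rw [setIntegral_indicator (hY (hCm B hB)), setIntegral_const, smul_eq_mul, mul_one,
        inter_comm] at h1
      rw [← ENNReal.toReal_eq_toReal_iff' (measure_ne_top _ _), ← measureReal_def, ← h1]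
      · exact integral_toReal ((κ.measurable_coe (hCm B hB)).comp hV').aemeasurable
          (ae_of_all _ fun ω => measure_lt_top _ _)
      · refine (lt_of_le_of_lt (lintegral_mono fun ω => prob_le_one) ?_).ne
        rw [lintegral_const, one_mul]
        exact measure_lt_top _ _
    · rw [Measure.map_apply hY .univ, preimage_univ, Measure.bind_apply .univ κ.aemeasurable]
      simp only [measure_univ, lintegral_const, one_mul, Measure.restrict_apply_univ]
      rw [Measure.map_apply hV' hA]
  rw [Measure.compProd_apply_prod hA hB, Measure.map_apply (hV'.prodMk hY) (hA.prod hB),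
    ← Measure.bind_apply hB κ.aemeasurable, ← key, Measure.map_apply hY hB,
    Measure.restrict_apply (hY hB), inter_comm]
  rfl

end CondProb

variable {K : ℕ}

namespace Model

variable {M : Model K} {β : State K → ℝ → ℝ} {ν : ℕ → State K → ℝ → ℝ} {x : State K}

/-- The history up to the next mark. -/
def histSnoc (n : ℕ) (p : (Finset.Iic n → Mark K) × Mark K) : Finset.Iic (n + 1) → Mark K :=
  fun k => if h : (k : ℕ) ≤ n then p.1 ⟨k, Finset.mem_Iic.2 h⟩ else p.2

theorem measurable_histSnoc (n : ℕ) : Measurable (histSnoc (K := K) n) := by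
  refine measurable_pi_lambda _ fun k => ?_
  by_cases h : (k : ℕ) ≤ n
  · simp only [histSnoc, dif_pos h]
    exact ((measurable_pi_apply (X := fun _ : Finset.Iic n => Mark K) _).comp measurable_fst :)
  · simpa only [histSnoc, dif_neg h] using measurable_snd

theorem hist_succ (n : ℕ) (s : ℕ → Mark K) : hist (n + 1) s = histSnoc n (hist n s, s (n + 1)) := by
  funext k
  by_cases h : (k : ℕ) ≤ n
  · rw [histSnoc, dif_pos h]; rfl
  · rw [histSnoc, dif_neg h]
    have := Finset.mem_Iic.1 k.2
    exact congrArg s (by omega)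

/-- The law of a sequence is determined by the laws of its initial segments. -/
theorem measure_ext_of_hist {μ μ' : Measure (ℕ → Mark K)} [IsFiniteMeasure μ]
    (h : ∀ n, μ.map (hist n) = μ'.map (hist n)) : μ = μ' := by
  have hp : IsProjectiveMeasureFamily (α := fun _ : ℕ => Mark K)
      fun I => μ.map fun s (k : I) => s k := by
    intro I J hJI
    rw [Measure.map_map (Finset.measurable_restrict₂ (X := fun _ : ℕ => Mark K) hJI) (by fun_prop)]
    rfl
  have h1 : IsProjectiveLimit (α := fun _ : ℕ => Mark K) μ fun I => μ.map fun s (k : I) => s k :=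
    fun I => rfl
  have h2 : IsProjectiveLimit (α := fun _ : ℕ => Mark K) μ' fun I => μ.map fun s (k : I) => s k :=
    (isProjectiveLimit_nat_iff hp μ').2 fun n => (h n).symm
  exact h1.unique h2

/-- The law of the chain of the marks is determined by its initial state and its transitions. -/
theorem eq_chainLaw (hM : M.RegularJumps) (hν : M.IsAdmissible ν) {μ : Measure (ℕ → Mark K)}
    [IsProbabilityMeasure μ] (h0 : ∀ᵐ s ∂μ, s 0 = (ENNReal.ofReal x.1, x))
    (h : ∀ n, μ.map (fun s => (hist n s, s (n + 1)))
      = μ.map (hist n) ⊗ₘ histKernel hM (hν.isPolicy n) x n) :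
    μ = chainLaw hM hν x := by
  refine measure_ext_of_hist fun n => ?_
  induction n with
  | zero =>
    have e : ∀ {P : Measure (ℕ → Mark K)} [IsProbabilityMeasure P],
        (∀ᵐ s ∂P, s 0 = (ENNReal.ofReal x.1, x)) →
          P.map (hist 0) = Measure.dirac fun _ => (ENNReal.ofReal x.1, x) := by
      intro P _ hP
      have hc : hist 0 =ᵐ[P] fun _ _ => (ENNReal.ofReal x.1, x) := by
        filter_upwards [hP] with s hs
        funext k
        have : (k : ℕ) = 0 := Nat.le_zero.1 (Finset.mem_Iic.1 k.2)
        rw [hist, this, hs]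
      rw [Measure.map_congr hc, Measure.map_const, measure_univ, one_smul]
    rw [e h0, e (chainLaw_initial hM hν x)]
  | succ n ih =>
    have e : ∀ P : Measure (ℕ → Mark K), P.map (hist (n + 1))
        = (P.map fun s => (hist n s, s (n + 1))).map (histSnoc n) := by
      intro P
      rw [Measure.map_map (measurable_histSnoc n)
        ((measurable_hist n).prodMk (measurable_pi_apply _))]
      exact congrArg P.map (funext fun s => hist_succ n s)
    rw [e, e, h, chainLaw_step, ih]

open Classical in
/-- The mark with a fixed state if there is no further jump. -/
def normMark (x : State K) (e : Mark K) : Mark K := if e.1 = ⊤ then (⊤, x) else e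

theorem measurable_normMark (x : State K) : Measurable (normMark x) :=
  Measurable.ite ((measurableSet_singleton ⊤).preimage measurable_fst) measurable_const
    measurable_id

theorem normMark_fst (x : State K) (e : Mark K) : (normMark x e).1 = e.1 := by
  by_cases h : e.1 = ⊤
  · rw [normMark, if_pos h, h]
  · rw [normMark, if_neg h]

theorem normMark_of_ne (x : State K) {e : Mark K} (h : e.1 ≠ ⊤) : normMark x e = e := if_neg h

theorem normMark_of_eq (x : State K) {e : Mark K} (h : e.1 = ⊤) : normMark x e = (⊤, x) := if_pos h

section Marks

variable {Ω : Type*} {Tn : ℕ → Ω → ℝ≥0∞} {Z : ℕ → Ω → State K}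

/-- The sequence of the marks of a process. -/
def marks (x : State K) (Tn : ℕ → Ω → ℝ≥0∞) (Z : ℕ → Ω → State K) (ω : Ω) (n : ℕ) : Mark K :=
  normMark x (Tn n ω, Z n ω)

theorem marks_fst (n : ℕ) (ω : Ω) : (marks x Tn Z ω n).1 = Tn n ω := normMark_fst _ _

theorem marks_of_ne {n : ℕ} {ω : Ω} (h : Tn n ω ≠ ⊤) : marks x Tn Z ω n = (Tn n ω, Z n ω) :=
  normMark_of_ne x h

theorem marks_of_eq {n : ℕ} {ω : Ω} (h : Tn n ω = ⊤) : marks x Tn Z ω n = (⊤, x) :=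
  normMark_of_eq x h

theorem measurable_hist_marks (n : ℕ) :
    Measurable[jumpHist Tn Z n] fun ω => hist n (marks x Tn Z ω) := by
  refine (measurable_pi_lambda (fun (f : Finset.Iic n → Mark K) k => normMark x (f k)) fun k =>
    (measurable_normMark x).comp (measurable_pi_apply k)).comp
      (comap_measurable fun ω (k : Finset.Iic n) => (Tn k ω, Z k ω))

theorem measurable_last_jumpHist (n : ℕ) : Measurable[jumpHist Tn Z n] (Tn n) :=
  ((measurable_pi_apply (X := fun _ : Finset.Iic n => Mark K)
    ⟨n, Finset.mem_Iic.2 le_rfl⟩).fst).comp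
      (comap_measurable fun ω (k : Finset.Iic n) => (Tn k ω, Z k ω))

/-- The history up to the next jump time. -/
abbrev jumpTimeHist (Tn : ℕ → Ω → ℝ≥0∞) (Z : ℕ → Ω → State K) (n : ℕ) : MeasurableSpace Ω :=
  jumpHist Tn Z n ⊔ MeasurableSpace.comap (Tn (n + 1)) inferInstance

end Marks

section PathLaw

variable {Ω : Type*} [mΩ : MeasurableSpace Ω] {P : Measure Ω} {X : ℝ → Ω → State K}
  {Tn : ℕ → Ω → ℝ≥0∞} {Z : ℕ → Ω → State K}

theorem IsPDMPWith.measurable_marks (h : M.IsPDMPWith ν x P X Tn Z) :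
    Measurable (marks x Tn Z) :=
  measurable_pi_lambda _ fun n =>
    (measurable_normMark x).comp ((h.measurable_T n).prodMk (h.measurable_Z n))

theorem IsPDMPWith.jumpHist_le (h : M.IsPDMPWith ν x P X Tn Z) (n : ℕ) : jumpHist Tn Z n ≤ mΩ :=
  Measurable.comap_le (f := fun ω (k : Finset.Iic n) => (Tn k ω, Z k ω))
    (measurable_pi_lambda _ fun k => (h.measurable_T k).prodMk (h.measurable_Z k))

theorem IsPDMPWith.ae_good (h : M.IsPDMPWith ν x P X Tn Z) :
    ∀ᵐ ω ∂P, ∀ n, Tn n ω ≠ ⊤ → marks x Tn Z ω n = (Tn n ω, Z n ω) ∧ marks x Tn Z ω n ∈ M.goodMark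
        := by
  filter_upwards [h.mem] with ω hω n hn
  have := hω n (lt_top_iff_ne_top.2 hn)
  rw [marks_of_ne hn]
  exact ⟨rfl, this.1, this.2.symm⟩

theorem IsPDMPWith.ae_ge (h : M.IsPDMPWith ν x P X Tn Z) :
    ∀ᵐ ω ∂P, ∀ n, ENNReal.ofReal x.1 ≤ Tn n ω := by
  filter_upwards [h.initial, h.increasing] with ω h0 h1 n
  induction n with
  | zero => exact h0.1.ge
  | succ n ih =>
    rcases eq_or_ne (Tn n ω) ⊤ with ht | ht
    · rw [(h1 n).2 ht]; exact le_top
    · exact ih.trans ((h1 n).1 (lt_top_iff_ne_top.2 ht)).le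

theorem IsPDMPWith.ae_le_horizon (h : M.IsPDMPWith ν x P X Tn Z) :
    ∀ᵐ ω ∂P, ∀ n, Tn n ω ≠ ⊤ → Tn n ω ≤ ENNReal.ofReal M.T := by
  filter_upwards [h.mem] with ω hω n hn
  have := hω n (lt_top_iff_ne_top.2 hn)
  rw [← this.2]
  exact ENNReal.ofReal_le_ofReal this.1.1.2

variable [IsProbabilityMeasure P]

/-- The survival property speaks only of times after the `n`-th jump. This extends it to every
threshold in `[0, T]`, as is needed to determine a measure on the `π`-system of rays. -/
theorem IsPDMPWith.condProb_time (h : M.IsPDMPWith ν x P X Tn Z) (hM : M.RegularJumps)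
    (hν : M.IsAdmissible ν) (n : ℕ) {t : ℝ} (h0 : 0 ≤ t) (ht : t ≤ M.T) :
    ∀ᵐ ω ∂P, (P⟦{ω' | ENNReal.ofReal t < Tn (n + 1) ω'} | jumpHist Tn Z n⟧) ω
      = (histTime M (ν n) n (hist n (marks x Tn Z ω))).real (Ioi (ENNReal.ofReal t)) := by
  have hβ := hν.isPolicy n
  have hmk := isMarkovKernel_timeKernel hM hβ
  have hm := h.jumpHist_le n
  have h1 : ∀ᵐ ω ∂P, Tn n ω ≤ ENNReal.ofReal t →
      (P⟦{ω' | ENNReal.ofReal t < Tn (n + 1) ω'} | jumpHist Tn Z n⟧) ω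
        = (M.timeKernel (ν n) (marks x Tn Z ω n)).real (Ioi (ENNReal.ofReal t)) := by
    by_cases htx : x.1 ≤ t
    · filter_upwards [h.survival n t ⟨htx, ht⟩, h.ae_good] with ω h1 h2 hle
      rw [h1 hle]
      obtain ⟨e, hg⟩ := h2 n (hle.trans_lt ENNReal.ofReal_lt_top).ne
      rw [e] at hg ⊢
      have ht' : t ∈ Icc (Z n ω).1 M.T := by
        rw [show Tn n ω = ENNReal.ofReal (Z n ω).1 from hg.2,
          ENNReal.ofReal_le_ofReal_iff h0] at hle
        exact ⟨hle, ht⟩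
      rw [measureReal_def, timeKernel_Ioi hM hβ hg ht', ENNReal.toReal_ofReal (Real.exp_pos _).le,
        cumRate_eq hM hβ hg.1 ⟨sub_nonneg.2 ht'.1, sub_le_sub_right ht'.2 _⟩]
    · filter_upwards [h.ae_ge] with ω hω hle
      have := (hω n).trans hle
      rw [ENNReal.ofReal_le_ofReal_iff h0] at this
      exact absurd this htx
  -- If the `n`-th jump is later than `t`, so is the next one. This event belongs to the history,
  -- and the conditional probability on it is one.
  have h2 : ∀ᵐ ω ∂P, ω ∈ {ω | ENNReal.ofReal t < Tn n ω} →
      (P⟦{ω' | ENNReal.ofReal t < Tn (n + 1) ω'} | jumpHist Tn Z n⟧) ω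
        = (P⟦(univ : Set Ω) | jumpHist Tn Z n⟧) ω := by
    refine condExp_indicator_congr_on
      (measurable_last_jumpHist n measurableSet_Ioi)
          (h.measurable_T (n + 1) measurableSet_Ioi) .univ ?_
    filter_upwards [h.increasing] with ω hω hlt
    refine iff_of_true ?_ trivial
    rcases eq_or_ne (Tn n ω) ⊤ with htop | htop
    · exact ((hω n).2 htop).symm ▸ ENNReal.ofReal_lt_top
    · exact lt_trans hlt ((hω n).1 (lt_top_iff_ne_top.2 htop))
  filter_upwards [h1, h2, h.ae_good] with ω e1 e2 e3
  rcases le_or_gt (Tn n ω) (ENNReal.ofReal t) with hle | hlt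
  · exact e1 hle
  · rw [e2 hlt, condExp_indicator_univ hm]
    change 1 = (M.timeKernel (ν n) (marks x Tn Z ω n)).real _
    rw [measureReal_def, (prob_compl_eq_zero_iff measurableSet_Ioi).1, ENNReal.toReal_one]
    have hae : ∀ᵐ r ∂(M.timeKernel (ν n) (marks x Tn Z ω n)), r ∈ Ioi (ENNReal.ofReal t) := by
      filter_upwards [ae_timeKernel hβ (marks x Tn Z ω n)] with r hr
      rcases hr with rfl | ⟨hg, hr, hr', -⟩
      · exact ENNReal.ofReal_lt_top
      · refine lt_trans hlt ?_
        rw [← marks_fst (x := x) (Tn := Tn) (Z := Z), hg.2, ENNReal.ofReal_lt_iff_lt_toReal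
            hg.1.1.1 hr]
        exact hr'.1
    exact hae

/-- The joint law of the history and of the next jump time. -/
theorem IsPDMPWith.map_time (h : M.IsPDMPWith ν x P X Tn Z) (hM : M.RegularJumps)
    (hν : M.IsAdmissible ν) (n : ℕ) :
    P.map (fun ω => (hist n (marks x Tn Z ω), Tn (n + 1) ω))
      = P.map (fun ω => hist n (marks x Tn Z ω)) ⊗ₘ histTime M (ν n) n := by
  have hβ := hν.isPolicy n
  have hmk := isMarkovKernel_histTime hM hβ n
  have hm := h.jumpHist_le n
  refine map_prodMk_eq_compProd hm (measurable_hist_marks n) (h.measurable_T (n + 1))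
    (BorelSpace.measurable_eq.trans (borel_eq_generateFrom_Ioi _)) isPiSystem_Ioi ?_
  rintro _ ⟨a, rfl⟩
  change ∀ᵐ ω ∂P, (P⟦{ω' | a < Tn (n + 1) ω'} | jumpHist Tn Z n⟧) ω = _
  rcases eq_or_ne a ⊤ with rfl | ha
  · refine ae_of_all _ fun ω => ?_
    rw [Ioi_top, measureReal_empty, show {ω' | ⊤ < Tn (n + 1) ω'} = ∅ by simp,
      condExp_indicator_empty]
  rcases le_or_gt a (ENNReal.ofReal M.T) with haT | haT
  · have := h.condProb_time hM hν n (t := a.toReal) ENNReal.toReal_nonneg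
      (ENNReal.toReal_le_of_le_ofReal M.T_pos.le haT)
    rwa [ENNReal.ofReal_toReal ha] at this
  -- Neither the process nor the kernel charges finite times after the horizon, so a finite
  -- threshold beyond `T` may be replaced by `T`.
  · have h1 : ∀ᵐ ω ∂P, ω ∈ (univ : Set Ω) → (P⟦{ω' | a < Tn (n + 1) ω'} | jumpHist Tn Z n⟧) ω
        = (P⟦{ω' | ENNReal.ofReal M.T < Tn (n + 1) ω'} | jumpHist Tn Z n⟧) ω := by
      refine condExp_indicator_congr_on .univ (h.measurable_T (n + 1) measurableSet_Ioi)
        (h.measurable_T (n + 1) measurableSet_Ioi) ?_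
      filter_upwards [h.ae_le_horizon] with ω hω _
      refine ⟨fun hl => haT.trans hl, fun hl => ?_⟩
      by_contra hcon
      exact absurd (hω (n + 1) fun htop => hcon (htop ▸ lt_top_iff_ne_top.2 ha)) (not_le.2 hl)
    filter_upwards [h1, h.condProb_time hM hν n M.T_pos.le le_rfl] with ω e1 e2
    rw [e1 trivial, e2]
    refine measureReal_congr ?_
    have : ∀ᵐ r ∂(histTime M (ν n) n (hist n (marks x Tn Z ω))),
        r ≠ ⊤ → r ≤ ENNReal.ofReal M.T := by
      filter_upwards [ae_timeKernel hβ (marks x Tn Z ω n)] with r hr hne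
      rcases hr with hr | ⟨-, -, hr, -⟩
      · exact absurd hr hne
      · exact (ENNReal.le_ofReal_iff_toReal_le hne M.T_pos.le).2 hr.2
    filter_upwards [this] with r hr
    refine propext ⟨fun hl => ?_, fun hl => haT.trans hl⟩
    by_contra hcon
    exact absurd (hr fun htop => hcon (htop ▸ lt_top_iff_ne_top.2 ha)) (not_le.2 hl)

/-- The joint law of the history, of the next jump time and of the next state. -/
theorem IsPDMPWith.map_state (h : M.IsPDMPWith ν x P X Tn Z) (hM : M.RegularJumps)
    (hν : M.IsAdmissible ν) (n : ℕ) :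
    P.map (fun ω => ((hist n (marks x Tn Z ω), Tn (n + 1) ω), (marks x Tn Z ω (n + 1)).2))
      = P.map (fun ω => (hist n (marks x Tn Z ω), Tn (n + 1) ω)) ⊗ₘ
        histState hM (hν.isPolicy n) x n := by
  have hβ := hν.isPolicy n
  have hmarks : Measurable fun ω => marks x Tn Z ω (n + 1) :=
    measurable_pi_iff.1 h.measurable_marks (n + 1)
  have hm : jumpTimeHist Tn Z n ≤ mΩ := sup_le (h.jumpHist_le n) (h.measurable_T (n + 1)).comap_le
  have hT : Measurable[jumpTimeHist Tn Z n] (Tn (n + 1)) :=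
      (comap_measurable _).mono le_sup_right le_rfl
  have hV : Measurable[jumpTimeHist Tn Z n] fun ω => (hist n (marks x Tn Z ω), Tn (n + 1) ω) :=
    ((measurable_hist_marks n).mono le_sup_left le_rfl).prodMk hT
  refine map_prodMk_eq_compProd hm hV hmarks.snd
    (MeasurableSpace.generateFrom_measurableSet).symm
    MeasurableSpace.isPiSystem_measurableSet fun A (hA : MeasurableSet A) => ?_
  have hS : MeasurableSet[jumpTimeHist Tn Z n] {ω | Tn (n + 1) ω = ⊤} := hT
      (measurableSet_singleton ⊤)
  have h1 : ∀ᵐ ω ∂P, ω ∈ {ω | Tn (n + 1) ω = ⊤}ᶜ →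
      (P⟦(fun ω => (marks x Tn Z ω (n + 1)).2) ⁻¹' A | jumpTimeHist Tn Z n⟧) ω =
          (P⟦Z (n + 1) ⁻¹' A | jumpTimeHist Tn Z n⟧) ω := by
    refine condExp_indicator_congr_on hS.compl (hmarks.snd hA) (h.measurable_Z _ hA)
      (ae_of_all _ fun ω hω => ?_)
    rw [mem_preimage, marks_of_ne hω]
    rfl
  -- If there is no further jump, the state `Z (n + 1)` is unconstrained. The normalized mark is `x`
  -- there, matching the Dirac mass that the kernel uses by default.
  have h2 : ∀ᵐ ω ∂P, ω ∈ {ω | Tn (n + 1) ω = ⊤} →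
      (P⟦(fun ω => (marks x Tn Z ω (n + 1)).2) ⁻¹' A | jumpTimeHist Tn Z n⟧) ω =
          (P⟦{_ω : Ω | x ∈ A} | jumpTimeHist Tn Z n⟧) ω := by
    refine condExp_indicator_congr_on hS (hmarks.snd hA) (MeasurableSet.const _)
      (ae_of_all _ fun ω hω => ?_)
    rw [mem_preimage, marks_of_eq hω]
    rfl
  have h3 : ∀ᵐ ω ∂P, (marks x Tn Z ω n, Tn (n + 1) ω) ∈ M.timeStep (ν n) := by
    have := ae_timeStep hM hβ (n := n) (μ := P.map fun ω => hist n (marks x Tn Z ω))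
    rw [← h.map_time hM hν n] at this
    exact ae_of_ae_map (hV.mono hm le_rfl).aemeasurable this
  filter_upwards [h1, h2, h3, h.jump_law n A hA, h.ae_good] with ω e1 e2 hs e4 e5
  change _ = (stateKernel hM hβ x (marks x Tn Z ω n, Tn (n + 1) ω)).real A
  by_cases htop : Tn (n + 1) ω = ⊤
  · rw [e2 htop, htop, stateKernel_top, measureReal_def, Measure.dirac_apply' _ hA]
    by_cases hxA : x ∈ A
    · rw [show {_ω : Ω | x ∈ A} = univ from eq_univ_of_forall fun _ => hxA,
        condExp_indicator_univ hm, indicator_of_mem hxA]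
      rfl
    · rw [show {_ω : Ω | x ∈ A} = ∅ from eq_empty_of_forall_notMem fun _ => hxA,
        condExp_indicator_empty, indicator_of_notMem hxA]
      rfl
  · obtain ⟨hg, hr, hj⟩ := hs.resolve_left htop
    have hn : Tn n ω ≠ ⊤ := by
      rw [← marks_fst (x := x) (Tn := Tn) (Z := Z), hg.2]
      exact ENNReal.ofReal_ne_top
    rw [e1 htop, e4 (lt_top_iff_ne_top.2 htop), stateKernel_of_good hM hβ x hj]
    have e6 : (marks x Tn Z ω n).2 = Z n ω := by rw [(e5 n hn).1]
    have hu : (Tn (n + 1) ω).toReal - (marks x Tn Z ω n).2.1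
        ∈ Icc 0 (M.T - (marks x Tn Z ω n).2.1) :=
      ⟨sub_nonneg.2 hr.1.le, sub_le_sub_right hr.2 _⟩
    rw [← e6, flow_eq hM hβ hg.1 hu, polRate_eq hβ hg.1 (mem_Icc_of_horizon hg.1 hu)]
    rfl

/-- The laws of the next time and the next state combine to the transition kernel of the chain, so
the marks of every PDMP have a law that depends only on the model, the strategy and the starting
point. -/
theorem IsPDMPWith.map_marks (h : M.IsPDMPWith ν x P X Tn Z) (hM : M.RegularJumps)
    (hν : M.IsAdmissible ν) :
    P.map (marks x Tn Z) = chainLaw hM hν x := by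
  have : IsProbabilityMeasure (P.map (marks x Tn Z)) :=
    Measure.isProbabilityMeasure_map h.measurable_marks.aemeasurable
  refine eq_chainLaw hM hν ?_ fun n => ?_
  · refine (ae_map_iff h.measurable_marks.aemeasurable
      (measurableSet_eq_fun (measurable_pi_apply 0) measurable_const)).2 ?_
    filter_upwards [h.initial] with ω hω
    rw [marks_of_ne (by rw [hω.1]; exact ENNReal.ofReal_ne_top), hω.1, hω.2]
  · have hmk := isMarkovKernel_histTime hM (hν.isPolicy n) n
    have hV : Measurable fun ω => (hist n (marks x Tn Z ω), Tn (n + 1) ω) :=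
      ((measurable_hist n).comp h.measurable_marks).prodMk (h.measurable_T _)
    have hE : Measurable fun ω => (marks x Tn Z ω (n + 1)).2 :=
      (measurable_pi_iff.1 h.measurable_marks (n + 1)).snd
    have e := congrArg (Measure.map MeasurableEquiv.prodAssoc) (h.map_state hM hν n)
    rw [h.map_time hM hν n, Measure.compProd_assoc', ← histKernel,
      Measure.map_map (MeasurableEquiv.measurable _) (hV.prodMk hE)] at e
    rw [Measure.map_map ((measurable_hist n).prodMk (measurable_pi_apply _)) h.measurable_marks,
      Measure.map_map (measurable_hist n) h.measurable_marks]
    refine Eq.trans (congrArg P.map (funext fun ω => ?_)) e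
    change (_, marks x Tn Z ω (n + 1)) = (_, (Tn (n + 1) ω, _))
    rw [← marks_fst (x := x) (Tn := Tn) (Z := Z)]

/-- Almost surely each time lies between two consecutive jump times, since these do not accumulate.
The path is thus a fixed measurable function of the marks, and its law is the image of `chainLaw`.
-/
theorem IsPDMPWith.pathLaw_eq (h : M.IsPDMPWith ν x P X Tn Z) (hM : M.RegularJumps)
    (hν : M.IsAdmissible ν) (hx : x ∈ M.stateSpace) :
    M.pathLaw x.1 P X
      = (chainLaw hM hν x).map fun s (t : Icc x.1 M.T) => M.chainState ν s t := by
  have hs : ∀ᵐ ω ∂P, M.IsMarkPath x (marks x Tn Z ω) := by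
    have := ae_isMarkPath hM hν x
    rw [← h.map_marks hM hν] at this
    exact ae_of_ae_map h.measurable_marks.aemeasurable this
  have e : (fun ω (t : Icc x.1 M.T) => X t ω) =ᵐ[P]
      fun ω (t : Icc x.1 M.T) => M.chainState ν (marks x Tn Z ω) t := by
    filter_upwards [hs, h.initial, h.nonexplosive, h.eq_flow] with ω hω h0 hne hflow
    funext t
    obtain ⟨n, h1, h2⟩ : ∃ n, Tn n ω ≤ ENNReal.ofReal t ∧ ENNReal.ofReal t < Tn (n + 1) ω := by
      by_contra! hcon
      obtain ⟨n, hn⟩ := hne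
      have : ∀ k, Tn k ω ≤ ENNReal.ofReal t := fun k => by
        induction k with
        | zero => rw [h0.1]; exact ENNReal.ofReal_le_ofReal t.2.1
        | succ k ih => exact hcon k ih
      exact absurd (this n) (by rw [hn]; exact not_le.2 ENNReal.ofReal_lt_top)
    rw [hflow n t t.2 h1 h2, chainState_eq hM hν hx hω (hx.1.1.trans t.2.1) t.2.2
      (by rwa [marks_fst]) (by rwa [marks_fst]),
      marks_of_ne (h1.trans_lt ENNReal.ofReal_lt_top).ne]
  rw [pathLaw, Measure.map_congr e, ← h.map_marks hM hν,
    Measure.map_map (measurable_pi_lambda (fun s (t : Icc x.1 M.T) => M.chainState ν s t)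
      fun t => measurable_chainState hν t)
      h.measurable_marks]
  rfl

end PathLaw

end Model
end
end Liquidation

/-- Existence and uniqueness of the controlled PDMP and of the solution of the
Kushner-Stratonovich equation. -/
theorem proposition4p1 {K : ℕ} (M : Liquidation.Model K) (hM : M.RegularJumps)
    (ν : ℕ → Liquidation.State K → ℝ → ℝ) (hν : M.IsAdmissible ν)
    (x : Liquidation.State K) (hx : x ∈ M.stateSpace) :
    -- the controlled ODE between jumps is uniquely solvable
    (∀ n, ∀ y ∈ M.stateSpace, (∃ φ, M.IsFlow (ν n y) y φ) ∧
      ∀ φ φ', M.IsFlow (ν n y) y φ → M.IsFlow (ν n y) y φ' →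
        EqOn φ φ' (Icc 0 (M.T - y.1))) ∧
    -- existence of the PDMP
    (∃ (Ω : Type) (_ : MeasurableSpace Ω) (P : Measure Ω) (_ : IsProbabilityMeasure P)
      (X : ℝ → Ω → Liquidation.State K), M.IsPDMP ν x P X) ∧
    -- uniqueness of the PDMP in law
    (∀ (Ω : Type u) (Ω' : Type v) [MeasurableSpace Ω] [MeasurableSpace Ω']
      (P : Measure Ω) (P' : Measure Ω') [IsProbabilityMeasure P] [IsProbabilityMeasure P']
      (X : ℝ → Ω → Liquidation.State K) (X' : ℝ → Ω' → Liquidation.State K),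
      M.IsPDMP ν x P X → M.IsPDMP ν x P' X' → M.pathLaw x.1 P X = M.pathLaw x.1 P' X') ∧
    -- under the open-loop strategy, the state equation, with the Kushner-Stratonovich equation
    -- for the filter, has a unique solution, which is adapted to the observed returns
    (∀ (Ω : Type u) (τ : ℕ → Ω → ℝ≥0∞) (ζ : ℕ → Ω → ℝ),
      (∀ ω, M.IsReturnPath x.1 (fun n => τ n ω) (fun n => ζ n ω)) →
      ∃ X : ℝ → Ω → Liquidation.State K,
        (∀ t ∈ Icc x.1 M.T,
          Measurable[Liquidation.Model.returnFiltration τ ζ t] (X t)) ∧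
        ∀ ω, M.SolvesState ν x (fun n => τ n ω) (fun n => ζ n ω) (fun t => X t ω) ∧
          ∀ X' : ℝ → Liquidation.State K,
            M.SolvesState ν x (fun n => τ n ω) (fun n => ζ n ω) X' →
              EqOn X' (fun t => X t ω) (Icc x.1 M.T)) ∧
    -- the Kushner-Stratonovich equation has a unique solution, which is adapted to the observed
    -- returns, for every selling rate that is adapted to them
    (∀ (Ω : Type u) (τ : ℕ → Ω → ℝ≥0∞) (ζ : ℕ → Ω → ℝ) (rate : ℝ → Ω → ℝ),
      (∀ ω, M.IsReturnPath x.1 (fun n => τ n ω) (fun n => ζ n ω)) →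
      (∀ t ∈ Icc x.1 M.T, ∀ ω, rate t ω ∈ Icc 0 M.νmax) →
      (∀ t ∈ Icc x.1 M.T,
        Measurable[(Liquidation.Model.returnFiltration τ ζ t).prod inferInstance]
          fun p : Ω × Icc x.1 t => rate p.2 p.1) →
      ∃ π : ℝ → Ω → Fin K → ℝ,
        (∀ t ∈ Icc x.1 M.T,
          Measurable[Liquidation.Model.returnFiltration τ ζ t] (π t)) ∧
        ∀ ω, M.SolvesKS x.1 x.2.2.2 (fun n => τ n ω) (fun n => ζ n ω)
            (fun t => rate t ω) (fun t => π t ω) ∧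
          ∀ π' : ℝ → Fin K → ℝ,
            M.SolvesKS x.1 x.2.2.2 (fun n => τ n ω) (fun n => ζ n ω)
              (fun t => rate t ω) π' →
                EqOn π' (fun t => π t ω) (Icc x.1 M.T)) := by
  refine ⟨fun n y hy => ⟨⟨_, Liquidation.Model.isFlow_flowSol hM (hν.isPolicy n) hy⟩,
      fun φ φ' h h' => (h.eqOn_flowSol hM (hν.isPolicy n) hy).trans
        (h'.eqOn_flowSol hM (hν.isPolicy n) hy).symm⟩,
    ⟨ℕ → Liquidation.Model.Mark K, inferInstance, Liquidation.Model.chainLaw hM hν x, inferInstance,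
      fun t s => M.chainState ν s t, _, _, Liquidation.Model.isPDMPWith_chain hM hν hx⟩,
    ?_, fun Ω τ ζ hτ => ?_, fun Ω τ ζ rate hτ hr hrm =>
      Liquidation.Model.exists_solvesKS hM ⟨hx.1.1, hx.1.2⟩ hx.2.2.2 τ ζ rate hτ hr hrm⟩
  · rintro Ω Ω' _ _ P P' _ _ X X' ⟨Tn, Z, h⟩ ⟨Tn', Z', h'⟩
    rw [h.pathLaw_eq hM hν hx, h'.pathLaw_eq hM hν hx]
  · exact ⟨fun t ω => M.olSol ν x (fun n => τ n ω) (fun n => ζ n ω) t,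
      fun t ht => Liquidation.Model.measurable_olSol hν hx.1.1 hτ ht,
      fun ω => ⟨Liquidation.Model.solvesState_olSol hM hν hx (hτ ω),
        fun X' hX' => hX'.eqOn_olSol hM hν hx (hτ ω)⟩⟩
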